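/- **Setting.** $(V,E)$ is a finite directed multigraph with $N\ge 1$ origin/destination pairs. Pair $i$ has an origin $O^i$, a destination $D^i\neq O^i$, a demand $m_i>0$ and an acyclic subgraph with edge set $E^i$ (with a fixed topological order) which contains at least one path from $O^i$ to $D^i$. Let $\mathcal P^i$ be the set of these paths, $P=\sum_i|\mathcal P^i|$, $M_{\rm tot}=\sum_i m_i$. A flow is $f=(f^i_p)_{p\in\mathcal P^i}$ with $f\ge 0$ and $\sum_{p\in\mathcal P^i}f^i_p=m_i$; its load on $e$ is $\ell_e(f)=\sum_i\sum_{p\ni e}f^i_p$. Edge costs $c_e(x,\omega)$ depend on the load $x\in[0,M_{\rm tot}]$ and on a random state $\omega\sim\mu$; they are measurable in $\omega$ and nondecreasing, uniformly bounded and $L$-Lipschitz in $x$. Put $\bar c_e(x)=\mathbb E\,c_e(x,\omega)$, $\Phi(f)=\sum_e\int_0^{\ell_e(f)}\bar c_e(x)\,dx$, $\mathrm{Gap}(f)=\Phi(f)-\min\Phi$. For $u\in\mathbb R^E$ let $\|u\|=\max_{p}\sum_{e\in p}|u_e|$ (maximum over all paths of all pairs), and let $\sigma^2=\sup_f\mathbb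 E\,\|(c_e(\ell_e(f),\omega)-\bar c_e(\ell_e(f)))_e\|^2$. A profile of local flows $y=(y^i_e)_{e\in E^i}$ sends the share $y^i_e$ of the type-$i$ traffic that arrives at the tail of $e$ along $e$. The arriving masses $a^i_v$ and the loads $\ell^i_e(y)=y^i_e\,a^i_{\mathrm{tail}(e)}$ are defined recursively by $a^i_{O^i}=m_i$ and $a^i_v=\sum_{e\in \mathrm{In}^i(v)}\ell^i_e(y)$ for $v\ne O^i$; put $\ell_e(y)=\sum_i\ell^i_e(y)$. **PushPullMatch**$(z,w,\alpha,A)$, for each pair $i$ (with $0/0=0$): *push backward* (reversed topological order) $b_{D^i}=1$, $b_v=\sum_{e\in \mathrm{Out}^i(v)}e^{w^i_e}b_{\mathrm{head}(e)}$ for $v\neq D^i$, and $q_e=e^{w^i_e}b_{\mathrm{head}(e)}/b_{\mathrm{tail}(e)}$; *pull forward* (topological order) $\lambda_e=q_e\cdot(\text{mass arriving at } \mathrm{tail}(e))$, where mass $m_i$ arrives at $O^i$ and $\sum_{e'\in \mathrm{In}^i(v)}\lambda_{e'}$ at every other $v$; averaged loads $\bar\lambda_e=(\alpha\lambda_e+z^i_e)/A$;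 new anchor $z^i_e+\alpha\lambda_e$; *match* $y^i_e=\bar\lambda_e/a_{\mathrm{tail}(e)}$ with $a_{O^i}=m_i$ and $a_v=\sum_{e'\in \mathrm{In}^i(v)}\bar\lambda_{e'}$ otherwise. It returns $y$ and the new anchor. **AdaLight** with $\alpha_t=t$: start with $w^1=z^1=0$, $\eta^1=1$. At $t=1,2,\dots$, with $A_t=\sum_{s\le t}\alpha_s$: let $\tilde y^t$ be the local flows returned by PushPullMatch$(z^t,\eta^tw^t,\alpha_t,A_t)$ (the anchor is not updated), observe $\tilde c^t_e=c_e(\ell_e(\tilde y^t),\tilde\omega^t)$, set $\tilde w^{t,i}_e=w^{t,i}_e-\alpha_t\tilde c^t_e$; let $y^t,z^{t+1}$ be the output of PushPullMatch$(z^t,\eta^t\tilde w^t,\alpha_t,A_t)$, observe $c^t_e=c_e(\ell_e(y^t),\omega^t)$, set $w^{t+1,i}_e=w^{t,i}_e-\alpha_tc^t_e$ and $\eta^{t+1}=\bigl(1+\sum_{s\le t}(\alpha_s\|c^s-\tilde c^s\|)^2\bigr)^{-1/2}$. The states $\tilde\omega^1,\omega^1,\tilde\omega^2,\omega^2,\dots$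 are i.i.d. with law $\mu$. The norm $\|\cdot\|$ is computed by the Bellman–Ford algorithm with edge weights $-|c^t_e-\tilde c^t_e|$. **Theorem.** (i) For all $N,K,L,M$ there is a constant $C$ such that for every network with $N$ pairs, demands at most $M$ and paths of at most $K$ edges, every such $L$-Lipschitz cost model, and every $T\ge 1$, the induced path flows $x^{T,i}_p=m_i\prod_{e\in p}y^{T,i}_e$ form a feasible flow, its gap is integrable, and $$\mathbb E[\mathrm{Gap}(x^T)]\le C(\log P)^{3/2}\Bigl(\frac{\sigma}{\sqrt T}+\frac1{T^2}\Bigr).$$ In the static case (costs that do not depend on $\omega$), $\mathrm{Gap}(x^T)\le C(\log P)^{3/2}/T^2$ surely. (ii) There is an absolute constant $C$ such that each iteration of AdaLight takes at most $C\,N\,|V|\,|E|$ elementary operations (arithmetic operations, comparisons, exponentials, square roots, queries of a cost, creation or writing of a table entry), in every network. In particular the Bellman–Ford routine computes $\|\cdot\|$ exactly. -/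

import Mathlib

open MeasureTheory ProbabilityTheory

/-! ## Networks, routes, flows -/

/-- `IsWalk tail head S u v p`: the list `p` of edges of `S` is a directed walk from `u` to `v`. -/
def IsWalk {V E : Type} (tail head : E → V) (S : Finset E) : V → V → List E → Prop
  | u, v, [] => u = v
  | u, v, e :: p => e ∈ S ∧ tail e = u ∧ IsWalk tail head S (head e) v p

/-- A directed multigraph with `N` origin/destination pairs.  Pair `i` comes with a subgraph (given
by its edge set), a demand, and a fixed topological order of that subgraph; the existence of the
order says that the subgraph is acyclic. -/
structure RoutingNetwork (V E : Type) [Fintype V] [DecidableEq V] [Fintype E] [DecidableEq E]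
    (N : ℕ) where
  tail : E → V
  head : E → V
  subgraph : Fin N → Finset E
  origin : Fin N → V
  dest : Fin N → V
  origin_ne_dest : ∀ i, origin i ≠ dest i
  demand : Fin N → ℝ
  demand_pos : ∀ i, 0 < demand i
  order : Fin N → List V
  order_nodup : ∀ i, (order i).Nodup
  mem_order : ∀ i v, v ∈ order i
  order_lt : ∀ i, ∀ e ∈ subgraph i, (order i).idxOf (tail e) < (order i).idxOf (head e)
  exists_route : ∀ i, ∃ p, IsWalk tail head (subgraph i) (origin i) (dest i) p

/-! ## Counting elementary operations -/

/-- A value together with the number of elementary operations spent on computing it. -/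
structure Counted (α : Type) where
  val : α
  ops : ℕ

namespace Counted

instance : Monad Counted where
  pure a := ⟨a, 0⟩
  bind x f := ⟨(f x.val).val, x.ops + (f x.val).ops⟩

/-- One elementary operation with result `a`. -/
def op {α : Type} (a : α) : Counted α := ⟨a, 1⟩

noncomputable def add (x y : ℝ) : Counted ℝ := op (x + y)
noncomputable def sub (x y : ℝ) : Counted ℝ := op (x - y)
noncomputable def mul (x y : ℝ) : Counted ℝ := op (x * y)
noncomputable def div (x y : ℝ) : Counted ℝ := op (x / y)
noncomputable def neg (x : ℝ) : Counted ℝ := op (-x)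
noncomputable def abs (x : ℝ) : Counted ℝ := op |x|
noncomputable def exp (x : ℝ) : Counted ℝ := op (Real.exp x)
noncomputable def sqrt (x : ℝ) : Counted ℝ := op (Real.sqrt x)
noncomputable def max (x y : ℝ) : Counted ℝ := op (x ⊔ y)

/-- Addition and minimum of distances, which may be `+∞`. -/
noncomputable def addDist (x : WithTop ℝ) (y : ℝ) : Counted (WithTop ℝ) := op (x + (y : WithTop ℝ))
noncomputable def minDist (x y : WithTop ℝ) : Counted (WithTop ℝ) := op (x ⊓ y)

/-- Creating a table with constant entries costs one operation per entry. -/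
def alloc {κ α : Type} [Fintype κ] (a : α) : Counted (κ → α) := ⟨fun _ => a, Fintype.card κ⟩

/-- Writing one entry of a table. -/
def write {κ α : Type} [DecidableEq κ] (f : κ → α) (k : κ) (a : α) : Counted (κ → α) :=
  op (Function.update f k a)

/-- Summation of a list of computed terms. -/
noncomputable def sumOver {κ : Type} (l : List κ) (f : κ → Counted ℝ) : Counted ℝ :=
  l.foldlM (fun s k => do
    let x ← f k
    add s x) 0

end Counted

/-- State of the algorithm before an iteration: the edge weights `w`, the anchor loads `z`, the
learning rate, the sums `∑ α` and `∑ (α max …)²`, and the local flows recommended last. -/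
structure AdaState (E : Type) (N : ℕ) where
  weight : Fin N → E → ℝ
  anchor : Fin N → E → ℝ
  rate : ℝ
  stepSum : ℝ
  rateSum : ℝ
  localFlow : Fin N → E → ℝ

namespace RoutingNetwork

variable {V E : Type} [Fintype V] [DecidableEq V] [Fintype E] [DecidableEq E] {N : ℕ}
  (G : RoutingNetwork V E N)

/-- The routes of pair `i`: paths from its origin to its destination in its subgraph. -/
def Route (i : Fin N) : Type :=
  {p : List E // IsWalk G.tail G.head (G.subgraph i) (G.origin i) (G.dest i) p}

theorem walk_idx_lt (i : Fin N) :
    ∀ (p : List E) (u v : V), IsWalk G.tail G.head (G.subgraph i) u v p →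
      ∀ e ∈ p, (G.order i).idxOf u < (G.order i).idxOf (G.head e)
  | [], _, _, _, e, he => by simp at he
  | a :: p, u, v, ⟨ha, hu, hp⟩, e, he => by
    have h1 := G.order_lt i a ha
    rw [hu] at h1
    rcases List.mem_cons.1 he with rfl | he
    · exact h1
    · exact h1.trans (walk_idx_lt i p _ v hp e he)

theorem walk_nodup (i : Fin N) :
    ∀ (p : List E) (u v : V), IsWalk G.tail G.head (G.subgraph i) u v p → p.Nodup
  | [], _, _, _ => List.nodup_nil
  | a :: p, u, v, ⟨_, _, hp⟩ => by
    refine List.nodup_cons.2 ⟨fun h => ?_, walk_nodup i p _ v hp⟩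
    exact lt_irrefl _ (G.walk_idx_lt i p _ v hp a h)

instance (i : Fin N) : Finite (G.Route i) :=
  Finite.of_injective (β := {l : List E // l.Nodup})
    (fun p => ⟨p.1, G.walk_nodup i p.1 _ _ p.2⟩)
    (fun _ _ h => Subtype.ext (congrArg (fun l : {l : List E // l.Nodup} => l.1) h))

noncomputable instance (i : Fin N) : Fintype (G.Route i) := Fintype.ofFinite _

instance (i : Fin N) : Nonempty (G.Route i) :=
  let ⟨p, hp⟩ := G.exists_route i
  ⟨⟨p, hp⟩⟩

/-- Total number of routes. -/
noncomputable def numRoutes : ℕ := ∑ i, Fintype.card (G.Route i)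

noncomputable def totalDemand : ℝ := ∑ i, G.demand i

/-- Feasible path flows. -/
def IsFlow (f : ∀ i, G.Route i → ℝ) : Prop :=
  ∀ i, (∀ p, 0 ≤ f i p) ∧ ∑ p, f i p = G.demand i

/-- Load on the edge `e` under a path flow. -/
noncomputable def load (f : ∀ i, G.Route i → ℝ) (e : E) : ℝ :=
  ∑ i, ∑ p : G.Route i, if e ∈ p.1 then f i p else 0

/-- `max_p ∑_{e ∈ p} |u_e|` over all routes `p` of all pairs. -/
noncomputable def routeNorm (u : E → ℝ) : ℝ :=
  ⨆ r : (Σ i, G.Route i), (r.2.1.map fun e => |u e|).sum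

/-! ## Random costs and the potential -/

/-- `c e x s` is the cost of edge `e` at load `x` in state `s`: measurable in the state; monotone,
uniformly bounded and `L`-Lipschitz in the load. -/
structure IsCostModel {S : Type*} [MeasurableSpace S] (c : E → ℝ → S → ℝ) (L : ℝ) : Prop where
  measurable : ∀ e, ∀ x ∈ Set.Icc 0 G.totalDemand, Measurable (c e x)
  monotone : ∀ e s, MonotoneOn (fun x => c e x s) (Set.Icc 0 G.totalDemand)
  bounded : ∃ H : ℝ, ∀ e s, ∀ x ∈ Set.Icc 0 G.totalDemand, |c e x s| ≤ H
  lipschitz : ∀ e s, ∀ x ∈ Set.Icc 0 G.totalDemand, ∀ y ∈ Set.Icc 0 G.totalDemand,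
    |c e x s - c e y s| ≤ L * |x - y|

section Costs

variable {S : Type*} [MeasurableSpace S] (μ : Measure S) (c : E → ℝ → S → ℝ)

/-- The mean cost function of an edge. -/
noncomputable def meanCost (e : E) (x : ℝ) : ℝ := ∫ s, c e x s ∂μ

/-- The (mean) Beckmann-McGuire-Winsten potential. -/
noncomputable def potential (f : ∀ i, G.Route i → ℝ) : ℝ :=
  ∑ e, ∫ x in (0 : ℝ)..G.load f e, meanCost μ c e x

/-- Equilibrium gap: potential minus its minimum over feasible flows. -/
noncomputable def gap (f : ∀ i, G.Route i → ℝ) : ℝ :=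
  G.potential μ c f - sInf (G.potential μ c '' {g | G.IsFlow g})

/-- The noise level `σ`: `σ²` is the largest, over feasible flows, second moment of the deviation of
the costs from their means, measured in `routeNorm`. -/
noncomputable def noiseLevel : ℝ :=
  Real.sqrt (⨆ f : {f : ∀ i, G.Route i → ℝ // G.IsFlow f},
    ∫ s, G.routeNorm (fun e => c e (G.load f.1 e) s - meanCost μ c e (G.load f.1 e)) ^ 2 ∂μ)

end Costs

/-! ## Local flows -/

/-- Incoming and outgoing edges of a vertex in the subgraph of pair `i`. -/
def inEdges (i : Fin N) (v : V) : Finset E := {e ∈ G.subgraph i | G.head e = v}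
def outEdges (i : Fin N) (v : V) : Finset E := {e ∈ G.subgraph i | G.tail e = v}

/-- Mass of type-`i` traffic arriving at `v` under the local flow `y`; the entry `y e` is the share
of the traffic at the tail of `e` that is sent along `e`. -/
noncomputable def arrival (i : Fin N) (y : E → ℝ) (v : V) : ℝ :=
  if v = G.origin i then G.demand i
  else ∑ e : {e // e ∈ G.inEdges i v}, y e.1 * arrival i y (G.tail e.1)
termination_by (G.order i).idxOf v
decreasing_by
  have h := Finset.mem_filter.1 e.2
  simpa [h.2] using G.order_lt i e.1 h.1

/-- Total load on the edge `e` under a profile of local flows. -/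
noncomputable def localLoad (y : Fin N → E → ℝ) (e : E) : ℝ :=
  ∑ i, if e ∈ G.subgraph i then y i e * G.arrival i (y i) (G.tail e) else 0

/-- The path flow `x_p = m_i ∏_{e ∈ p} y_e` induced by a profile of local flows. -/
noncomputable def pathFlow (y : Fin N → E → ℝ) (i : Fin N) (p : G.Route i) : ℝ :=
  G.demand i * (p.1.map (y i)).prod

/-! ## The PushPullMatch dynamic program -/

open Counted

/-- Pushing backward: backward scores of the vertices, in reversed topological order, and the
resulting pivot local flow. -/
noncomputable def pushBackward (i : Fin N) (w : E → ℝ) : Counted (E → ℝ) := do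
  let bw₀ ← alloc (κ := V) (0 : ℝ)
  let q₀ ← alloc (κ := E) (0 : ℝ)
  let r ← (G.order i).reverse.foldlM (fun (a : (V → ℝ) × (E → ℝ)) v => do
    let b ← if v = G.dest i then pure 1 else
      sumOver (G.outEdges i v).toList (fun e => do
        let x ← exp (w e)
        mul (a.1 (G.head e)) x)
    let bw ← write a.1 v b
    let q ← (G.outEdges i v).toList.foldlM (fun q e => do
      let x ← exp (w e)
      let n ← mul x (bw (G.head e))
      let d ← div n b
      write q e d) a.2
    pure (bw, q)) (bw₀, q₀)
  pure r.2

/-- Pulling forward: the loads of the pivot local flow `q` in topological order, their averages with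
the anchor loads `z`, and the updated anchor.  Returns the averaged loads and the new anchor. -/
noncomputable def pullForward (i : Fin N) (q z : E → ℝ) (α A : ℝ) :
    Counted ((E → ℝ) × (E → ℝ)) := do
  let ld₀ ← alloc (κ := E) (0 : ℝ)
  let av₀ ← alloc (κ := E) (0 : ℝ)
  let r ← (G.order i).foldlM (fun (a : (E → ℝ) × (E → ℝ) × (E → ℝ)) v => do
    let fw ← if v = G.origin i then pure (G.demand i) else
      sumOver (G.inEdges i v).toList (fun e => pure (a.1 e))
    (G.outEdges i v).toList.foldlM (fun (b : (E → ℝ) × (E → ℝ) × (E → ℝ)) e => do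
      let l ← mul fw (q e)
      let ld ← write b.1 e l
      let αl ← mul α l
      let s ← add αl (b.2.2 e)
      let x ← div s A
      let av ← write b.2.1 e x
      let z' ← add (b.2.2 e) αl
      let an ← write b.2.2 e z'
      pure (ld, av, an)) a) (ld₀, av₀, z)
  pure r.2

/-- Matching: the local flow with the edge loads `av`.  (A vertex that carries no traffic gets the
local flow `0`, the value of `0 / 0`.) -/
noncomputable def matchLoad (i : Fin N) (av : E → ℝ) : Counted (E → ℝ) := do
  let y₀ ← alloc (κ := E) (0 : ℝ)
  (G.order i).foldlM (fun (y : E → ℝ) v => do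
    let ar ← if v = G.origin i then pure (G.demand i) else
      sumOver (G.inEdges i v).toList (fun e => pure (av e))
    (G.outEdges i v).toList.foldlM (fun y e => do
      let d ← div (av e) ar
      write y e d) y) y₀

/-- `PushPullMatch(z, w, α, A)`: returns the profile of local flows and the updated anchor. -/
noncomputable def pushPullMatch (z w : Fin N → E → ℝ) (α A : ℝ) :
    Counted ((Fin N → E → ℝ) × (Fin N → E → ℝ)) := do
  let Y₀ ← alloc (κ := Fin N) (0 : E → ℝ)
  (List.finRange N).foldlM (fun (r : (Fin N → E → ℝ) × (Fin N → E → ℝ)) i => do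
    let q ← G.pushBackward i (w i)
    let a ← G.pullForward i q (z i) α A
    let y ← G.matchLoad i a.1
    let Y ← write r.1 i y
    let Z ← write r.2 i a.2
    pure (Y, Z)) (Y₀, z)

/-! ## AdaLight -/

/-- Bellman-Ford: the distance from the origin to the destination of pair `i` for the edge weights
`r`, by relaxing all edges `|V|` times. -/
noncomputable def bellmanFord (i : Fin N) (r : E → ℝ) : Counted (WithTop ℝ) := do
  let d₀ ← alloc (κ := V) (⊤ : WithTop ℝ)
  let d₁ ← write d₀ (G.origin i) 0
  let d ← (List.range (Fintype.card V)).foldlM (fun d _ =>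
    (G.subgraph i).toList.foldlM (fun (d : V → WithTop ℝ) e => do
      let x ← addDist (d (G.tail e)) (r e)
      let m ← minDist (d (G.head e)) x
      write d (G.head e) m) d) d₁
  pure (d (G.dest i))

/-- Computes `routeNorm u` by shortest paths for the edge weights `-|u e|`. -/
noncomputable def routeNormProgram (u : E → ℝ) : Counted ℝ := do
  let r₀ ← alloc (κ := E) (0 : ℝ)
  let r ← (Finset.univ : Finset E).toList.foldlM (fun (r : E → ℝ) e => do
    let x ← abs (u e)
    let y ← neg x
    write r e y) r₀
  (List.finRange N).foldlM (fun m i => do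
    let d ← G.bellmanFord i r
    let x ← neg (d.untopD 0)
    max m x) 0

/-- Measuring the costs on all edges, one query per edge. -/
noncomputable def measureCosts (cost : E → ℝ) : Counted (E → ℝ) := do
  let t₀ ← alloc (κ := E) (0 : ℝ)
  (Finset.univ : Finset E).toList.foldlM (fun (t : E → ℝ) e => do
    let x ← op (cost e)
    write t e x) t₀

/-- Fills a table indexed by the pairs and the edges of their subgraphs. -/
noncomputable def tabulate (f : Fin N → E → Counted ℝ) : Counted (Fin N → E → ℝ) := do
  let W₀ ← alloc (κ := Fin N) (0 : E → ℝ)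
  (List.finRange N).foldlM (fun (W : Fin N → E → ℝ) i => do
    let row₀ ← alloc (κ := E) (0 : ℝ)
    let row ← (G.subgraph i).toList.foldlM (fun (row : E → ℝ) e => do
      let x ← f i e
      write row e x) row₀
    write W i row) W₀

/-- One iteration with step `α`.  `testCost y` and `cost y` are the edge costs that are observed
in the test phase and in the recommendation phase when the local flows `y` are used. -/
noncomputable def iteration (testCost cost : (Fin N → E → ℝ) → E → ℝ) (α : ℝ)
    (s : AdaState E N) : Counted (AdaState E N) := do
  let A ← add s.stepSum α
  let w₁ ← G.tabulate (fun i e => mul s.rate (s.weight i e))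
  let test ← G.pushPullMatch s.anchor w₁ α A
  let ct ← measureCosts (testCost test.1)
  let wt ← G.tabulate (fun i e => do
    let x ← mul α (ct e)
    sub (s.weight i e) x)
  let w₂ ← G.tabulate (fun i e => mul s.rate (wt i e))
  let rec' ← G.pushPullMatch s.anchor w₂ α A
  let cr ← measureCosts (cost rec'.1)
  let w' ← G.tabulate (fun i e => do
    let x ← mul α (cr e)
    sub (s.weight i e) x)
  let u₀ ← alloc (κ := E) (0 : ℝ)
  let u ← (Finset.univ : Finset E).toList.foldlM (fun (u : E → ℝ) e => do
    let x ← sub (cr e) (ct e)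
    write u e x) u₀
  let m ← G.routeNormProgram u
  let αm ← mul α m
  let sq ← mul αm αm
  let R ← add s.rateSum sq
  let R₁ ← add 1 R
  let root ← sqrt R₁
  let η ← div 1 root
  pure { weight := w', anchor := rec'.2, rate := η, stepSum := A, rateSum := R,
         localFlow := rec'.1 }

/-- The state after `t` iterations of AdaLight with steps `α_t = t`, where `ζ (t, false)` and
`ζ (t, true)` are the states of nature in the test and in the recommendation phase of epoch `t`. -/
noncomputable def adaLight {S : Type*} (c : E → ℝ → S → ℝ) (ζ : ℕ × Bool → S) :
    ℕ → AdaState E N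
  | 0 => { weight := 0, anchor := 0, rate := 1, stepSum := 0, rateSum := 0, localFlow := 0 }
  | t + 1 =>
    (G.iteration (fun y e => c e (G.localLoad y e) (ζ (t + 1, false)))
      (fun y e => c e (G.localLoad y e) (ζ (t + 1, true))) ((t : ℝ) + 1)
      (adaLight c ζ t)).val

/-- The path flow induced by the local flows recommended in epoch `t`. -/
noncomputable def adaLightFlow {S : Type*} (c : E → ℝ → S → ℝ) (ζ : ℕ × Bool → S) (t : ℕ) :
    ∀ i, G.Route i → ℝ :=
  G.pathFlow (G.adaLight c ζ t).localFlow

end RoutingNetwork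

/-!
Pushing backward computes the partition functions of the routes by dynamic programming, so that the
pivot local flows induce the logit flow `logit θ` of the edge scores `θ`; pulling forward and
matching produce local flows whose induced path flow has the same loads as the weighted average of
all the logit flows so far.  AdaLight is therefore an extra-gradient method with entropic
regularization on the product of the scaled simplices of path flows, and only loads enter its costs.

* The gain of a test step over no test step is quadratic in the distance of the two logit flows,
  by Pinsker's inequality, so the weighted regret against a fixed flow is at most `log P` times the
  inverse learning rate, plus the squared variations `(α_t ‖c^t - c̃^t‖)²` of the costs weighted by
  the learning rate, minus the squared distances.
* The potential is convex and the costs are queried at averages with the weights `α_t = t`.  Hence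
  `A_T Gap(x^T)` telescopes to the weighted regret, and the loads in the two phases of epoch `t`
  differ by `α_t / A_t ≤ 2 / t` times the distance of the two logit flows, so that the smooth part
  of `α_t ‖c^t - c̃^t‖` is of the order of this distance and is compensated by the negative terms.
* What remains is the noise, of order `σ T^{3/2}` after the adaptive choice of the learning rate,
  and a constant.  Division by `A_T ~ T² / 2` gives the rates.  In expectation the noise does not
  contribute to first order, since a flow that is determined by earlier states of nature is
  independent of the state in which its costs are observed.
-/

/-! ## Operation counts -/

namespace Counted

variable {α β κ : Type}

@[simp] theorem val_pure (a : α) : (pure a : Counted α).val = a := rfl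

@[simp] theorem ops_pure (a : α) : (pure a : Counted α).ops = 0 := rfl

@[simp] theorem val_bind (x : Counted α) (f : α → Counted β) : (x >>= f).val = (f x.val).val := rfl

@[simp] theorem ops_bind (x : Counted α) (f : α → Counted β) :
    (x >>= f).ops = x.ops + (f x.val).ops := rfl

@[simp] theorem val_op (a : α) : (op a).val = a := rfl

@[simp] theorem ops_op (a : α) : (op a).ops = 1 := rfl

theorem ops_alloc [Fintype κ] (a : α) : (alloc a : Counted (κ → α)).ops = Fintype.card κ := rfl

@[simp] theorem val_foldlM (f : β → α → Counted β) (l : List α) (b : β) :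
    (l.foldlM f b).val = l.foldl (fun b a => (f b a).val) b := by
  induction l generalizing b with
  | nil => rfl
  | cons a l ih => rw [List.foldlM_cons, val_bind, ih, List.foldl_cons]

@[simp] theorem val_sumOver (l : List κ) (f : κ → Counted ℝ) :
    (sumOver l f).val = (l.map fun k => (f k).val).sum := by
  simp [sumOver, add, List.sum_eq_foldl, List.foldl_map]

theorem ops_bind_le {x : Counted α} {f : α → Counted β} {m n : ℕ} (hx : x.ops ≤ m)
    (hf : ∀ a, (f a).ops ≤ n) : (x >>= f).ops ≤ m + n :=
  Nat.add_le_add hx (hf _)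

theorem ops_foldlM_le {k n : ℕ} {f : β → α → Counted β} {l : List α} (hn : l.length ≤ n)
    (h : ∀ b a, (f b a).ops ≤ k) (b : β) : (l.foldlM f b).ops ≤ n * k := by
  refine le_trans ?_ (Nat.mul_le_mul_right k hn)
  clear hn
  induction l generalizing b with
  | nil => simp
  | cons a l ih =>
    rw [List.foldlM_cons, ops_bind, List.length_cons, Nat.succ_mul, add_comm]
    exact Nat.add_le_add (ih _) (h _ _)

theorem ops_foldlM_toList_le [Fintype κ] {k : ℕ} {f : β → κ → Counted β}
    (h : ∀ b a, (f b a).ops ≤ k) (s : Finset κ) (b : β) :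
    (s.toList.foldlM f b).ops ≤ Fintype.card κ * k :=
  ops_foldlM_le (s.length_toList.trans_le s.card_le_univ) h b

theorem ops_sumOver_toList_le [Fintype κ] {k : ℕ} {f : κ → Counted ℝ} (h : ∀ a, (f a).ops ≤ k)
    (s : Finset κ) : (sumOver s.toList f).ops ≤ Fintype.card κ * (k + 1) :=
  ops_foldlM_toList_le (k := k + 1) (fun _ a => ops_bind_le (h a) fun _ => (ops_op _).le) _ _

theorem ops_ite_bind_le {p : Prop} [Decidable p] {x y : Counted α} {f : α → Counted β} {m n : ℕ}
    (hx : x.ops ≤ m) (hy : y.ops ≤ m) (hf : ∀ a, (f a).ops ≤ n) :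
    (if p then x >>= f else y >>= f).ops ≤ m + n := by
  split_ifs
  exacts [ops_bind_le hx hf, ops_bind_le hy hf]

end Counted

namespace RoutingNetwork

variable {V E : Type} [Fintype V] [DecidableEq V] [Fintype E] [DecidableEq E] {N : ℕ}
  (G : RoutingNetwork V E N)

open Counted

attribute [local simp] Counted.add Counted.sub Counted.mul Counted.div Counted.neg Counted.abs
  Counted.exp Counted.sqrt Counted.max Counted.addDist Counted.minDist Counted.alloc Counted.write

theorem length_order (i : Fin N) : (G.order i).length = Fintype.card V := by
  rw [← List.toFinset_card_of_nodup (G.order_nodup i), ← Finset.card_univ]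
  congr 1
  ext v
  simp [G.mem_order i v]

include G in
theorem card_vertices_pos (i : Fin N) : 0 < Fintype.card V :=
  Fintype.card_pos_iff.2 ⟨G.origin i⟩

include G in
theorem card_edges_pos (i : Fin N) : 0 < Fintype.card E := by
  obtain ⟨p, hp⟩ := G.exists_route i
  cases p with
  | nil => exact absurd hp (G.origin_ne_dest i)
  | cons e p => exact Fintype.card_pos_iff.2 ⟨e⟩

include G in
theorem card_le_card_mul_card (i : Fin N) :
    Fintype.card V ≤ Fintype.card V * Fintype.card E ∧
      Fintype.card E ≤ Fintype.card V * Fintype.card E :=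
  ⟨Nat.le_mul_of_pos_right _ (G.card_edges_pos i),
    Nat.le_mul_of_pos_left _ (G.card_vertices_pos i)⟩

theorem ops_pushBackward_le (i : Fin N) (w : E → ℝ) :
    (G.pushBackward i w).ops ≤ 10 * (Fintype.card V * Fintype.card E) := by
  obtain ⟨hV, hE⟩ := G.card_le_card_mul_card i
  have hE₁ := G.card_edges_pos i
  refine le_trans (ops_bind_le (ops_alloc _).le fun _ => ops_bind_le (ops_alloc _).le fun _ =>
    ops_bind_le (ops_foldlM_le (k := 8 * Fintype.card E)
      ((List.length_reverse ..).trans (G.length_order i)).le (fun a v => ?_) _)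
    fun _ => (ops_pure _).le) ?_
  · refine le_trans (ops_ite_bind_le (Nat.zero_le _)
      (ops_sumOver_toList_le (k := 2) (by simp) _) fun _ =>
      ops_bind_le (ops_op _).le fun _ =>
        ops_bind_le (ops_foldlM_toList_le (k := 4) (by simp) _ _) fun _ => (ops_pure _).le) ?_
    omega
  · linarith

theorem ops_pullForward_le (i : Fin N) (q z : E → ℝ) (α A : ℝ) :
    (G.pullForward i q z α A).ops ≤ 11 * (Fintype.card V * Fintype.card E) := by
  obtain ⟨-, hE⟩ := G.card_le_card_mul_card i
  refine le_trans (ops_bind_le (ops_alloc _).le fun _ => ops_bind_le (ops_alloc _).le fun _ =>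
    ops_bind_le (ops_foldlM_le (k := 9 * Fintype.card E) (G.length_order i).le (fun a v => ?_) _)
    fun _ => (ops_pure _).le) ?_
  · refine le_trans (ops_ite_bind_le (Nat.zero_le _)
      (ops_sumOver_toList_le (k := 0) (by simp) _) fun _ =>
      ops_foldlM_toList_le (k := 8) (by simp) _ _) ?_
    omega
  · linarith

theorem ops_matchLoad_le (i : Fin N) (av : E → ℝ) :
    (G.matchLoad i av).ops ≤ 4 * (Fintype.card V * Fintype.card E) := by
  obtain ⟨-, hE⟩ := G.card_le_card_mul_card i
  refine le_trans (ops_bind_le (ops_alloc _).le fun _ => ops_foldlM_le (k := 3 * Fintype.card E)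
    (G.length_order i).le (fun y v => ?_) _) ?_
  · refine le_trans (ops_ite_bind_le (Nat.zero_le _)
      (ops_sumOver_toList_le (k := 0) (by simp) _) fun _ =>
      ops_foldlM_toList_le (k := 2) (by simp) _ _) ?_
    omega
  · linarith

theorem ops_bellmanFord_le (i : Fin N) (r : E → ℝ) :
    (G.bellmanFord i r).ops ≤ 5 * (Fintype.card V * Fintype.card E) := by
  obtain ⟨hV, hE⟩ := G.card_le_card_mul_card i
  have hE₁ := G.card_edges_pos i
  refine le_trans (ops_bind_le (ops_alloc _).le fun _ => ops_bind_le (ops_op _).le fun _ =>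
    ops_bind_le (ops_foldlM_le List.length_range.le
      (fun d _ => ops_foldlM_toList_le (k := 3) (by simp) _ _) _) fun _ => (ops_pure _).le) ?_
  linarith

/-- `N |V| |E|`, the size of the network in the running time bounds. -/
def size (_ : RoutingNetwork V E N) : ℕ := N * Fintype.card V * Fintype.card E

theorem le_size (hN : 1 ≤ N) : 1 ≤ G.size ∧ N ≤ G.size ∧ Fintype.card E ≤ G.size := by
  have i : Fin N := ⟨0, hN⟩
  have hVE : 0 < Fintype.card V * Fintype.card E := Nat.mul_pos (G.card_vertices_pos i)
    (G.card_edges_pos i)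
  rw [size, mul_assoc]
  exact ⟨Nat.mul_pos hN hVE, Nat.le_mul_of_pos_right _ hVE,
    (G.card_le_card_mul_card i).2.trans (Nat.le_mul_of_pos_left _ hN)⟩

theorem ops_pairLoop_le {σ : Type} {f : σ → Fin N → Counted σ} {k : ℕ}
    (h : ∀ a i, (f a i).ops ≤ k * (Fintype.card V * Fintype.card E)) (a : σ) :
    ((List.finRange N).foldlM f a).ops ≤ k * G.size :=
  (ops_foldlM_le List.length_finRange.le h a).trans_eq (by rw [size]; ring)

theorem ops_pushPullMatch_le (hN : 1 ≤ N) (z w : Fin N → E → ℝ) (α A : ℝ) :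
    (G.pushPullMatch z w α A).ops ≤ 28 * G.size := by
  obtain ⟨-, hN', -⟩ := G.le_size hN
  refine le_trans (ops_bind_le ((ops_alloc _).trans (Fintype.card_fin N)).le fun _ =>
    G.ops_pairLoop_le (k := 27) (fun a i => ?_) _) ?_
  · have hVE := Nat.mul_pos (G.card_vertices_pos i) (G.card_edges_pos i)
    refine le_trans (ops_bind_le (G.ops_pushBackward_le i _) fun _ =>
      ops_bind_le (G.ops_pullForward_le i ..) fun _ => ops_bind_le (G.ops_matchLoad_le i _)
        fun _ => ops_bind_le (ops_op _).le fun _ => ops_bind_le (ops_op _).le fun _ =>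
        (ops_pure _).le) ?_
    omega
  · omega

theorem ops_routeNormProgram_le (hN : 1 ≤ N) (u : E → ℝ) :
    (G.routeNormProgram u).ops ≤ 11 * G.size := by
  obtain ⟨-, -, hE⟩ := G.le_size hN
  refine le_trans (ops_bind_le (ops_alloc _).le fun _ => ops_bind_le
    (ops_foldlM_toList_le (k := 3) (by simp) _ _) fun _ =>
      G.ops_pairLoop_le (k := 7) (fun a i => ?_) _) ?_
  · have hVE := Nat.mul_pos (G.card_vertices_pos i) (G.card_edges_pos i)
    refine le_trans (ops_bind_le (G.ops_bellmanFord_le i _) fun _ =>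
      ops_bind_le (ops_op _).le fun _ => (ops_op _).le) ?_
    omega
  · omega

theorem ops_tabulate_le (hN : 1 ≤ N) {f : Fin N → E → Counted ℝ} {k : ℕ}
    (hf : ∀ i e, (f i e).ops ≤ k) : (G.tabulate f).ops ≤ (k + 4) * G.size := by
  obtain ⟨-, hN', -⟩ := G.le_size hN
  refine le_trans (ops_bind_le ((ops_alloc _).trans (Fintype.card_fin N)).le fun _ =>
    G.ops_pairLoop_le (k := k + 3) (fun a i => ?_) _) ?_
  · obtain ⟨hV, hE⟩ := G.card_le_card_mul_card i
    have hV₁ := G.card_vertices_pos i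
    refine le_trans (ops_bind_le (ops_alloc _).le fun _ => ops_bind_le
      (ops_foldlM_toList_le (k := k + 1) (fun _ e => by simpa using hf i e) _ _)
        fun _ => (ops_op _).le) ?_
    nlinarith
  · linarith

omit [Fintype V] [DecidableEq V] in
theorem ops_measureCosts_le (cost : E → ℝ) : (measureCosts cost).ops ≤ 3 * Fintype.card E := by
  refine le_trans (ops_bind_le (ops_alloc _).le fun _ =>
    ops_foldlM_toList_le (k := 2) (by simp) _ _) ?_
  omega

theorem ops_iteration_le (hN : 1 ≤ N) (testCost cost : (Fin N → E → ℝ) → E → ℝ) (α : ℝ)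
    (s : AdaState E N) : (G.iteration testCost cost α s).ops ≤ 108 * G.size := by
  obtain ⟨one_le, -, hE⟩ := G.le_size hN
  have matching := G.ops_pushPullMatch_le hN
  have measuring (cost : E → ℝ) : (measureCosts cost).ops ≤ 3 * G.size :=
    (ops_measureCosts_le cost).trans (Nat.mul_le_mul_left 3 hE)
  unfold iteration
  refine le_trans
    (ops_bind_le (ops_op _).le fun _ =>
    ops_bind_le (G.ops_tabulate_le hN (k := 1) (by simp)) fun _ =>
    ops_bind_le (matching ..) fun _ => ops_bind_le (measuring _) fun _ =>
    ops_bind_le (G.ops_tabulate_le hN (k := 2) (by simp)) fun _ =>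
    ops_bind_le (G.ops_tabulate_le hN (k := 1) (by simp)) fun _ =>
    ops_bind_le (matching ..) fun _ => ops_bind_le (measuring _) fun _ =>
    ops_bind_le (G.ops_tabulate_le hN (k := 2) (by simp)) fun _ =>
    ops_bind_le (ops_alloc _).le fun _ =>
    ops_bind_le (ops_foldlM_toList_le (k := 2) (by simp) _ _) fun _ =>
    ops_bind_le (G.ops_routeNormProgram_le hN _) fun _ =>
    ops_bind_le (ops_op _).le fun _ => ops_bind_le (ops_op _).le fun _ =>
    ops_bind_le (ops_op _).le fun _ => ops_bind_le (ops_op _).le fun _ =>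
    ops_bind_le (ops_op _).le fun _ => ops_bind_le (ops_op _).le fun _ => (ops_pure _).le) ?_
  omega

end RoutingNetwork

/-! ## Walks and the route norm -/

theorem isWalk_append {V E : Type} {tail head : E → V} {S : Finset E} {u v : V} {p q : List E} :
    IsWalk tail head S u v (p ++ q) ↔
      ∃ x, IsWalk tail head S u x p ∧ IsWalk tail head S x v q := by
  induction p generalizing u with
  | nil => exact ⟨fun h => ⟨u, rfl, h⟩, fun ⟨x, hx, h⟩ => by obtain rfl : u = x := hx; exact h⟩
  | cons e p ih =>
    simp only [List.cons_append, IsWalk, ih]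
    exact ⟨fun ⟨he, hev, x, hes, hxs⟩ => ⟨x, ⟨he, hev, hes⟩, hxs⟩,
      fun ⟨x, ⟨he, hev, hes⟩, hxs⟩ => ⟨he, hev, x, hes, hxs⟩⟩

theorem IsWalk.mem {V E : Type} {tail head : E → V} {S : Finset E} {u v : V} {p : List E}
    (h : IsWalk tail head S u v p) {e : E} (he : e ∈ p) : e ∈ S := by
  induction p generalizing u with
  | nil => simp at he
  | cons a p ih =>
    rcases List.mem_cons.1 he with rfl | he
    · exact h.1
    · exact ih h.2.2 he

/-- The relaxation step of the Bellman-Ford algorithm along the edge `e`, for the edge weights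
`r`. -/
noncomputable def relaxEdge {V E : Type} [DecidableEq V] (tail head : E → V) (r : E → ℝ)
    (d : V → WithTop ℝ) (e : E) : V → WithTop ℝ :=
  Function.update d (head e) (d (head e) ⊓ (d (tail e) + (r e : WithTop ℝ)))

section Relax

variable {V E : Type} [DecidableEq V] {tail head : E → V} {r : E → ℝ}

theorem relaxEdge_le (d : V → WithTop ℝ) (e : E) (v : V) : relaxEdge tail head r d e v ≤ d v := by
  rw [relaxEdge, Function.update_apply]
  split_ifs with h
  · rw [h]; exact inf_le_left
  · exact le_rfl

theorem foldl_relaxEdge_le (l : List E) (d : V → WithTop ℝ) (v : V) :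
    l.foldl (relaxEdge tail head r) d v ≤ d v := by
  induction l generalizing d with
  | nil => exact le_rfl
  | cons a l ih => exact (ih _).trans (relaxEdge_le d a v)

theorem foldl_relaxEdge_head_le {l : List E} {e : E} (he : e ∈ l) (d : V → WithTop ℝ) :
    l.foldl (relaxEdge tail head r) d (head e) ≤ d (tail e) + (r e : WithTop ℝ) := by
  obtain ⟨l1, l2, rfl⟩ := List.append_of_mem he
  rw [List.foldl_append, List.foldl_cons]
  refine (foldl_relaxEdge_le _ _ _).trans ?_
  rw [relaxEdge, Function.update_self]
  exact inf_le_right.trans (add_le_add_left (foldl_relaxEdge_le l1 d _) _)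

/-- Soundness of a table of tentative distances from `o`: every finite entry is the weight of a walk
in `S`. -/
def IsSoundDist (tail head : E → V) (S : Finset E) (r : E → ℝ) (o : V) (d : V → WithTop ℝ) :
    Prop :=
  ∀ v, d v ≠ ⊤ → ∃ p, IsWalk tail head S o v p ∧ d v = ((p.map r).sum : ℝ)

theorem IsSoundDist.relaxEdge {S : Finset E} {o : V} {d : V → WithTop ℝ}
    (hd : IsSoundDist tail head S r o d) {e : E} (he : e ∈ S) :
    IsSoundDist tail head S r o (relaxEdge tail head r d e) := by
  intro v hv
  rw [_root_.relaxEdge, Function.update_apply] at hv ⊢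
  split_ifs at hv ⊢ with h
  · rcases le_total (d (head e)) (d (tail e) + (r e : WithTop ℝ)) with hle | hle
    · rw [inf_eq_left.2 hle] at hv ⊢
      rw [h]; exact hd _ hv
    · rw [inf_eq_right.2 hle] at hv ⊢
      obtain ⟨p, hp, hs⟩ := hd (tail e) (fun h' => hv (by rw [h', WithTop.top_add]))
      refine ⟨p ++ [e], isWalk_append.2 ⟨_, hp, he, rfl, h.symm⟩, ?_⟩
      rw [hs]; simp
  · exact hd v hv

theorem IsSoundDist.foldl_relaxEdge {S : Finset E} {o : V} {l : List E} (hl : ∀ e ∈ l, e ∈ S)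
    {d : V → WithTop ℝ} (hd : IsSoundDist tail head S r o d) :
    IsSoundDist tail head S r o (l.foldl (_root_.relaxEdge tail head r) d) := by
  induction l generalizing d with
  | nil => exact hd
  | cons a l ih =>
    exact ih (fun e he => hl e (List.mem_cons_of_mem _ he)) (hd.relaxEdge (hl a List.mem_cons_self))

/-- `k` rounds of relaxations along the edges in `l`. -/
noncomputable def relaxRounds (tail head : E → V) (r : E → ℝ) (l : List E) (d : V → WithTop ℝ)
    (k : ℕ) : V → WithTop ℝ :=
  (List.range k).foldl (fun d _ => l.foldl (relaxEdge tail head r) d) d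

theorem relaxRounds_succ (l : List E) (d : V → WithTop ℝ) (k : ℕ) :
    relaxRounds tail head r l d (k + 1) =
      l.foldl (relaxEdge tail head r) (relaxRounds tail head r l d k) := by
  simp [relaxRounds, List.range_succ]

theorem IsSoundDist.relaxRounds {S : Finset E} {o : V} {l : List E} (hl : ∀ e ∈ l, e ∈ S)
    {d : V → WithTop ℝ} (hd : IsSoundDist tail head S r o d) (k : ℕ) :
    IsSoundDist tail head S r o (relaxRounds tail head r l d k) := by
  induction k with
  | zero => exact hd
  | succ k ih => rw [relaxRounds_succ]; exact ih.foldl_relaxEdge hl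

theorem relaxRounds_le_walk {S : Finset E} {o : V} {l : List E} (hl : ∀ e ∈ S, e ∈ l)
    {d : V → WithTop ℝ} (hd : d o ≤ 0) {k : ℕ} {v : V} {p : List E}
    (hp : IsWalk tail head S o v p) (hk : p.length ≤ k) :
    relaxRounds tail head r l d k v ≤ ((p.map r).sum : ℝ) := by
  induction k generalizing v p with
  | zero =>
    obtain rfl : p = [] := List.length_eq_zero_iff.1 (Nat.le_zero.1 hk)
    obtain rfl : o = v := hp
    simpa [relaxRounds] using hd
  | succ k ih =>
    rw [relaxRounds_succ]
    rcases List.eq_nil_or_concat' p with rfl | ⟨p', e, rfl⟩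
    · exact (foldl_relaxEdge_le _ _ _).trans (ih hp (Nat.zero_le _))
    · obtain ⟨x, hx, he, rfl, rfl⟩ := isWalk_append.1 hp
      refine (foldl_relaxEdge_head_le (hl e he) _).trans ?_
      have := ih hx (by simpa using hk)
      simpa using add_le_add_left this (r e : WithTop ℝ)

end Relax

namespace RoutingNetwork

variable {V E : Type} [Fintype V] [DecidableEq V] [Fintype E] [DecidableEq E] {N : ℕ}
  (G : RoutingNetwork V E N)

open Counted

theorem walk_idx_add_length_le (i : Fin N) {u v : V} {p : List E}
    (h : IsWalk G.tail G.head (G.subgraph i) u v p) :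
    (G.order i).idxOf u + p.length ≤ (G.order i).idxOf v := by
  induction p generalizing u with
  | nil => obtain rfl : u = v := h; simp
  | cons e p ih =>
    have hidx := ih h.2.2
    have hlt := G.order_lt i e h.1
    rw [h.2.1] at hlt
    simp only [List.length_cons]
    omega

theorem walk_length_le (i : Fin N) {u v : V} {p : List E}
    (h : IsWalk G.tail G.head (G.subgraph i) u v p) : p.length ≤ Fintype.card V := by
  have hidx := G.walk_idx_add_length_le i h
  have hlt := List.idxOf_lt_length_of_mem (G.mem_order i v)
  rw [G.length_order] at hlt
  omega

theorem isSoundDist_initial (i : Fin N) (r : E → ℝ) :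
    IsSoundDist G.tail G.head (G.subgraph i) r (G.origin i)
      (Function.update (fun _ => ⊤) (G.origin i) 0) := by
  intro v hv
  rw [Function.update_apply] at hv ⊢
  split_ifs at hv ⊢ with h
  · exact ⟨[], h.symm, by simp⟩
  · exact absurd rfl hv

theorem val_bellmanFord (i : Fin N) (r : E → ℝ) :
    (G.bellmanFord i r).val = relaxRounds G.tail G.head r (G.subgraph i).toList
      (Function.update (fun _ => ⊤) (G.origin i) 0) (Fintype.card V) (G.dest i) := by
  simp only [bellmanFord, addDist, minDist, alloc, write, val_bind, val_pure, val_foldlM, val_op]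
  rfl

theorem exists_val_bellmanFord_eq (i : Fin N) (r : E → ℝ) :
    ∃ m : ℝ, (G.bellmanFord i r).val = m ∧ (∃ p : G.Route i, m = (p.1.map r).sum) ∧
      ∀ p : G.Route i, m ≤ (p.1.map r).sum := by
  rw [val_bellmanFord]
  set d := relaxRounds G.tail G.head r (G.subgraph i).toList
    (Function.update (fun _ => ⊤) (G.origin i) 0) (Fintype.card V) (G.dest i) with d_eq
  have d_le (p : G.Route i) : d ≤ ((p.1.map r).sum : ℝ) :=
    relaxRounds_le_walk (S := G.subgraph i) (fun e he => Finset.mem_toList.2 he) (by simp) p.2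
      (G.walk_length_le i p.2)
  obtain ⟨p₀⟩ : Nonempty (G.Route i) := inferInstance
  obtain ⟨p, hp, d_eq_sum⟩ := (G.isSoundDist_initial i r).relaxRounds (l := (G.subgraph i).toList)
    (fun e he => Finset.mem_toList.1 he) (Fintype.card V) (G.dest i)
    (ne_top_of_le_ne_top WithTop.coe_ne_top (d_le p₀))
  rw [← d_eq] at d_eq_sum
  exact ⟨_, d_eq_sum, ⟨⟨p, hp⟩, rfl⟩, fun p' => WithTop.coe_le_coe.1 (d_eq_sum ▸ d_le p')⟩

end RoutingNetwork

theorem foldl_update {α β : Type*} [DecidableEq α] (l : List α) (f : α → β) (t : α → β) (a : α) :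
    l.foldl (fun t a => Function.update t a (f a)) t a = if a ∈ l then f a else t a := by
  induction l generalizing t with
  | nil => simp
  | cons b l ih =>
    rw [List.foldl_cons, ih, Function.update_apply]
    by_cases ha : a ∈ l <;> by_cases hab : a = b <;> simp [ha, hab]

theorem foldl_max_le_iff {ι : Type*} (l : List ι) (f : ι → ℝ) (m b : ℝ) :
    l.foldl (fun m i => m ⊔ f i) m ≤ b ↔ m ≤ b ∧ ∀ i ∈ l, f i ≤ b := by
  induction l generalizing m with
  | nil => simp
  | cons a l ih => simp [ih, and_assoc]

namespace RoutingNetwork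

variable {V E : Type} [Fintype V] [DecidableEq V] [Fintype E] [DecidableEq E] {N : ℕ}
  (G : RoutingNetwork V E N)

open Counted

attribute [local simp] Counted.abs Counted.neg Counted.max Counted.alloc Counted.write

theorem routeNorm_bddAbove (u : E → ℝ) :
    BddAbove (Set.range fun r : (Σ i, G.Route i) => (r.2.1.map fun e => |u e|).sum) :=
  (Set.finite_range _).bddAbove

theorem le_routeNorm (u : E → ℝ) (i : Fin N) (p : G.Route i) :
    (p.1.map fun e => |u e|).sum ≤ G.routeNorm u :=
  le_ciSup (G.routeNorm_bddAbove u) ⟨i, p⟩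

theorem routeNorm_nonneg (u : E → ℝ) : 0 ≤ G.routeNorm u :=
  Real.iSup_nonneg fun _ => List.sum_nonneg (by simp)

theorem routeNorm_le {u : E → ℝ} {b : ℝ} (hb : 0 ≤ b)
    (h : ∀ i (p : G.Route i), (p.1.map fun e => |u e|).sum ≤ b) : G.routeNorm u ≤ b :=
  Real.iSup_le (fun r => h r.1 r.2) hb

theorem val_routeNormProgram (u : E → ℝ) :
    (G.routeNormProgram u).val = (List.finRange N).foldl
      (fun m i => m ⊔ -((G.bellmanFord i fun e => -|u e|).val.untopD 0)) 0 := by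
  have val_table (t : E → ℝ) : Finset.univ.toList.foldl
      (fun t e => Function.update t e (-|u e|)) t = fun e => -|u e| :=
    funext fun e => by simp [foldl_update (f := fun e => -|u e|)]
  simp [routeNormProgram, val_table]

theorem val_routeNormProgram_eq_routeNorm (u : E → ℝ) :
    (G.routeNormProgram u).val = G.routeNorm u := by
  have sum_neg (p : List E) : (p.map fun e => -|u e|).sum = -(p.map fun e => |u e|).sum := by
    simpa only [neg_one_mul] using List.sum_map_mul_left p (fun e => |u e|) (-1)
  rw [val_routeNormProgram]
  refine eq_of_forall_ge_iff fun b => ?_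
  rw [foldl_max_le_iff]
  constructor
  · rintro ⟨b_nonneg, h⟩
    refine G.routeNorm_le b_nonneg fun i p => ?_
    obtain ⟨m, hm, -, m_le⟩ := G.exists_val_bellmanFord_eq i fun e => -|u e|
    have neg_m_le := h i (List.mem_finRange i)
    rw [hm, WithTop.untopD_coe] at neg_m_le
    linarith [sum_neg p.1 ▸ m_le p]
  · intro h
    refine ⟨(G.routeNorm_nonneg u).trans h, fun i _ => ?_⟩
    obtain ⟨m, hm, ⟨p, hp⟩, -⟩ := G.exists_val_bellmanFord_eq i fun e => -|u e|
    rw [hm, WithTop.untopD_coe, hp, sum_neg, neg_neg]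
    exact (G.le_routeNorm u i p).trans h

end RoutingNetwork

/-! ## Edge flows and local flows -/

theorem sum_map_single_of_nodup {α R : Type*} [DecidableEq α] [AddMonoidWithOne R] {p : List α}
    (hp : p.Nodup) (a : α) : (p.map (Pi.single a (1 : R))).sum = if a ∈ p then 1 else 0 := by
  induction p with
  | nil => simp
  | cons b p ih =>
    obtain ⟨hb, hp⟩ := List.nodup_cons.1 hp
    rw [List.map_cons, List.sum_cons, ih hp, Pi.single_apply]
    by_cases h : b = a
    · subst h; simp [hb]
    · simp [h, Ne.symm h]

namespace RoutingNetwork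

variable {V E : Type} [Fintype V] [DecidableEq V] [Fintype E] [DecidableEq E] {N : ℕ}
  (G : RoutingNetwork V E N)

variable {G} in
theorem mem_outEdges {i : Fin N} {e : E} {v : V} :
    e ∈ G.outEdges i v ↔ e ∈ G.subgraph i ∧ G.tail e = v := Finset.mem_filter

variable {G} in
theorem mem_inEdges {i : Fin N} {e : E} {v : V} :
    e ∈ G.inEdges i v ↔ e ∈ G.subgraph i ∧ G.head e = v := Finset.mem_filter

theorem finite_walks (i : Fin N) (v : V) :
    {p : List E | IsWalk G.tail G.head (G.subgraph i) v (G.dest i) p}.Finite :=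
  (Set.finite_coe_iff.1 (inferInstance : Finite {l : List E // l.Nodup})).subset
    fun p hp => G.walk_nodup i p _ _ hp

/-- The walks from `v` to the destination of pair `i`. -/
noncomputable def walks (i : Fin N) (v : V) : Finset (List E) := (G.finite_walks i v).toFinset

variable {G} in
theorem mem_walks {i : Fin N} {v : V} {p : List E} :
    p ∈ G.walks i v ↔ IsWalk G.tail G.head (G.subgraph i) v (G.dest i) p := by
  simp [walks]

theorem sum_route {M : Type*} [AddCommMonoid M] (i : Fin N) (F : List E → M) :
    ∑ p : G.Route i, F p.1 = ∑ p ∈ G.walks i (G.origin i), F p :=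
  Finset.sum_bij (fun p _ => p.1) (fun p _ => mem_walks.2 p.2) (fun _ _ _ _ h => Subtype.ext h)
    (fun p hp => ⟨⟨p, mem_walks.1 hp⟩, Finset.mem_univ _, rfl⟩) fun _ _ => rfl

theorem walks_dest (i : Fin N) : G.walks i (G.dest i) = {[]} := by
  ext p
  rw [mem_walks, Finset.mem_singleton]
  constructor
  · intro h
    have := G.walk_idx_add_length_le i h
    exact List.length_eq_zero_iff.1 (by omega)
  · rintro rfl; rfl

theorem sum_walks_of_ne {M : Type*} [AddCommMonoid M] {i : Fin N} {v : V} (hv : v ≠ G.dest i)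
    (F : List E → M) :
    ∑ p ∈ G.walks i v, F p =
      ∑ e ∈ G.outEdges i v, ∑ p ∈ G.walks i (G.head e), F (e :: p) := by
  have walks_eq : G.walks i v = (G.outEdges i v).biUnion
      fun e => (G.walks i (G.head e)).image (List.cons e) := by
    ext p
    simp only [Finset.mem_biUnion, Finset.mem_image, mem_walks, mem_outEdges]
    constructor
    · intro hp
      cases p with
      | nil => exact absurd hp hv
      | cons e p => exact ⟨e, ⟨hp.1, hp.2.1⟩, p, hp.2.2, rfl⟩
    · rintro ⟨e, ⟨he, htail⟩, p, hp, rfl⟩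
      exact ⟨he, htail, hp⟩
  rw [walks_eq, Finset.sum_biUnion]
  · refine Finset.sum_congr rfl fun e _ => Finset.sum_image fun _ _ _ _ h => ?_
    exact (List.cons.inj h).2
  · intro e _ e' _ hne
    rw [Function.onFun, Finset.disjoint_left]
    intro p hp hp'
    obtain ⟨q, -, rfl⟩ := Finset.mem_image.1 hp
    obtain ⟨q', -, h⟩ := Finset.mem_image.1 hp'
    exact hne (List.cons.inj h).1.symm

/-- The total weight of the walks from `v` to the destination, a walk being weighted by the product
of the weights `g` of its edges. -/
noncomputable def walkSum (i : Fin N) (g : E → ℝ) (v : V) : ℝ :=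
  ∑ p ∈ G.walks i v, (p.map g).prod

theorem walkSum_dest (i : Fin N) (g : E → ℝ) : G.walkSum i g (G.dest i) = 1 := by
  simp [walkSum, walks_dest]

theorem walkSum_of_ne {i : Fin N} (g : E → ℝ) {v : V} (hv : v ≠ G.dest i) :
    G.walkSum i g v = ∑ e ∈ G.outEdges i v, g e * G.walkSum i g (G.head e) := by
  simp [walkSum, G.sum_walks_of_ne hv, Finset.mul_sum]

theorem walkSum_nonneg (i : Fin N) {g : E → ℝ} (hg : ∀ e, 0 ≤ g e) (v : V) :
    0 ≤ G.walkSum i g v :=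
  Finset.sum_nonneg fun p _ => List.prod_nonneg (by simpa using fun e _ => hg e)

theorem walkSum_pos (i : Fin N) {g : E → ℝ} (hg : ∀ e, 0 < g e) {v : V} {p : List E}
    (hp : p ∈ G.walks i v) : 0 < G.walkSum i g v :=
  Finset.sum_pos (fun p _ => List.prod_pos (by simpa using fun e _ => hg e)) ⟨p, hp⟩

theorem walkSum_origin_pos (i : Fin N) {g : E → ℝ} (hg : ∀ e, 0 < g e) :
    0 < G.walkSum i g (G.origin i) :=
  let ⟨_, hp⟩ := G.exists_route i
  G.walkSum_pos i hg (mem_walks.2 hp)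

theorem outEdges_induction (i : Fin N) {P : V → Prop}
    (h : ∀ v, (∀ e ∈ G.outEdges i v, P (G.head e)) → P v) (v : V) : P v := by
  induction hn : Fintype.card V - (G.order i).idxOf v using Nat.strong_induction_on generalizing v
  rename_i n ih
  refine h v fun e he => ih _ ?_ _ rfl
  obtain ⟨hs, rfl⟩ := Finset.mem_filter.1 he
  have tail_lt_head := G.order_lt i e hs
  have head_lt := List.idxOf_lt_length_of_mem (G.mem_order i (G.head e))
  rw [G.length_order] at head_lt
  omega

theorem inEdges_induction (i : Fin N) {P : V → Prop}
    (h : ∀ v, (∀ e ∈ G.inEdges i v, P (G.tail e)) → P v) (v : V) : P v := by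
  induction hn : (G.order i).idxOf v using Nat.strong_induction_on generalizing v
  rename_i n ih
  refine h v fun e he => ih _ ?_ _ rfl
  obtain ⟨hs, rfl⟩ := Finset.mem_filter.1 he
  rw [← hn]
  exact G.order_lt i e hs

theorem sum_outEdges {M : Type*} [AddCommMonoid M] (i : Fin N) (F : E → M) :
    ∑ v, ∑ e ∈ G.outEdges i v, F e = ∑ e ∈ G.subgraph i, F e :=
  Finset.sum_fiberwise _ _ _

theorem sum_inEdges {M : Type*} [AddCommMonoid M] (i : Fin N) (F : E → M) :
    ∑ v, ∑ e ∈ G.inEdges i v, F e = ∑ e ∈ G.subgraph i, F e :=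
  Finset.sum_fiberwise _ _ _

/-- The total cost of the walks from `v` to the destination for the edge costs `u`, a walk being
weighted by the product of the weights `g` of its edges. -/
noncomputable def walkCost (i : Fin N) (g u : E → ℝ) (v : V) : ℝ :=
  ∑ p ∈ G.walks i v, (p.map g).prod * (p.map u).sum

theorem walkCost_dest (i : Fin N) (g u : E → ℝ) : G.walkCost i g u (G.dest i) = 0 := by
  simp [walkCost, walks_dest]

theorem walkCost_of_ne {i : Fin N} (g u : E → ℝ) {v : V} (hv : v ≠ G.dest i) :
    G.walkCost i g u v = ∑ e ∈ G.outEdges i v,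
      g e * (u e * G.walkSum i g (G.head e) + G.walkCost i g u (G.head e)) := by
  simp only [walkCost, G.sum_walks_of_ne hv, walkSum]
  refine Finset.sum_congr rfl fun e _ => ?_
  rw [Finset.mul_sum, ← Finset.sum_add_distrib, Finset.mul_sum]
  refine Finset.sum_congr rfl fun p _ => ?_
  simp only [List.map_cons, List.prod_cons, List.sum_cons]
  ring

/-- The mass arriving at `v` under the edge loads `l`, if `m` enters at the origin. -/
noncomputable def inflow (i : Fin N) (m : ℝ) (l : E → ℝ) (v : V) : ℝ :=
  if v = G.origin i then m else ∑ e ∈ G.inEdges i v, l e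

/-- `l` is a flow of mass `m` from the origin to the destination of pair `i`. -/
structure IsEdgeFlow (i : Fin N) (m : ℝ) (l : E → ℝ) : Prop where
  nonneg : ∀ e ∈ G.subgraph i, 0 ≤ l e
  into_origin : ∀ e ∈ G.inEdges i (G.origin i), l e = 0
  out_dest : ∀ e ∈ G.outEdges i (G.dest i), l e = 0
  balance : ∀ v, v ≠ G.dest i → ∑ e ∈ G.outEdges i v, l e = G.inflow i m l v

namespace IsEdgeFlow

variable {G} {i : Fin N} {m m' : ℝ} {l l' : E → ℝ}

theorem congr (h : G.IsEdgeFlow i m l) (hl : ∀ e ∈ G.subgraph i, l' e = l e) :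
    G.IsEdgeFlow i m l' := by
  have hout : ∀ v, ∀ e ∈ G.outEdges i v, l' e = l e := fun v e he => hl e (mem_outEdges.1 he).1
  have hin : ∀ v, ∀ e ∈ G.inEdges i v, l' e = l e := fun v e he => hl e (mem_inEdges.1 he).1
  refine ⟨fun e he => (hl e he).symm ▸ h.nonneg e he,
    fun e he => (hin _ e he).trans (h.into_origin e he),
    fun e he => (hout _ e he).trans (h.out_dest e he), fun v hv => ?_⟩
  rw [inflow, Finset.sum_congr rfl (hout v), Finset.sum_congr rfl (hin v)]
  exact h.balance v hv

theorem zero (i : Fin N) : G.IsEdgeFlow i 0 (0 : E → ℝ) :=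
  ⟨by simp, by simp, by simp, by simp [inflow]⟩

theorem linear (h : G.IsEdgeFlow i m l) (h' : G.IsEdgeFlow i m' l') {a b : ℝ} (ha : 0 ≤ a)
    (hb : 0 ≤ b) : G.IsEdgeFlow i (a * m + b * m') fun e => a * l e + b * l' e := by
  refine ⟨fun e he => ?_, fun e he => ?_, fun e he => ?_, fun v hv => ?_⟩
  · have := h.nonneg e he
    have := h'.nonneg e he
    positivity
  · simp [h.into_origin e he, h'.into_origin e he]
  · simp [h.out_dest e he, h'.out_dest e he]
  · rw [Finset.sum_add_distrib, ← Finset.mul_sum, ← Finset.mul_sum, h.balance v hv,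
      h'.balance v hv]
    simp only [inflow]
    split_ifs
    · rfl
    · rw [Finset.sum_add_distrib, ← Finset.mul_sum, ← Finset.mul_sum]

theorem inflow_nonneg (h : G.IsEdgeFlow i m l) (hm : 0 ≤ m) (v : V) : 0 ≤ G.inflow i m l v := by
  rw [inflow]
  split_ifs
  · exact hm
  · exact Finset.sum_nonneg fun e he => h.nonneg e (mem_inEdges.1 he).1

theorem inflow_head_ne_zero (h : G.IsEdgeFlow i m l) {e : E} (he : e ∈ G.subgraph i)
    (hl : l e ≠ 0) : G.inflow i m l (G.head e) ≠ 0 := by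
  have ho : G.head e ≠ G.origin i := fun ho => hl (h.into_origin e (mem_inEdges.2 ⟨he, ho⟩))
  rw [inflow, if_neg ho]
  refine ne_of_gt (Finset.sum_pos' (fun e he => h.nonneg e (mem_inEdges.1 he).1)
    ⟨e, mem_inEdges.2 ⟨he, rfl⟩, lt_of_le_of_ne (h.nonneg e he) hl.symm⟩)

theorem sum_outEdges_mul (h : G.IsEdgeFlow i m l) {g : E → ℝ}
    (hg : ∀ e ∈ G.subgraph i, l e = g e * G.inflow i m l (G.tail e))
    (hW : ∀ v, G.inflow i m l v ≠ 0 → G.walkSum i g v = 1) (u : E → ℝ) (v : V) :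
    ∑ e ∈ G.outEdges i v, u e * l e = G.inflow i m l v * G.walkCost i g u v -
      ∑ e ∈ G.outEdges i v, l e * G.walkCost i g u (G.head e) := by
  by_cases hv : v = G.dest i
  · subst hv
    rw [walkCost_dest, mul_zero, zero_sub,
      Finset.sum_eq_zero fun e he => by rw [h.out_dest e he, mul_zero],
      Finset.sum_eq_zero fun e he => by rw [h.out_dest e he, zero_mul], neg_zero]
  · rw [G.walkCost_of_ne g u hv, Finset.mul_sum, ← Finset.sum_sub_distrib]
    refine Finset.sum_congr rfl fun e he => ?_
    obtain ⟨hs, rfl⟩ := mem_outEdges.1 he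
    have l_eq : l e * G.walkSum i g (G.head e) = l e := by
      by_cases hl : l e = 0
      · rw [hl, zero_mul]
      · rw [hW _ (h.inflow_head_ne_zero hs hl), mul_one]
    calc u e * l e = l e * (u e * G.walkSum i g (G.head e) + G.walkCost i g u (G.head e))
          - l e * G.walkCost i g u (G.head e) := by linear_combination -u e * l_eq
      _ = _ := by rw [hg e hs]; ring

/- Summing `sum_outEdges_mul` over all vertices, the terms telescope along the edges by the balance
of the flow and only the origin survives. -/
theorem sum_mul_eq_walkCost (h : G.IsEdgeFlow i m l) {g : E → ℝ}
    (hg : ∀ e ∈ G.subgraph i, l e = g e * G.inflow i m l (G.tail e))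
    (hW : ∀ v, G.inflow i m l v ≠ 0 → G.walkSum i g v = 1) (u : E → ℝ) :
    ∑ e ∈ G.subgraph i, u e * l e = m * G.walkCost i g u (G.origin i) := by
  rw [← G.sum_outEdges i, Finset.sum_congr rfl fun v _ => h.sum_outEdges_mul hg hW u v,
    Finset.sum_sub_distrib, G.sum_outEdges i, ← G.sum_inEdges i, ← Finset.sum_sub_distrib,
    Finset.sum_eq_single (G.origin i)]
  · rw [Finset.sum_eq_zero fun e he => by rw [h.into_origin e he, zero_mul], inflow, if_pos rfl,
      sub_zero]
  · intro v _ hv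
    rw [inflow, if_neg hv, Finset.sum_mul, sub_eq_zero]
    exact Finset.sum_congr rfl fun e he => by rw [(mem_inEdges.1 he).2]
  · simp

end IsEdgeFlow

/-- The load of the pair `i` on the edge `e` under a path flow. -/
noncomputable def pairLoad (f : ∀ i, G.Route i → ℝ) (i : Fin N) (e : E) : ℝ :=
  ∑ p : G.Route i, if e ∈ p.1 then f i p else 0

theorem load_eq_sum_pairLoad (f : ∀ i, G.Route i → ℝ) (e : E) :
    G.load f e = ∑ i, G.pairLoad f i e := rfl

theorem pairLoad_of_notMem (f : ∀ i, G.Route i → ℝ) {i : Fin N} {e : E} (he : e ∉ G.subgraph i) :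
    G.pairLoad f i e = 0 :=
  Finset.sum_eq_zero fun p _ => if_neg fun h => he (p.2.mem h)

theorem IsEdgeFlow.pairLoad_eq {i : Fin N} {l g : E → ℝ} {m : ℝ} (h : G.IsEdgeFlow i m l)
    (hg : ∀ e ∈ G.subgraph i, l e = g e * G.inflow i m l (G.tail e))
    (hW : ∀ v, G.inflow i m l v ≠ 0 → G.walkSum i g v = 1) {f : ∀ i, G.Route i → ℝ}
    (hf : ∀ p, f i p = m * (p.1.map g).prod) {e : E} (he : e ∈ G.subgraph i) :
    G.pairLoad f i e = l e := by
  have := h.sum_mul_eq_walkCost hg hW (Pi.single e 1)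
  rw [Finset.sum_eq_single e (fun e' _ h => by rw [Pi.single_apply, if_neg h, zero_mul])
    (fun h => absurd he h), Pi.single_eq_same, one_mul] at this
  rw [this, walkCost, pairLoad, Finset.mul_sum,
    ← G.sum_route i fun p => m * ((p.map g).prod * (p.map (Pi.single e (1 : ℝ))).sum)]
  refine Finset.sum_congr rfl fun p _ => ?_
  rw [sum_map_single_of_nodup (G.walk_nodup i _ _ _ p.2), hf]
  split_ifs <;> ring

/-- The local flow that realizes the edge loads `l`. -/
noncomputable def matching (i : Fin N) (l : E → ℝ) (e : E) : ℝ :=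
  if e ∈ G.subgraph i then l e / G.inflow i (G.demand i) l (G.tail e) else 0

namespace IsEdgeFlow

variable {G} {i : Fin N} {l : E → ℝ}

theorem eq_matching_mul (h : G.IsEdgeFlow i (G.demand i) l) {e : E} (he : e ∈ G.subgraph i) :
    l e = G.matching i l e * G.inflow i (G.demand i) l (G.tail e) := by
  rw [matching, if_pos he]
  by_cases hzero : G.inflow i (G.demand i) l (G.tail e) = 0
  · rw [hzero, mul_zero]
    by_cases hd : G.tail e = G.dest i
    · exact h.out_dest e (mem_outEdges.2 ⟨he, hd⟩)
    · have := h.balance _ hd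
      rw [hzero] at this
      exact (Finset.sum_eq_zero_iff_of_nonneg
        fun e he => h.nonneg e (mem_outEdges.1 he).1).1 this e (mem_outEdges.2 ⟨he, rfl⟩)
  · rw [div_mul_cancel₀ _ hzero]

theorem walkSum_matching (h : G.IsEdgeFlow i (G.demand i) l) (v : V)
    (hv : G.inflow i (G.demand i) l v ≠ 0) : G.walkSum i (G.matching i l) v = 1 := by
  revert hv
  refine G.outEdges_induction i (P := fun v => G.inflow i (G.demand i) l v ≠ 0 →
    G.walkSum i (G.matching i l) v = 1) (fun v ih hv => ?_) v
  by_cases hd : v = G.dest i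
  · rw [hd, walkSum_dest]
  · rw [G.walkSum_of_ne _ hd]
    have : ∀ e ∈ G.outEdges i v, G.matching i l e * G.walkSum i (G.matching i l) (G.head e) =
        l e / G.inflow i (G.demand i) l v := by
      intro e he
      obtain ⟨hs, ht⟩ := mem_outEdges.1 he
      rw [matching, if_pos hs, ht]
      by_cases hzero : l e = 0
      · rw [hzero, zero_div, zero_mul]
      · rw [ih e he (h.inflow_head_ne_zero hs hzero), mul_one]
    rw [Finset.sum_congr rfl this, ← Finset.sum_div, h.balance v hd, div_self hv]

theorem arrival_matching (h : G.IsEdgeFlow i (G.demand i) l) (v : V) :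
    G.arrival i (G.matching i l) v = G.inflow i (G.demand i) l v := by
  refine G.inEdges_induction i (P := fun v => G.arrival i (G.matching i l) v =
    G.inflow i (G.demand i) l v) (fun v ih => ?_) v
  rw [arrival, inflow]
  split_ifs
  · rfl
  · rw [Finset.sum_coe_sort (G.inEdges i v)
      fun e => G.matching i l e * G.arrival i (G.matching i l) (G.tail e)]
    refine Finset.sum_congr rfl fun e he => ?_
    rw [ih e he, ← h.eq_matching_mul (mem_inEdges.1 he).1]

theorem matching_nonneg (h : G.IsEdgeFlow i (G.demand i) l) (e : E) : 0 ≤ G.matching i l e := by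
  rw [matching]
  split_ifs with he
  · exact div_nonneg (h.nonneg e he) (h.inflow_nonneg (G.demand_pos i).le _)
  · exact le_rfl

end IsEdgeFlow

theorem isFlow_pathFlow_matching {l : Fin N → E → ℝ}
    (h : ∀ i, G.IsEdgeFlow i (G.demand i) (l i)) :
    G.IsFlow (G.pathFlow fun i => G.matching i (l i)) := by
  refine fun i => ⟨fun p => mul_nonneg (G.demand_pos i).le (List.prod_nonneg ?_), ?_⟩
  · simpa using fun e _ => (h i).matching_nonneg e
  · simp only [pathFlow]
    rw [← Finset.mul_sum, G.sum_route i fun p => (p.map (G.matching i (l i))).prod]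
    have := (h i).walkSum_matching (G.origin i)
      (by rw [inflow, if_pos rfl]; exact (G.demand_pos i).ne')
    rw [walkSum] at this
    rw [this, mul_one]

theorem pairLoad_pathFlow_matching {l : Fin N → E → ℝ} {i : Fin N}
    (h : G.IsEdgeFlow i (G.demand i) (l i)) {e : E} (he : e ∈ G.subgraph i) :
    G.pairLoad (G.pathFlow fun i => G.matching i (l i)) i e = l i e :=
  h.pairLoad_eq G (fun _ he => h.eq_matching_mul he) h.walkSum_matching (fun _ => rfl) he

theorem load_pathFlow_matching {l : Fin N → E → ℝ} (h : ∀ i, G.IsEdgeFlow i (G.demand i) (l i))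
    (e : E) : G.load (G.pathFlow fun i => G.matching i (l i)) e =
      ∑ i, if e ∈ G.subgraph i then l i e else 0 := by
  rw [load_eq_sum_pairLoad]
  refine Finset.sum_congr rfl fun i _ => ?_
  split_ifs with he
  · exact G.pairLoad_pathFlow_matching (h i) he
  · exact G.pairLoad_of_notMem _ he

theorem localLoad_matching {l : Fin N → E → ℝ} (h : ∀ i, G.IsEdgeFlow i (G.demand i) (l i))
    (e : E) : G.localLoad (fun i => G.matching i (l i)) e =
      ∑ i, if e ∈ G.subgraph i then l i e else 0 := by
  refine Finset.sum_congr rfl fun i _ => ?_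
  split_ifs with he
  · rw [(h i).arrival_matching, ← (h i).eq_matching_mul he]
  · rfl

end RoutingNetwork

/-! ## Softmax and log-sum-exp -/

section Softmax

variable {ι : Type*}

theorem sq_sqrt_sub_sqrt_add_sub_le {a b : ℝ} (ha : 0 < a) (hb : 0 < b) :
    (√a - √b) ^ 2 + (a - b) ≤ a * (Real.log a - Real.log b) := by
  have hlog := Real.log_le_sub_one_of_pos (div_pos (Real.sqrt_pos.2 hb) (Real.sqrt_pos.2 ha))
  rw [Real.log_div (Real.sqrt_pos.2 hb).ne' (Real.sqrt_pos.2 ha).ne', Real.log_sqrt ha.le,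
    Real.log_sqrt hb.le] at hlog
  have hmul : a * (√b / √a) = √a * √b := by
    rw [mul_div_left_comm, Real.div_sqrt, mul_comm]
  have := mul_le_mul_of_nonneg_left hlog ha.le
  rw [mul_sub_one, hmul] at this
  linarith [Real.sq_sqrt ha.le, Real.sq_sqrt hb.le, sub_sq (√a) (√b)]

theorem sq_sum_abs_sub_le (s : Finset ι) {f g : ι → ℝ} (hf : ∀ j ∈ s, 0 ≤ f j)
    (hg : ∀ j ∈ s, 0 ≤ g j) :
    (∑ j ∈ s, |f j - g j|) ^ 2 ≤
      2 * (∑ j ∈ s, f j + ∑ j ∈ s, g j) * ∑ j ∈ s, (√(f j) - √(g j)) ^ 2 := by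
  have hfactor : ∑ j ∈ s, |f j - g j| = ∑ j ∈ s, (√(f j) + √(g j)) * |√(f j) - √(g j)| :=
    Finset.sum_congr rfl fun j hj => by
      rw [← abs_of_nonneg (add_nonneg (Real.sqrt_nonneg (f j)) (Real.sqrt_nonneg (g j))),
        ← abs_mul, ← sq_sub_sq, Real.sq_sqrt (hf j hj), Real.sq_sqrt (hg j hj)]
  have hadd : ∑ j ∈ s, (√(f j) + √(g j)) ^ 2 ≤ 2 * (∑ j ∈ s, f j + ∑ j ∈ s, g j) := by
    rw [← Finset.sum_add_distrib, Finset.mul_sum]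
    refine Finset.sum_le_sum fun j hj => (add_sq_le).trans_eq ?_
    rw [Real.sq_sqrt (hf j hj), Real.sq_sqrt (hg j hj)]
  rw [hfactor]
  refine (Finset.sum_mul_sq_le_sq_mul_sq _ _ _).trans ?_
  simp only [sq_abs]
  gcongr

variable [Fintype ι]

/-- The log-sum-exp function, the convex conjugate of the negative entropy. -/
noncomputable def logSumExp (a : ι → ℝ) : ℝ := Real.log (∑ j, Real.exp (a j))

/-- The softmax (or logit) distribution of the scores `a`, the gradient of `logSumExp` at `a`. -/
noncomputable def softmax (a : ι → ℝ) (j : ι) : ℝ := Real.exp (a j) / ∑ k, Real.exp (a k)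

theorem logSumExp_zero : logSumExp (0 : ι → ℝ) = Real.log (Fintype.card ι) := by
  simp [logSumExp]

theorem le_logSumExp (a : ι → ℝ) (j : ι) : a j ≤ logSumExp a := by
  have hj : Real.exp (a j) ≤ ∑ k, Real.exp (a k) :=
    Finset.single_le_sum (fun k _ => (Real.exp_pos (a k)).le) (Finset.mem_univ j)
  exact (Real.le_log_iff_exp_le ((Real.exp_pos _).trans_le hj)).2 hj

variable [Nonempty ι]

theorem sum_exp_pos (a : ι → ℝ) : 0 < ∑ j, Real.exp (a j) :=
  Finset.sum_pos (fun _ _ => Real.exp_pos _) Finset.univ_nonempty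

theorem softmax_pos (a : ι → ℝ) (j : ι) : 0 < softmax a j :=
  div_pos (Real.exp_pos _) (sum_exp_pos a)

theorem sum_softmax (a : ι → ℝ) : ∑ j, softmax a j = 1 := by
  simp only [softmax, ← Finset.sum_div, div_self (sum_exp_pos a).ne']

theorem log_softmax (a : ι → ℝ) (j : ι) : Real.log (softmax a j) = a j - logSumExp a := by
  rw [softmax, Real.log_div (Real.exp_pos _).ne' (sum_exp_pos a).ne', Real.log_exp, logSumExp]

-- The right-hand side is the Kullback-Leibler divergence of `softmax a` from `softmax b`.
theorem sum_sq_sqrt_softmax_sub_le (a b : ι → ℝ) :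
    ∑ j, (√(softmax a j) - √(softmax b j)) ^ 2 ≤
      logSumExp b - logSumExp a - ∑ j, softmax a j * (b j - a j) := by
  have hkl := Finset.sum_le_sum fun j (_ : j ∈ Finset.univ) =>
    sq_sqrt_sub_sqrt_add_sub_le (softmax_pos a j) (softmax_pos b j)
  simp only [Finset.sum_add_distrib, Finset.sum_sub_distrib, sum_softmax, sub_self, add_zero,
    log_softmax] at hkl
  refine hkl.trans_eq ?_
  rw [← one_mul (logSumExp b - logSumExp a), ← sum_softmax a, Finset.sum_mul,
    ← Finset.sum_sub_distrib]
  exact Finset.sum_congr rfl fun j _ => by ring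

end Softmax

theorem abs_sum_map_le {α : Type*} (u : α → ℝ) (p : List α) :
    |(p.map u).sum| ≤ (p.map fun e => |u e|).sum := by
  induction p with
  | nil => simp
  | cons e p ih =>
    simp only [List.map_cons, List.sum_cons]
    exact (abs_add_le _ _).trans (add_le_add_right ih _)

namespace RoutingNetwork

variable {V E : Type} [Fintype V] [DecidableEq V] [Fintype E] [DecidableEq E] {N : ℕ}
  (G : RoutingNetwork V E N)

/-! ## Path flows and logit flows -/

theorem totalDemand_nonneg : 0 ≤ G.totalDemand :=
  Finset.sum_nonneg fun i _ => (G.demand_pos i).le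

theorem totalDemand_pos (hN : 1 ≤ N) : 0 < G.totalDemand :=
  Finset.sum_pos (fun i _ => G.demand_pos i) ⟨⟨0, hN⟩, Finset.mem_univ _⟩

variable {G} in
theorem IsFlow.sum_eq {f : ∀ i, G.Route i → ℝ} (hf : G.IsFlow f) :
    ∑ i, ∑ p, f i p = G.totalDemand :=
  Finset.sum_congr rfl fun i _ => (hf i).2

theorem pairLoad_linear (f g : ∀ i, G.Route i → ℝ) (a b : ℝ) (i : Fin N) (e : E) :
    G.pairLoad (a • f + b • g) i e = a * G.pairLoad f i e + b * G.pairLoad g i e := by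
  simp only [pairLoad, Finset.mul_sum, ← Finset.sum_add_distrib]
  exact Finset.sum_congr rfl fun p _ => by split_ifs <;> simp

theorem load_linear (f g : ∀ i, G.Route i → ℝ) (a b : ℝ) :
    G.load (a • f + b • g) = a • G.load f + b • G.load g := by
  ext e
  simp only [load_eq_sum_pairLoad, pairLoad_linear, Pi.add_apply, Pi.smul_apply, smul_eq_mul,
    Finset.sum_add_distrib, Finset.mul_sum]

/-- Total cost of the path flow `f` for the edge costs `u`. -/
noncomputable def pairing (u : E → ℝ) (f : ∀ i, G.Route i → ℝ) : ℝ :=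
  ∑ i, ∑ p : G.Route i, f i p * (p.1.map u).sum

theorem pairing_eq_sum_load (u : E → ℝ) (f : ∀ i, G.Route i → ℝ) :
    G.pairing u f = ∑ e, u e * G.load f e := by
  simp only [pairing, load, Finset.mul_sum]
  rw [Finset.sum_comm]
  refine Finset.sum_congr rfl fun i _ => ?_
  rw [Finset.sum_comm]
  refine Finset.sum_congr rfl fun p _ => ?_
  have hp : p.1.toFinset = Finset.univ.filter fun e => e ∈ p.1 := by ext; simp
  rw [← List.sum_toFinset u (G.walk_nodup i _ _ _ p.2), hp, Finset.sum_filter, Finset.mul_sum]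
  exact Finset.sum_congr rfl fun e _ => by split_ifs <;> ring

theorem pairing_zero (f : ∀ i, G.Route i → ℝ) : G.pairing 0 f = 0 := by
  simp [pairing_eq_sum_load]

theorem pairing_sub (u v : E → ℝ) (f : ∀ i, G.Route i → ℝ) :
    G.pairing (u - v) f = G.pairing u f - G.pairing v f := by
  simp only [pairing_eq_sum_load, Pi.sub_apply, sub_mul, Finset.sum_sub_distrib]

theorem pairing_smul (a : ℝ) (u : E → ℝ) (f : ∀ i, G.Route i → ℝ) :
    G.pairing (a • u) f = a * G.pairing u f := by
  simp only [pairing_eq_sum_load, Pi.smul_apply, smul_eq_mul, mul_assoc, Finset.mul_sum]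

theorem pairing_linear_right (u : E → ℝ) (f g : ∀ i, G.Route i → ℝ) (a b : ℝ) :
    G.pairing u (a • f + b • g) = a * G.pairing u f + b * G.pairing u g := by
  simp only [pairing_eq_sum_load, load_linear, Pi.add_apply, Pi.smul_apply, smul_eq_mul, mul_add,
    Finset.sum_add_distrib, Finset.mul_sum, mul_left_comm]

/-- The `ℓ¹` distance of path flows. -/
noncomputable def flowDist (f g : ∀ i, G.Route i → ℝ) : ℝ :=
  ∑ i, ∑ p : G.Route i, |f i p - g i p|

theorem flowDist_nonneg (f g : ∀ i, G.Route i → ℝ) : 0 ≤ G.flowDist f g :=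
  Finset.sum_nonneg fun _ _ => Finset.sum_nonneg fun _ _ => abs_nonneg _

theorem flowDist_comm (f g : ∀ i, G.Route i → ℝ) : G.flowDist f g = G.flowDist g f := by
  simp only [flowDist, abs_sub_comm]

theorem flowDist_le {f g : ∀ i, G.Route i → ℝ} (hf : G.IsFlow f) (hg : G.IsFlow g) :
    G.flowDist f g ≤ 2 * G.totalDemand := by
  rw [two_mul]
  nth_rewrite 1 [← hf.sum_eq]
  rw [← hg.sum_eq]
  simp only [← Finset.sum_add_distrib, flowDist]
  refine Finset.sum_le_sum fun i _ => Finset.sum_le_sum fun p _ => ?_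
  exact (abs_sub _ _).trans_eq (by rw [abs_of_nonneg ((hf i).1 p), abs_of_nonneg ((hg i).1 p)])

theorem pairing_sub_le (u : E → ℝ) (f g : ∀ i, G.Route i → ℝ) :
    G.pairing u f - G.pairing u g ≤ G.routeNorm u * G.flowDist f g := by
  simp only [pairing, flowDist, ← Finset.sum_sub_distrib, Finset.mul_sum, ← sub_mul]
  refine Finset.sum_le_sum fun i _ => Finset.sum_le_sum fun p _ => (le_abs_self _).trans ?_
  rw [abs_mul, mul_comm]
  exact mul_le_mul_of_nonneg_right ((abs_sum_map_le u p.1).trans (G.le_routeNorm u i p))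
    (abs_nonneg _)

theorem abs_load_sub_le (f g : ∀ i, G.Route i → ℝ) (e : E) :
    |G.load f e - G.load g e| ≤ G.flowDist f g := by
  simp only [load, flowDist, ← Finset.sum_sub_distrib]
  refine (Finset.abs_sum_le_sum_abs _ _).trans (Finset.sum_le_sum fun i _ =>
    (Finset.abs_sum_le_sum_abs _ _).trans (Finset.sum_le_sum fun p _ => ?_))
  split_ifs
  · exact le_rfl
  · simp

theorem flowDist_sq_le {f g : ∀ i, G.Route i → ℝ} (hf : G.IsFlow f) (hg : G.IsFlow g) :
    G.flowDist f g ^ 2 ≤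
      4 * G.totalDemand * ∑ i, ∑ p : G.Route i, (√(f i p) - √(g i p)) ^ 2 := by
  have h := sq_sum_abs_sub_le (Finset.univ : Finset (Σ i, G.Route i)) (f := fun r => f r.1 r.2)
    (g := fun r => g r.1 r.2) (fun r _ => (hf r.1).1 r.2) fun r _ => (hg r.1).1 r.2
  simp only [Fintype.sum_sigma, hf.sum_eq, hg.sum_eq] at h
  exact h.trans_eq (by ring)

/-- The scores of the routes of pair `i` for the edge scores `θ`. -/
def routeScore (θ : E → ℝ) (i : Fin N) (p : G.Route i) : ℝ := (p.1.map θ).sum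

/-- The logit path flow with edge scores `θ`. -/
noncomputable def logit (θ : E → ℝ) (i : Fin N) (p : G.Route i) : ℝ :=
  G.demand i * softmax (G.routeScore θ i) p

/-- The potential of the logit flow: `logit θ` is its gradient at `θ`. -/
noncomputable def logPartition (θ : E → ℝ) : ℝ := ∑ i, G.demand i * logSumExp (G.routeScore θ i)

theorem isFlow_logit (θ : E → ℝ) : G.IsFlow (G.logit θ) :=
  fun i => ⟨fun p => (mul_pos (G.demand_pos i) (softmax_pos _ p)).le, by
    simp only [logit, ← Finset.mul_sum, sum_softmax, mul_one]⟩

theorem flowDist_logit_sq_le (a b : E → ℝ) :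
    G.flowDist (G.logit a) (G.logit b) ^ 2 ≤ 4 * G.totalDemand *
      (G.logPartition b - G.logPartition a - G.pairing (b - a) (G.logit a)) := by
  refine (G.flowDist_sq_le (G.isFlow_logit a) (G.isFlow_logit b)).trans
    (mul_le_mul_of_nonneg_left ?_ (mul_nonneg zero_le_four G.totalDemand_nonneg))
  rw [pairing_sub]
  simp only [logPartition, pairing, ← Finset.sum_sub_distrib]
  refine Finset.sum_le_sum fun i _ => ?_
  have h := mul_le_mul_of_nonneg_left (sum_sq_sqrt_softmax_sub_le (G.routeScore a i)
    (G.routeScore b i)) (G.demand_pos i).le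
  simp only [Finset.mul_sum, mul_sub] at h
  simpa only [logit, Real.sqrt_mul (G.demand_pos i).le, ← mul_sub, mul_pow,
    Real.sq_sqrt (G.demand_pos i).le, routeScore, mul_assoc] using h

theorem logPartition_add_pairing_le (a b : E → ℝ) :
    G.logPartition a + G.pairing (b - a) (G.logit a) ≤ G.logPartition b := by
  rcases Nat.eq_zero_or_pos N with rfl | hN
  · simp [logPartition, pairing]
  have h := (sq_nonneg _).trans (G.flowDist_logit_sq_le a b)
  linarith [nonneg_of_mul_nonneg_right h (mul_pos four_pos (G.totalDemand_pos hN))]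

theorem pairing_le_logPartition (θ : E → ℝ) {f : ∀ i, G.Route i → ℝ} (hf : G.IsFlow f) :
    G.pairing θ f ≤ G.logPartition θ := by
  refine Finset.sum_le_sum fun i _ => ?_
  rw [← (hf i).2, Finset.sum_mul]
  exact Finset.sum_le_sum fun p _ =>
    mul_le_mul_of_nonneg_left (le_logSumExp (G.routeScore θ i) p) ((hf i).1 p)

theorem logPartition_zero :
    G.logPartition 0 = ∑ i, G.demand i * Real.log (Fintype.card (G.Route i)) := by
  refine Finset.sum_congr rfl fun i _ => ?_
  rw [show G.routeScore 0 i = 0 from funext fun p => by simp [routeScore, Pi.zero_def],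
    logSumExp_zero]

theorem logPartition_zero_le : G.logPartition 0 ≤ G.totalDemand * Real.log G.numRoutes := by
  rw [logPartition_zero, totalDemand, Finset.sum_mul]
  refine Finset.sum_le_sum fun i _ => mul_le_mul_of_nonneg_left ?_ (G.demand_pos i).le
  refine Real.log_le_log (Nat.cast_pos.2 Fintype.card_pos) (Nat.cast_le.2 ?_)
  exact Finset.single_le_sum (f := fun i => Fintype.card (G.Route i)) (fun _ _ => Nat.zero_le _)
    (Finset.mem_univ i)

theorem logPartition_zero_nonneg : 0 ≤ G.logPartition 0 := by
  rw [logPartition_zero]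
  exact Finset.sum_nonneg fun i _ => mul_nonneg (G.demand_pos i).le (Real.log_natCast_nonneg _)

theorem mul_logPartition_smul_le (w : E → ℝ) {a b : ℝ} (ha : 0 ≤ a) (hab : a ≤ b) :
    b * G.logPartition (a • w) ≤ a * G.logPartition (b • w) + (b - a) * G.logPartition 0 := by
  have hb := mul_le_mul_of_nonneg_left (G.logPartition_add_pairing_le (a • w) (b • w)) ha
  have hzero := mul_le_mul_of_nonneg_left (G.logPartition_add_pairing_le (a • w) 0)
    (sub_nonneg.2 hab)
  simp only [pairing_sub, pairing_smul, pairing_zero] at hb hzero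
  linarith

/-- The one-step inequality of optimistic dual averaging: `v` is the prediction of the loss `u`. -/
theorem pairing_logit_sub_le (hN : 1 ≤ N) (θ u v : E → ℝ) :
    G.pairing u (G.logit (θ - v)) ≤ G.logPartition θ - G.logPartition (θ - u) +
      G.routeNorm (u - v) * G.flowDist (G.logit (θ - u)) (G.logit (θ - v)) -
      (G.flowDist (G.logit (θ - u)) (G.logit (θ - v)) ^ 2 +
        G.flowDist (G.logit (θ - v)) (G.logit θ) ^ 2) / (4 * G.totalDemand) := by
  have hM : 0 < 4 * G.totalDemand := mul_pos four_pos (G.totalDemand_pos hN)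
  have hupdate := (div_le_iff₀' hM).2 (G.flowDist_logit_sq_le (θ - u) (θ - v))
  have hpredict := (div_le_iff₀' hM).2 (G.flowDist_logit_sq_le (θ - v) θ)
  have hdiff := G.pairing_sub_le (u - v) (G.logit (θ - v)) (G.logit (θ - u))
  rw [G.flowDist_comm] at hdiff
  simp only [pairing_sub] at hupdate hpredict hdiff
  rw [add_div]
  linarith

end RoutingNetwork

namespace RoutingNetwork

variable {V E : Type} [Fintype V] [DecidableEq V] [Fintype E] [DecidableEq E] {N : ℕ}
  (G : RoutingNetwork V E N)

/-! ## Correctness of PushPullMatch -/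

theorem arrival_eq_inflow (i : Fin N) (y : E → ℝ) (v : V) :
    G.arrival i y v =
      G.inflow i (G.demand i) (fun e => y e * G.arrival i y (G.tail e)) v := by
  rw [arrival, inflow]
  congr 1
  exact Finset.sum_coe_sort (G.inEdges i v) fun e => y e * G.arrival i y (G.tail e)

theorem arrival_nonneg (i : Fin N) {y : E → ℝ} (hy : ∀ e, 0 ≤ y e) (v : V) :
    0 ≤ G.arrival i y v := by
  refine G.inEdges_induction i (P := fun v => 0 ≤ G.arrival i y v) (fun v ih => ?_) v
  rw [arrival_eq_inflow, inflow]
  split_ifs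
  · exact (G.demand_pos i).le
  · exact Finset.sum_nonneg fun e he => mul_nonneg (hy e) (ih e he)

theorem arrival_of_idx_lt (i : Fin N) (y : E → ℝ) (v : V)
    (hv : (G.order i).idxOf v < (G.order i).idxOf (G.origin i)) : G.arrival i y v = 0 := by
  revert hv
  refine G.inEdges_induction i (P := fun v => (G.order i).idxOf v <
    (G.order i).idxOf (G.origin i) → G.arrival i y v = 0) (fun v ih hv => ?_) v
  rw [arrival_eq_inflow, inflow, if_neg (by rintro rfl; exact lt_irrefl _ hv)]
  refine Finset.sum_eq_zero fun e he => ?_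
  obtain ⟨hs, rfl⟩ := mem_inEdges.1 he
  rw [ih e he ((G.order_lt i e hs).trans hv), mul_zero]

/-- The backward score of `v`: the total exponential weight of the walks from `v` to the
destination. -/
noncomputable def backwardScore (i : Fin N) (w : E → ℝ) (v : V) : ℝ :=
  G.walkSum i (fun e => Real.exp (w e)) v

theorem backwardScore_dest (i : Fin N) (w : E → ℝ) : G.backwardScore i w (G.dest i) = 1 :=
  G.walkSum_dest i _

theorem backwardScore_of_ne {i : Fin N} (w : E → ℝ) {v : V} (hv : v ≠ G.dest i) :
    G.backwardScore i w v =
      ∑ e ∈ G.outEdges i v, Real.exp (w e) * G.backwardScore i w (G.head e) :=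
  G.walkSum_of_ne _ hv

theorem backwardScore_nonneg (i : Fin N) (w : E → ℝ) (v : V) : 0 ≤ G.backwardScore i w v :=
  G.walkSum_nonneg i (fun _ => (Real.exp_pos _).le) v

theorem backwardScore_pos {i : Fin N} (w : E → ℝ) {v : V} {p : List E} (hp : p ∈ G.walks i v) :
    0 < G.backwardScore i w v :=
  G.walkSum_pos i (fun _ => Real.exp_pos _) hp

theorem backwardScore_origin_pos (i : Fin N) (w : E → ℝ) :
    0 < G.backwardScore i w (G.origin i) :=
  G.walkSum_origin_pos i fun _ => Real.exp_pos _

theorem backwardScore_eq_sum (i : Fin N) (w : E → ℝ) (v : V) :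
    G.backwardScore i w v = ∑ p ∈ G.walks i v, Real.exp (p.map w).sum :=
  Finset.sum_congr rfl fun p _ => by simp [Real.exp_list_sum, Function.comp_def]

theorem backwardScore_head_eq_zero {i : Fin N} (w : E → ℝ) {e : E}
    (he : e ∈ G.outEdges i (G.dest i)) : G.backwardScore i w (G.head e) = 0 := by
  refine Finset.sum_eq_zero fun p hp => ?_
  obtain ⟨hs, htail⟩ := mem_outEdges.1 he
  have walk_le := G.walk_idx_add_length_le i (mem_walks.1 hp)
  have tail_lt_head := G.order_lt i e hs
  rw [htail] at tail_lt_head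
  omega

/-- The local flow that sends traffic along walks proportionally to their exponential weights. -/
noncomputable def pivot (i : Fin N) (w : E → ℝ) (e : E) : ℝ :=
  if e ∈ G.subgraph i then
    Real.exp (w e) * G.backwardScore i w (G.head e) / G.backwardScore i w (G.tail e) else 0

theorem pivot_nonneg (i : Fin N) (w : E → ℝ) (e : E) : 0 ≤ G.pivot i w e := by
  rw [pivot]
  split_ifs
  · exact div_nonneg (mul_nonneg (Real.exp_pos _).le (G.backwardScore_nonneg i w _))
      (G.backwardScore_nonneg i w _)
  · exact le_rfl

theorem prod_pivot (i : Fin N) (w : E → ℝ) {v : V} {p : List E} (hp : p ∈ G.walks i v) :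
    (p.map (G.pivot i w)).prod = Real.exp (p.map w).sum / G.backwardScore i w v := by
  induction p generalizing v with
  | nil =>
    obtain rfl : v = G.dest i := mem_walks.1 hp
    simp [backwardScore_dest]
  | cons e p ih =>
    obtain ⟨hs, rfl, hwalk⟩ := mem_walks.1 hp
    have head_pos := G.backwardScore_pos w (mem_walks.2 hwalk)
    have tail_pos := G.backwardScore_pos w hp
    rw [List.map_cons, List.prod_cons, ih (mem_walks.2 hwalk), List.map_cons, List.sum_cons,
      Real.exp_add, pivot, if_pos hs]
    field_simp

theorem walkSum_pivot (i : Fin N) (w : E → ℝ) (v : V) (hv : G.backwardScore i w v ≠ 0) :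
    G.walkSum i (G.pivot i w) v = 1 := by
  rw [walkSum, Finset.sum_congr rfl fun p hp => G.prod_pivot i w hp, ← Finset.sum_div,
    ← backwardScore_eq_sum, div_self hv]

/-- The loads of the pivot local flow. -/
noncomputable def pivotLoad (i : Fin N) (w : E → ℝ) (e : E) : ℝ :=
  G.pivot i w e * G.arrival i (G.pivot i w) (G.tail e)

theorem arrival_pivot (i : Fin N) (w : E → ℝ) (v : V) :
    G.arrival i (G.pivot i w) v = G.inflow i (G.demand i) (G.pivotLoad i w) v :=
  G.arrival_eq_inflow i _ v

theorem backwardScore_ne_zero {i : Fin N} {w : E → ℝ} {v : V}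
    (h : G.arrival i (G.pivot i w) v ≠ 0) : G.backwardScore i w v ≠ 0 := by
  rw [arrival_eq_inflow, inflow] at h
  split_ifs at h with ho
  · exact ho ▸ (G.backwardScore_origin_pos i w).ne'
  · contrapose! h
    refine Finset.sum_eq_zero fun e he => ?_
    obtain ⟨hs, rfl⟩ := mem_inEdges.1 he
    rw [pivot, if_pos hs, h, mul_zero, zero_div, zero_mul]

theorem sum_outEdges_pivotLoad {i : Fin N} (w : E → ℝ) {v : V} (hv : v ≠ G.dest i) :
    ∑ e ∈ G.outEdges i v, G.pivotLoad i w e = G.arrival i (G.pivot i w) v := by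
  have hload : ∀ e ∈ G.outEdges i v, G.pivotLoad i w e =
      Real.exp (w e) * G.backwardScore i w (G.head e) *
        (G.arrival i (G.pivot i w) v / G.backwardScore i w v) := fun e he => by
    obtain ⟨hs, rfl⟩ := mem_outEdges.1 he
    rw [pivotLoad, pivot, if_pos hs]
    ring
  rw [Finset.sum_congr rfl hload, ← Finset.sum_mul, ← G.backwardScore_of_ne w hv]
  by_cases harrival : G.arrival i (G.pivot i w) v = 0
  · rw [harrival, zero_div, mul_zero]
  · rw [mul_div_cancel₀ _ (G.backwardScore_ne_zero harrival)]

theorem isEdgeFlow_pivotLoad (i : Fin N) (w : E → ℝ) :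
    G.IsEdgeFlow i (G.demand i) (G.pivotLoad i w) where
  nonneg e _ := mul_nonneg (G.pivot_nonneg i w e) (G.arrival_nonneg i (G.pivot_nonneg i w) _)
  into_origin e he := by
    obtain ⟨hs, hhead⟩ := mem_inEdges.1 he
    rw [pivotLoad, G.arrival_of_idx_lt i _ _ (hhead ▸ G.order_lt i e hs), mul_zero]
  out_dest e he := by simp [pivotLoad, pivot, G.backwardScore_head_eq_zero w he]
  balance v hv := (G.sum_outEdges_pivotLoad w hv).trans (G.arrival_pivot i w v)

theorem backwardScore_origin (i : Fin N) (θ : E → ℝ) :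
    G.backwardScore i θ (G.origin i) = ∑ p, Real.exp (G.routeScore θ i p) := by
  rw [backwardScore_eq_sum]
  exact (G.sum_route i fun p => Real.exp (p.map θ).sum).symm

theorem pivotLoad_eq_pairLoad_logit (i : Fin N) (θ : E → ℝ) {e : E} (he : e ∈ G.subgraph i) :
    G.pivotLoad i θ e = G.pairLoad (G.logit θ) i e := by
  refine ((G.isEdgeFlow_pivotLoad i θ).pairLoad_eq G (g := G.pivot i θ) (fun e _ => ?_)
    (fun v hv => G.walkSum_pivot i θ v (G.backwardScore_ne_zero ?_)) (fun p => ?_) he).symm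
  · rw [← arrival_pivot, pivotLoad]
  · rwa [arrival_pivot]
  · rw [G.prod_pivot i θ (mem_walks.2 p.2), backwardScore_origin]
    rfl

theorem pivotLoad_congr {i : Fin N} {w θ : E → ℝ} (hw : ∀ e ∈ G.subgraph i, w e = θ e) {e : E}
    (he : e ∈ G.subgraph i) : G.pivotLoad i w e = G.pivotLoad i θ e := by
  have routeScore_eq : G.routeScore w i = G.routeScore θ i := funext fun p =>
    congrArg List.sum (List.map_congr_left fun e he => hw e (p.2.mem he))
  simp only [G.pivotLoad_eq_pairLoad_logit i _ he, pairLoad, logit, routeScore_eq]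

end RoutingNetwork

theorem foldl_eq_of_append_singleton {α β : Type*} (F : List α → β) (f : β → α → β) (l : List α)
    (hF : ∀ l₁ a l₂, l = l₁ ++ a :: l₂ → f (F l₁) a = F (l₁ ++ [a])) :
    l.foldl f (F []) = F l := by
  induction l using List.reverseRecOn with
  | nil => rfl
  | append_singleton l b ih =>
    rw [List.foldl_append, ih fun l₁ a l₂ h => hF l₁ a (l₂ ++ [b]) (by simp [h])]
    exact hF l b [] rfl

theorem mem_of_idxOf_lt {α : Type*} [DecidableEq α] {l₁ l₂ : List α} {a x : α}
    (ha : a ∉ l₁) (h : (l₁ ++ a :: l₂).idxOf x < (l₁ ++ a :: l₂).idxOf a) : x ∈ l₁ := by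
  by_contra hx
  rw [List.idxOf_append_of_notMem hx, List.idxOf_append_of_notMem ha] at h
  simp at h

theorem mem_of_lt_idxOf {α : Type*} [DecidableEq α] {l₁ l₂ : List α} {a x : α}
    (hx : x ∈ l₁ ++ a :: l₂) (ha : a ∉ l₁)
    (h : (l₁ ++ a :: l₂).idxOf a < (l₁ ++ a :: l₂).idxOf x) : x ∈ l₂ := by
  rcases List.mem_append.1 hx with hx₁ | hx₂
  · rw [List.idxOf_append_of_mem hx₁, List.idxOf_append_of_notMem ha, List.idxOf_cons_self] at h
    have := List.idxOf_lt_length_of_mem hx₁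
    omega
  · exact List.mem_of_ne_of_mem (by rintro rfl; exact lt_irrefl _ h) hx₂

theorem foldl_update_triple {κ α β γ : Type*} [DecidableEq κ] {l : List κ} (hl : l.Nodup)
    (f : κ → α) (g : κ → γ → β) (h : κ → γ → γ) (b : (κ → α) × (κ → β) × (κ → γ)) :
    l.foldl (fun (b : (κ → α) × (κ → β) × (κ → γ)) k => (Function.update b.1 k (f k),
      Function.update b.2.1 k (g k (b.2.2 k)), Function.update b.2.2 k (h k (b.2.2 k)))) b =
    (fun k => if k ∈ l then f k else b.1 k, fun k => if k ∈ l then g k (b.2.2 k) else b.2.1 k,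
      fun k => if k ∈ l then h k (b.2.2 k) else b.2.2 k) := by
  induction l generalizing b with
  | nil => simp
  | cons a l ih =>
    obtain ⟨ha, hl⟩ := List.nodup_cons.1 hl
    rw [List.foldl_cons, ih hl]
    refine Prod.ext ?_ (Prod.ext ?_ ?_) <;> ext k <;> by_cases hk : k = a <;> simp [hk, ha]

theorem foldl_update_pair {κ α β : Type*} [DecidableEq κ] (l : List κ) (f : κ → α) (g : κ → β)
    (b : (κ → α) × (κ → β)) :
    l.foldl (fun (b : (κ → α) × (κ → β)) k =>
      (Function.update b.1 k (f k), Function.update b.2 k (g k))) b =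
    (fun k => if k ∈ l then f k else b.1 k, fun k => if k ∈ l then g k else b.2 k) := by
  induction l generalizing b with
  | nil => simp
  | cons a l ih =>
    rw [List.foldl_cons, ih]
    refine Prod.ext ?_ ?_ <;> ext k <;> by_cases hk : k = a <;> simp [hk]

namespace RoutingNetwork

variable {V E : Type} [Fintype V] [DecidableEq V] [Fintype E] [DecidableEq E] {N : ℕ}
  (G : RoutingNetwork V E N)

open Counted

theorem foldl_order {β : Type*} (i : Fin N) (F : List V → β) (f : β → V → β)
    (hF : ∀ l v, v ∉ l → (∀ e ∈ G.inEdges i v, G.tail e ∈ l) → f (F l) v = F (l ++ [v])) :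
    (G.order i).foldl f (F []) = F (G.order i) := by
  refine foldl_eq_of_append_singleton F f _ fun l v l₂ hl => ?_
  have hv : v ∉ l := fun h =>
    List.disjoint_of_nodup_append (hl ▸ G.order_nodup i) h List.mem_cons_self
  refine hF l v hv fun e he => ?_
  obtain ⟨hs, rfl⟩ := mem_inEdges.1 he
  exact mem_of_idxOf_lt hv (hl ▸ G.order_lt i e hs)

theorem foldl_reverse_order {β : Type*} (i : Fin N) (F : List V → β) (f : β → V → β)
    (hF : ∀ l v, (∀ e ∈ G.outEdges i v, G.head e ∈ l) → f (F l) v = F (l ++ [v])) :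
    (G.order i).reverse.foldl f (F []) = F (G.order i).reverse := by
  refine foldl_eq_of_append_singleton F f _ fun l v l₂ hl => hF l v fun e he => ?_
  have horder : G.order i = l₂.reverse ++ v :: l.reverse := by
    rw [← List.reverse_reverse (G.order i), hl]; simp
  have hv : v ∉ l₂.reverse := fun h =>
    List.disjoint_of_nodup_append (horder ▸ G.order_nodup i) h List.mem_cons_self
  obtain ⟨hs, rfl⟩ := mem_outEdges.1 he
  exact List.mem_reverse.1
    (mem_of_lt_idxOf (horder ▸ G.mem_order i (G.head e)) hv (horder ▸ G.order_lt i e hs))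

/-- The edge table with the entries of `f` on the edges of pair `i` that leave the vertices of `l`
and the entries of `g` elsewhere: the content of a table that is being filled vertex by vertex. -/
def outTable (i : Fin N) (l : List V) (f g : E → ℝ) (e : E) : ℝ :=
  if e ∈ G.subgraph i ∧ G.tail e ∈ l then f e else g e

theorem outTable_nil (i : Fin N) (f g : E → ℝ) : G.outTable i [] f g = g := by
  ext e; simp [outTable]

theorem outTable_of_forall_mem {i : Fin N} {l : List V} (hl : ∀ v, v ∈ l) (f g : E → ℝ) :
    G.outTable i l f g = fun e => if e ∈ G.subgraph i then f e else g e := by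
  ext e; simp [outTable, hl]

theorem outTable_append_singleton (i : Fin N) (l : List V) (v : V) (f g : E → ℝ) (e : E) :
    G.outTable i (l ++ [v]) f g e = if e ∈ G.outEdges i v then f e else G.outTable i l f g e := by
  by_cases hs : e ∈ G.subgraph i <;> by_cases hv : G.tail e = v <;>
    simp [outTable, mem_outEdges, hs, hv]

theorem outTable_of_mem_outEdges {i : Fin N} {l : List V} {v : V} (hv : v ∉ l) (f g : E → ℝ)
    {e : E} (he : e ∈ G.outEdges i v) : G.outTable i l f g e = g e :=
  if_neg fun h => hv ((mem_outEdges.1 he).2 ▸ h.2)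

theorem foldl_update_outTable (i : Fin N) (l : List V) (v : V) {f x : E → ℝ} (g : E → ℝ)
    (hx : ∀ e ∈ G.outEdges i v, x e = f e) :
    (G.outEdges i v).toList.foldl (fun t e => Function.update t e (x e)) (G.outTable i l f g) =
      G.outTable i (l ++ [v]) f g := by
  ext e
  rw [foldl_update (f := x), outTable_append_singleton]
  simp only [Finset.mem_toList]
  split_ifs with he
  · exact hx e he
  · rfl

theorem foldl_update_outTable_triple (i : Fin N) {l : List V} {v : V} (hv : v ∉ l) {f x : E → ℝ}
    (z : E → ℝ) (hx : ∀ e ∈ G.outEdges i v, x e = f e) (g h : ℝ → ℝ → ℝ) :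
    (G.outEdges i v).toList.foldl (fun (b : (E → ℝ) × (E → ℝ) × (E → ℝ)) e =>
      (Function.update b.1 e (x e), Function.update b.2.1 e (g (x e) (b.2.2 e)),
        Function.update b.2.2 e (h (x e) (b.2.2 e))))
        (G.outTable i l f 0, G.outTable i l (fun e => g (f e) (z e)) 0,
          G.outTable i l (fun e => h (f e) (z e)) z) =
      (G.outTable i (l ++ [v]) f 0, G.outTable i (l ++ [v]) (fun e => g (f e) (z e)) 0,
        G.outTable i (l ++ [v]) (fun e => h (f e) (z e)) z) := by
  rw [foldl_update_triple (Finset.nodup_toList _) x (fun e => g (x e)) (fun e => h (x e))]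
  refine Prod.ext ?_ (Prod.ext ?_ ?_) <;> ext e <;> by_cases he : e ∈ G.outEdges i v <;>
    simp [outTable_append_singleton, he, hx, G.outTable_of_mem_outEdges hv]

theorem val_pushBackward (i : Fin N) (w : E → ℝ) : (G.pushBackward i w).val = G.pivot i w := by
  let F (l : List V) : (V → ℝ) × (E → ℝ) :=
    (fun v => if v ∈ l then G.backwardScore i w v else 0, G.outTable i l (G.pivot i w) 0)
  have hstart : ((fun _ => 0, fun _ => 0) : (V → ℝ) × (E → ℝ)) = F [] := by
    simp only [F, outTable_nil, List.not_mem_nil, if_false]; rfl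
  have hend : (F (G.order i).reverse).2 = G.pivot i w := by
    ext e
    simp only [F, G.outTable_of_forall_mem fun v => List.mem_reverse.2 (G.mem_order i v), pivot]
    split_ifs <;> rfl
  simp only [pushBackward, val_bind, val_pure, val_foldlM, alloc]
  rw [hstart, ← hend]
  refine congrArg Prod.snd (G.foldl_reverse_order i F _ fun l v hl => ?_)
  have hscore : Function.update (F l).1 v (G.backwardScore i w v) = (F (l ++ [v])).1 := by
    ext v'
    by_cases hv : v' = v <;> simp [F, hv]
  have hshare : ∀ e ∈ G.outEdges i v, Real.exp (w e) * (F (l ++ [v])).1 (G.head e) /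
      G.backwardScore i w v = G.pivot i w e := fun e he => by
    have hhead : (F (l ++ [v])).1 (G.head e) = G.backwardScore i w (G.head e) :=
      if_pos (List.mem_append_left _ (hl e he))
    obtain ⟨hs, rfl⟩ := mem_outEdges.1 he
    rw [hhead, pivot, if_pos hs]
  have hstep : (Function.update (F l).1 v (G.backwardScore i w v),
      (G.outEdges i v).toList.foldl (fun t e => Function.update t e (Real.exp (w e) *
        Function.update (F l).1 v (G.backwardScore i w v) (G.head e) / G.backwardScore i w v))
        (F l).2) = F (l ++ [v]) := by
    rw [hscore]
    exact Prod.ext rfl (G.foldl_update_outTable i l v 0 hshare)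
  split_ifs with hv <;> simp only [exp, mul, div, write, val_bind, val_pure, val_op, val_foldlM,
    val_sumOver, Finset.sum_map_toList]
  · simpa only [hv, backwardScore_dest] using hstep
  · have hsum : ∑ e ∈ G.outEdges i v, (F l).1 (G.head e) * Real.exp (w e) =
        G.backwardScore i w v := by
      rw [G.backwardScore_of_ne w hv]
      exact Finset.sum_congr rfl fun e he => by simp only [F, if_pos (hl e he), mul_comm]
    rwa [hsum]

theorem val_pullForward (i : Fin N) (q z : E → ℝ) (α A : ℝ) :
    (G.pullForward i q z α A).val =
      (fun e => if e ∈ G.subgraph i then (α * (q e * G.arrival i q (G.tail e)) + z e) / A else 0,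
        fun e => if e ∈ G.subgraph i then z e + α * (q e * G.arrival i q (G.tail e)) else z e) := by
  set X : E → ℝ := fun e => q e * G.arrival i q (G.tail e) with hX
  let F (l : List V) : (E → ℝ) × (E → ℝ) × (E → ℝ) :=
    (G.outTable i l X 0, G.outTable i l (fun e => (α * X e + z e) / A) 0,
      G.outTable i l (fun e => z e + α * X e) z)
  have hstart : ((fun _ => 0, fun _ => 0, z) : (E → ℝ) × (E → ℝ) × (E → ℝ)) = F [] := by
    simp only [F, outTable_nil]; rfl
  have hend : (F (G.order i)).2 = (fun e => if e ∈ G.subgraph i then (α * X e + z e) / A else 0,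
      fun e => if e ∈ G.subgraph i then z e + α * X e else z e) := by
    simp only [F, G.outTable_of_forall_mem (G.mem_order i), Pi.zero_apply]
  simp only [pullForward, val_bind, val_pure, val_foldlM, alloc]
  rw [hstart, ← hend]
  refine congrArg Prod.snd (G.foldl_order i F _ fun l v hv hl => ?_)
  have hload : ∀ e ∈ G.outEdges i v, G.arrival i q v * q e = X e := fun e he => by
    rw [hX, ← (mem_outEdges.1 he).2, mul_comm]
  have hstep := G.foldl_update_outTable_triple i hv z hload (fun x y => (α * x + y) / A)
    fun x y => y + α * x
  have harrival : G.arrival i q v = if v = G.origin i then G.demand i else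
      ∑ e ∈ G.inEdges i v, (F l).1 e := by
    rw [arrival_eq_inflow, inflow]
    exact if_congr Iff.rfl rfl (Finset.sum_congr rfl fun e he =>
      (if_pos ⟨(mem_inEdges.1 he).1, hl e he⟩).symm)
  split_ifs at harrival ⊢ with ho <;> simp only [mul, add, div, write, val_bind, val_pure, val_op,
    val_foldlM, val_sumOver, Finset.sum_map_toList]
  all_goals (rw [← harrival]; exact hstep)

theorem val_matchLoad (i : Fin N) (x : E → ℝ) : (G.matchLoad i x).val = G.matching i x := by
  have hstart : (fun _ => 0) = G.outTable i [] (G.matching i x) 0 := (G.outTable_nil i _ _).symm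
  have hend : G.outTable i (G.order i) (G.matching i x) 0 = G.matching i x := by
    ext e
    by_cases he : e ∈ G.subgraph i <;> simp [outTable, G.mem_order, matching, he]
  simp only [matchLoad, val_bind, val_foldlM, alloc]
  rw [hstart]
  refine (G.foldl_order i (G.outTable i · (G.matching i x) 0) _ fun l v _ _ => ?_).trans hend
  have hstep := G.foldl_update_outTable i l v (f := G.matching i x) 0
    (x := fun e => x e / G.inflow i (G.demand i) x v) fun e he => by
      obtain ⟨hs, rfl⟩ := mem_outEdges.1 he
      rw [matching, if_pos hs]
  rw [inflow] at hstep
  split_ifs at hstep ⊢ with ho <;> simpa only [div, write, val_bind, val_pure, val_op, val_foldlM,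
    val_sumOver, Finset.sum_map_toList] using hstep

/-- The loads of pair `i` averaged with the anchor `z`: `λ̄` of the pull-forward step, for the
pivot flow of the scores `w`. -/
noncomputable def averageLoad (i : Fin N) (z w : E → ℝ) (α A : ℝ) (e : E) : ℝ :=
  if e ∈ G.subgraph i then (α * G.pivotLoad i w e + z e) / A else 0

/-- The new anchor of pair `i`, for the pivot flow of the scores `w`. -/
noncomputable def nextAnchor (i : Fin N) (z w : E → ℝ) (α : ℝ) (e : E) : ℝ :=
  if e ∈ G.subgraph i then z e + α * G.pivotLoad i w e else z e

theorem val_pushPullMatch (z w : Fin N → E → ℝ) (α A : ℝ) :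
    (G.pushPullMatch z w α A).val =
      (fun i => G.matching i (G.averageLoad i (z i) (w i) α A),
        fun i => G.nextAnchor i (z i) (w i) α) := by
  have hfold := foldl_update_pair (List.finRange N)
    (fun i => G.matching i (G.averageLoad i (z i) (w i) α A))
    (fun i => G.nextAnchor i (z i) (w i) α) ((fun _ => (0 : E → ℝ)), z)
  simp only [List.mem_finRange, if_true] at hfold
  simp only [pushPullMatch, val_bind, val_foldlM, alloc, write, val_op, val_pure,
    val_pushBackward, val_pullForward, val_matchLoad]
  exact hfold

end RoutingNetwork

/-! ## The iterates as path flows -/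

/-- The sum `1 + ⋯ + (t + 1)` of the first `t + 1` steps. -/
noncomputable def stepTotal (t : ℕ) : ℝ := (t + 1) * (t + 2) / 2

theorem stepTotal_pos (t : ℕ) : 0 < stepTotal t := by unfold stepTotal; positivity

theorem stepTotal_eq_cast_succ (t : ℕ) :
    stepTotal t = ((t + 1 : ℕ) : ℝ) * ((t + 1 : ℕ) + 1) / 2 := by
  rw [stepTotal]; push_cast; ring

theorem stepTotal_eq_add (t : ℕ) : (t : ℝ) * (t + 1) / 2 + (t + 1) = stepTotal t := by
  rw [stepTotal]; ring

namespace RoutingNetwork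

variable {V E : Type} [Fintype V] [DecidableEq V] [Fintype E] [DecidableEq E] {N : ℕ}
  (G : RoutingNetwork V E N)

open Counted

theorem val_tabulate (f : Fin N → E → Counted ℝ) :
    (G.tabulate f).val = fun i => Set.indicator (G.subgraph i) fun e => (f i e).val := by
  ext i e
  simp only [tabulate, val_bind, val_foldlM, alloc, write, val_op]
  rw [foldl_update (f := fun i => (G.subgraph i).toList.foldl
    (fun row e => Function.update row e (f i e).val) fun _ => 0), if_pos (List.mem_finRange i),
    foldl_update (f := fun e => (f i e).val)]
  simp [Set.indicator_apply]

omit [Fintype V] [DecidableEq V] in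
theorem foldl_update_univ (f : E → ℝ) :
    (Finset.univ : Finset E).toList.foldl (fun t e => Function.update t e (f e)) (fun _ => 0) =
      f := by
  ext e
  rw [foldl_update (f := f)]
  simp

omit [Fintype V] [DecidableEq V] in
theorem val_measureCosts (cost : E → ℝ) : (measureCosts cost).val = cost := by
  simp only [measureCosts, val_bind, val_foldlM, alloc, write, val_op, foldl_update_univ]

/-- The state of the algorithm at the level of path flows: the negative cumulative costs, the
cumulative pivot flows, and the cumulative squared cost variations. -/
structure PathState where
  weight : E → ℝ
  anchor : ∀ i, G.Route i → ℝ
  rateSum : ℝ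

namespace PathState

variable {G} {S : Type*} (c : E → ℝ → S → ℝ) (t : ℕ) (s : G.PathState)

/-- The learning rate. -/
noncomputable def rate : ℝ := 1 / √(1 + s.rateSum)

/-- The average of the pivot flow with scores `θ` and the earlier pivot flows. -/
noncomputable def averageFlow (θ : E → ℝ) : ∀ i, G.Route i → ℝ :=
  ((t + 1) / stepTotal t) • G.logit θ + (1 / stepTotal t) • s.anchor

/-- The edge scores of the test phase. -/
noncomputable def testScore : E → ℝ := s.rate • s.weight

/-- The costs observed in the test phase when nature is in state `x`. -/
noncomputable def testCost (x : S) : E → ℝ :=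
  fun e => c e (G.load (s.averageFlow t s.testScore) e) x

/-- The edge scores of the recommendation phase. -/
noncomputable def score (x : S) : E → ℝ := s.rate • (s.weight - ((t : ℝ) + 1) • s.testCost c t x)

/-- The recommended flow. -/
noncomputable def flow (x : S) : ∀ i, G.Route i → ℝ := s.averageFlow t (s.score c t x)

/-- The costs observed in the recommendation phase when nature is in state `x` during the test
phase and in state `x'` during the recommendation phase. -/
noncomputable def cost (x x' : S) : E → ℝ := fun e => c e (G.load (s.flow c t x) e) x'

/-- The state after iteration `t + 1`. -/
noncomputable def next (x x' : S) : G.PathState where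
  weight := s.weight - ((t : ℝ) + 1) • s.cost c t x x'
  anchor := s.anchor + ((t : ℝ) + 1) • G.logit (s.score c t x)
  rateSum := s.rateSum + ((t + 1) * G.routeNorm (s.cost c t x x' - s.testCost c t x)) ^ 2

end PathState

/-- The states of the algorithm before the iterations. -/
noncomputable def pathRun {S : Type*} (c : E → ℝ → S → ℝ) (ζ : ℕ × Bool → S) : ℕ → G.PathState
  | 0 => ⟨0, 0, 0⟩
  | t + 1 => (pathRun c ζ t).next c t (ζ (t + 1, false)) (ζ (t + 1, true))

/-- The flow recommended in epoch `t + 1`. -/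
noncomputable def runFlow {S : Type*} (c : E → ℝ → S → ℝ) (ζ : ℕ × Bool → S) (t : ℕ) :
    ∀ i, G.Route i → ℝ := (G.pathRun c ζ t).flow c t (ζ (t + 1, false))

/-- The state `a` of the program before iteration `t + 1` represents the state `s`.  The two only
have to agree on the subgraphs of the pairs: the program never reads the other entries. -/
structure Represents (t : ℕ) (a : AdaState E N) (s : G.PathState) : Prop where
  weight : ∀ i, ∀ e ∈ G.subgraph i, a.weight i e = s.weight e
  isEdgeFlow : ∀ i, G.IsEdgeFlow i (t * (t + 1) / 2 * G.demand i) (a.anchor i)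
  anchor : ∀ i, ∀ e ∈ G.subgraph i, a.anchor i e = G.pairLoad s.anchor i e
  rate : a.rate = s.rate
  stepSum : a.stepSum = t * (t + 1) / 2
  rateSum : a.rateSum = s.rateSum

theorem sum_pairLoad_subgraph (f : ∀ i, G.Route i → ℝ) (e : E) :
    (∑ i, if e ∈ G.subgraph i then G.pairLoad f i e else 0) = G.load f e := by
  rw [load_eq_sum_pairLoad]
  refine Finset.sum_congr rfl fun i _ => ?_
  split_ifs with h
  · rfl
  · rw [G.pairLoad_of_notMem f h]

theorem val_iteration {testCost cost : (Fin N → E → ℝ) → E → ℝ} {α A : ℝ} {a : AdaState E N}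
    {c₁ c₂ : E → ℝ} {w : Fin N → E → ℝ} (hA : a.stepSum + α = A)
    (hc₁ : testCost (G.pushPullMatch a.anchor
      (fun i => Set.indicator (G.subgraph i) fun e => a.rate * a.weight i e) α A).val.1 = c₁)
    (hw : w = fun i => Set.indicator (G.subgraph i) fun e =>
      a.rate * Set.indicator (G.subgraph i) (fun e => a.weight i e - α * c₁ e) e)
    (hc₂ : cost (G.pushPullMatch a.anchor w α A).val.1 = c₂) :
    (G.iteration testCost cost α a).val =
      { weight := fun i => Set.indicator (G.subgraph i) fun e => a.weight i e - α * c₂ e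
        anchor := (G.pushPullMatch a.anchor w α A).val.2
        rate := 1 / √(1 + (a.rateSum + (α * G.routeNorm (c₂ - c₁)) ^ 2))
        stepSum := A
        rateSum := a.rateSum + (α * G.routeNorm (c₂ - c₁)) ^ 2
        localFlow := (G.pushPullMatch a.anchor w α A).val.1 } := by
  subst hA hc₁ hw hc₂
  simp only [iteration, val_bind, val_pure, Counted.add, Counted.mul, Counted.sub, Counted.sqrt,
    Counted.div, val_op, val_tabulate, val_measureCosts, alloc, write, val_foldlM,
    foldl_update_univ, val_routeNormProgram_eq_routeNorm, ← sq]
  rfl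

namespace Represents

variable {G} {t : ℕ} {a : AdaState E N} {s : G.PathState} {w : Fin N → E → ℝ} {θ : E → ℝ}

theorem isEdgeFlow_averageLoad (h : G.Represents t a s) (w : Fin N → E → ℝ) (i : Fin N) :
    G.IsEdgeFlow i (G.demand i)
      (G.averageLoad i (a.anchor i) (w i) (t + 1) (stepTotal t)) := by
  have hA := stepTotal_pos t
  convert ((G.isEdgeFlow_pivotLoad i (w i)).linear (h.isEdgeFlow i) (a := (t + 1) / stepTotal t)
    (b := 1 / stepTotal t) (by positivity) (by positivity)).congr
      (l' := G.averageLoad i (a.anchor i) (w i) (t + 1) (stepTotal t))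
      (fun e he => by rw [averageLoad, if_pos he]; ring) using 1
  field_simp
  rw [← stepTotal_eq_add]
  ring

theorem isEdgeFlow_nextAnchor (h : G.Represents t a s) (w : Fin N → E → ℝ) (i : Fin N) :
    G.IsEdgeFlow i (stepTotal t * G.demand i)
      (G.nextAnchor i (a.anchor i) (w i) (t + 1)) := by
  convert ((G.isEdgeFlow_pivotLoad i (w i)).linear (h.isEdgeFlow i) (a := t + 1) (b := 1)
    (by positivity) (by positivity)).congr (l' := G.nextAnchor i (a.anchor i) (w i) (t + 1))
      (fun e he => by rw [nextAnchor, if_pos he]; ring) using 1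
  rw [← stepTotal_eq_add]
  ring

theorem sum_averageLoad (h : G.Represents t a s) (hw : ∀ i, ∀ e ∈ G.subgraph i, w i e = θ e)
    (e : E) :
    (∑ i, if e ∈ G.subgraph i then
      G.averageLoad i (a.anchor i) (w i) (t + 1) (stepTotal t) e else 0) =
      G.load (s.averageFlow t θ) e := by
  rw [← sum_pairLoad_subgraph]
  refine Finset.sum_congr rfl fun i _ => ?_
  split_ifs with he
  · rw [averageLoad, if_pos he, G.pivotLoad_congr (hw i) he, G.pivotLoad_eq_pairLoad_logit i θ he,
      h.anchor i e he, PathState.averageFlow, pairLoad_linear]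
    ring
  · rfl

theorem nextAnchor_eq_pairLoad (h : G.Represents t a s)
    (hw : ∀ i, ∀ e ∈ G.subgraph i, w i e = θ e) (i : Fin N) {e : E} (he : e ∈ G.subgraph i) :
    G.nextAnchor i (a.anchor i) (w i) (t + 1) e =
      G.pairLoad (s.anchor + ((t : ℝ) + 1) • G.logit θ) i e := by
  have hlinear := G.pairLoad_linear s.anchor (G.logit θ) 1 (t + 1) i e
  rw [one_smul, one_mul] at hlinear
  rw [hlinear, nextAnchor, if_pos he, G.pivotLoad_congr (hw i) he,
    G.pivotLoad_eq_pairLoad_logit i θ he, h.anchor i e he]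

theorem localLoad_pushPullMatch (h : G.Represents t a s)
    (hw : ∀ i, ∀ e ∈ G.subgraph i, w i e = θ e) :
    G.localLoad (G.pushPullMatch a.anchor w (t + 1) (stepTotal t)).val.1 =
      G.load (s.averageFlow t θ) := by
  rw [val_pushPullMatch]
  exact funext fun e =>
    (G.localLoad_matching (h.isEdgeFlow_averageLoad w) e).trans (h.sum_averageLoad hw e)

variable {S : Type*} (c : E → ℝ → S → ℝ) (x x' : S)

theorem exists_val_iteration (h : G.Represents t a s) :
    ∃ w : Fin N → E → ℝ, (∀ i, ∀ e ∈ G.subgraph i, w i e = s.score c t x e) ∧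
      (G.iteration (fun y e => c e (G.localLoad y e) x) (fun y e => c e (G.localLoad y e) x')
        (t + 1) a).val =
        { weight := fun i =>
            Set.indicator (G.subgraph i) fun e => a.weight i e - (t + 1) * s.cost c t x x' e
          anchor := fun i => G.nextAnchor i (a.anchor i) (w i) (t + 1)
          rate := (s.next c t x x').rate
          stepSum := stepTotal t
          rateSum := (s.next c t x x').rateSum
          localFlow := fun i =>
            G.matching i (G.averageLoad i (a.anchor i) (w i) (t + 1) (stepTotal t)) } := by
  have score_test : ∀ i, ∀ e ∈ G.subgraph i,
      Set.indicator (G.subgraph i) (fun e => a.rate * a.weight i e) e = s.testScore e :=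
    fun i e he => by
      rw [Set.indicator_of_mem (Finset.mem_coe.2 he), h.rate, h.weight i e he]; rfl
  have score_eq : ∀ i, ∀ e ∈ G.subgraph i, Set.indicator (G.subgraph i) (fun e => a.rate *
      Set.indicator (G.subgraph i) (fun e => a.weight i e - (t + 1) * s.testCost c t x e) e) e =
        s.score c t x e := fun i e he => by
    simp only [Set.indicator_of_mem (Finset.mem_coe.2 he), h.rate, h.weight i e he]
    rfl
  refine ⟨_, score_eq, ?_⟩
  rw [G.val_iteration (c₁ := s.testCost c t x) (c₂ := s.cost c t x x')
    (h.stepSum ▸ stepTotal_eq_add t) (by rw [h.localLoad_pushPullMatch score_test]; rfl) rfl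
    (by rw [h.localLoad_pushPullMatch score_eq]; rfl), h.rateSum, val_pushPullMatch]
  rfl

theorem next (h : G.Represents t a s) :
    G.Represents (t + 1) (G.iteration (fun y e => c e (G.localLoad y e) x)
      (fun y e => c e (G.localLoad y e) x') (t + 1) a).val (s.next c t x x') := by
  obtain ⟨w, hw, hval⟩ := h.exists_val_iteration c x x'
  rw [hval]
  refine ⟨fun i e he => ?_, fun i => ?_, fun i e he => h.nextAnchor_eq_pairLoad hw i he, rfl,
    stepTotal_eq_cast_succ t, rfl⟩
  · simp only [Set.indicator_of_mem (Finset.mem_coe.2 he), h.weight i e he]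
    rfl
  · rw [← stepTotal_eq_cast_succ]
    exact h.isEdgeFlow_nextAnchor w i

end Represents

variable {S : Type*} (c : E → ℝ → S → ℝ) (ζ : ℕ × Bool → S) (t : ℕ)

theorem represents_adaLight : G.Represents t (G.adaLight c ζ t) (G.pathRun c ζ t) := by
  induction t with
  | zero =>
    refine ⟨fun _ _ _ => rfl, fun i => ?_, fun i e _ => ?_, ?_, ?_, rfl⟩
    · simpa [adaLight] using IsEdgeFlow.zero (G := G) i
    · simp [adaLight, pathRun, pairLoad]
    · simp [adaLight, pathRun, PathState.rate]
    · simp [adaLight]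
  | succ t ih => exact ih.next c _ _

theorem isFlow_adaLightFlow : G.IsFlow (G.adaLightFlow c ζ (t + 1)) := by
  have h := G.represents_adaLight c ζ t
  obtain ⟨w, -, hval⟩ := h.exists_val_iteration c (ζ (t + 1, false)) (ζ (t + 1, true))
  rw [adaLightFlow, adaLight, hval]
  exact G.isFlow_pathFlow_matching (h.isEdgeFlow_averageLoad w)

theorem load_adaLightFlow : G.load (G.adaLightFlow c ζ (t + 1)) = G.load (G.runFlow c ζ t) := by
  have h := G.represents_adaLight c ζ t
  obtain ⟨w, hw, hval⟩ := h.exists_val_iteration c (ζ (t + 1, false)) (ζ (t + 1, true))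
  rw [adaLightFlow, adaLight, hval]
  exact funext fun e =>
    (G.load_pathFlow_matching (h.isEdgeFlow_averageLoad w) e).trans (h.sum_averageLoad hw e)

end RoutingNetwork

/-! ## Regret of the pivot flows -/

theorem adaptive_step_le {M ρ ρ' a r d : ℝ} (hM : 0 < M) (hρ : 0 < ρ) (hρ' : ρ ≤ ρ')
    (ha : ρ' ^ 2 = ρ ^ 2 + a ^ 2) (hr0 : 0 ≤ r) (hr : r ≤ 2 * M) (hd0 : 0 ≤ d) (hd : d ≤ 2 * M) :
    a * r - ρ * ((r ^ 2 + d ^ 2) / (4 * M)) ≤ 4 * M * (ρ' - ρ) - ρ' * (d ^ 2 / (4 * M)) := by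
  have hρ0 : 0 < ρ' := hρ.trans_le hρ'
  have sq_div_le {x : ℝ} (hx0 : 0 ≤ x) (hx : x ≤ 2 * M) : (ρ' - ρ) * (x ^ 2 / (4 * M)) ≤
      (ρ' - ρ) * M := by
    refine mul_le_mul_of_nonneg_left ?_ (sub_nonneg.2 hρ')
    rw [div_le_iff₀ (by linarith)]
    nlinarith
  have young : a * r ≤ ρ' * (r ^ 2 / (4 * M)) + M * (a ^ 2 / ρ') := by
    have hsq : ρ' * (r ^ 2 / (4 * M)) + M * (a ^ 2 / ρ') - a * r =
        (ρ' * r - 2 * M * a) ^ 2 / (4 * M * ρ') := by field_simp; ring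
    have hnonneg : 0 ≤ (ρ' * r - 2 * M * a) ^ 2 / (4 * M * ρ') := by positivity
    linarith
  have increment : M * (a ^ 2 / ρ') ≤ M * (2 * (ρ' - ρ)) := by
    refine mul_le_mul_of_nonneg_left ?_ hM.le
    rw [div_le_iff₀ hρ0]
    nlinarith [sq_nonneg (ρ' - ρ)]
  rw [add_div]
  linarith [sq_div_le hr0 hr, sq_div_le hd0 hd]

-- `D` collects the `d t ^ 2` of the steps after which `ρ` exceeds `√C`.
theorem exists_sq_le_and_mul_le_sum {B C γ : ℝ} (hB : 0 < B) (hC : 1 ≤ C) {ρ a d σ : ℕ → ℝ}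
    (hρ0 : ρ 0 = 1) (hρ : ∀ t, 0 ≤ ρ t) (hρs : ∀ t, ρ (t + 1) ^ 2 = ρ t ^ 2 + a t ^ 2)
    (ha : ∀ t, a t ^ 2 ≤ 2 * γ ^ 2 * d t ^ 2 + 2 * σ t ^ 2) (T : ℕ) :
    ∃ D, 0 ≤ D ∧ ρ T ^ 2 ≤ C + 2 * γ ^ 2 * D + 2 * ∑ t ∈ Finset.range T, σ t ^ 2 ∧
      √C * (D / B) ≤ ∑ t ∈ Finset.range T, ρ (t + 1) * (d t ^ 2 / B) := by
  induction T with
  | zero => exact ⟨0, le_rfl, by simp [hρ0, hC], by simp⟩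
  | succ T ih =>
    obtain ⟨D, hD, hsq, hsum⟩ := ih
    simp only [Finset.sum_range_succ]
    have hd : 0 ≤ d T ^ 2 / B := by positivity
    rcases le_total (ρ (T + 1)) (√C) with hle | hge
    · refine ⟨D, hD, ?_, hsum.trans (le_add_of_nonneg_right (mul_nonneg (hρ _) hd))⟩
      have hsmall : ρ (T + 1) ^ 2 ≤ C := by
        rw [← Real.sq_sqrt (zero_le_one.trans hC)]
        exact pow_le_pow_left₀ (hρ _) hle 2
      have hnoise : 0 ≤ ∑ t ∈ Finset.range T, σ t ^ 2 := Finset.sum_nonneg fun _ _ => sq_nonneg _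
      have hdist : 0 ≤ 2 * γ ^ 2 * D := by positivity
      linarith [sq_nonneg (σ T)]
    · refine ⟨D + d T ^ 2, by positivity, ?_, ?_⟩
      · rw [hρs]
        linarith [ha T]
      · rw [add_div, mul_add]
        exact add_le_add hsum (mul_le_mul_of_nonneg_right hge hd)

theorem mul_sqrt_sub_le {B C D γ : ℝ} (hB : 0 < B) (hC : 0 ≤ C) (hD : 0 ≤ D) :
    C * (γ * √(2 * D)) - √C * (D / B) ≤
      C * √C * (γ ^ 2 * B / 2) := by
  set q := √C
  set u := √(2 * D)
  have hq : C = q ^ 2 := (Real.sq_sqrt hC).symm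
  have hu : D = u ^ 2 / 2 := by rw [Real.sq_sqrt (by linarith)]; ring
  have hsq : q * (D / B) + q ^ 2 * q * (γ ^ 2 * B / 2) - q ^ 2 * (γ * u) =
      q / (2 * B) * (u - q * γ * B) ^ 2 := by
    rw [hu]
    field_simp
    ring
  have hnonneg : 0 ≤ q / (2 * B) * (u - q * γ * B) ^ 2 := by positivity
  rw [hq]
  linarith

theorem adaptive_sum_le {B C γ : ℝ} (hB : 0 < B) (hC : 1 ≤ C) (hγ : 0 ≤ γ) {ρ a d σ : ℕ → ℝ}
    (hρ0 : ρ 0 = 1) (hρ : ∀ t, 0 ≤ ρ t) (hρs : ∀ t, ρ (t + 1) ^ 2 = ρ t ^ 2 + a t ^ 2)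
    (ha : ∀ t, a t ^ 2 ≤ 2 * γ ^ 2 * d t ^ 2 + 2 * σ t ^ 2) (T : ℕ) :
    C * ρ T - ∑ t ∈ Finset.range T, ρ (t + 1) * (d t ^ 2 / B) ≤
      C * √C * (1 + γ ^ 2 * B / 2) +
        C * √(2 * ∑ t ∈ Finset.range T, σ t ^ 2) := by
  obtain ⟨D, hD, hsq, hsum⟩ := exists_sq_le_and_mul_le_sum hB hC hρ0 hρ hρs ha T
  have hnoise : 0 ≤ ∑ t ∈ Finset.range T, σ t ^ 2 := Finset.sum_nonneg fun _ _ => sq_nonneg _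
  have hC0 : 0 ≤ C := zero_le_one.trans hC
  have hρT : ρ T ≤ √C + γ * √(2 * D) +
      √(2 * ∑ t ∈ Finset.range T, σ t ^ 2) := by
    refine le_of_sq_le_sq ?_ (by positivity)
    have hcross : 0 ≤ √C * (γ * √(2 * D)) + √C * √(2 * ∑ t ∈ Finset.range T, σ t ^ 2) +
      γ * √(2 * D) * √(2 * ∑ t ∈ Finset.range T, σ t ^ 2) := by positivity
    linear_combination hsq + 2 * hcross - Real.sq_sqrt hC0 -
      γ ^ 2 * Real.sq_sqrt (mul_nonneg zero_le_two hD) -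
      Real.sq_sqrt (mul_nonneg zero_le_two hnoise)
  linarith [mul_le_mul_of_nonneg_left hρT hC0, mul_sqrt_sub_le (γ := γ) hB hC0 hD]

namespace RoutingNetwork

variable {V E : Type} [Fintype V] [DecidableEq V] [Fintype E] [DecidableEq E] {N : ℕ}
  (G : RoutingNetwork V E N)

theorem routeNorm_smul {a : ℝ} (ha : 0 ≤ a) (u : E → ℝ) :
    G.routeNorm (a • u) = a * G.routeNorm u := by
  simp only [routeNorm, Real.mul_iSup_of_nonneg ha, Pi.smul_apply, smul_eq_mul, abs_mul,
    abs_of_nonneg ha, List.sum_map_mul_left]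

/-- The normalised log-partition function of the scores `ρ⁻¹ • w`, rescaled to the units of the
weights `w`: the Lyapunov function of the dual iteration. -/
noncomputable def scaledPartition (ρ : ℝ) (w : E → ℝ) : ℝ :=
  ρ * (G.logPartition (ρ⁻¹ • w) - G.logPartition 0)

theorem scaledPartition_antitone (w : E → ℝ) {ρ ρ' : ℝ} (hρ : 0 < ρ) (hρ' : ρ ≤ ρ') :
    G.scaledPartition ρ' w ≤ G.scaledPartition ρ w := by
  have hρ'0 : 0 < ρ' := hρ.trans_le hρ'
  have h := mul_le_mul_of_nonneg_left (G.mul_logPartition_smul_le w (inv_nonneg.2 hρ'0.le)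
    (inv_anti₀ hρ hρ')) (mul_pos hρ hρ'0).le
  unfold scaledPartition
  linear_combination (exp := 1) h
    + ρ' * (G.logPartition 0 - G.logPartition (ρ'⁻¹ • w)) * mul_inv_cancel₀ hρ.ne'
    + ρ * (G.logPartition (ρ⁻¹ • w) - G.logPartition 0) * mul_inv_cancel₀ hρ'0.ne'

theorem mul_pairing_logit_le (hN : 1 ≤ N) {ρ ρ' α : ℝ} (hρ : 0 < ρ) (hρ' : ρ ≤ ρ') (hα : 0 ≤ α)
    (w u v : E → ℝ) (ha : ρ' ^ 2 = ρ ^ 2 + (α * G.routeNorm (u - v)) ^ 2) :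
    α * G.pairing u (G.logit (ρ⁻¹ • (w - α • v))) ≤
      G.scaledPartition ρ w - G.scaledPartition ρ' (w - α • u) + 4 * G.totalDemand * (ρ' - ρ) -
        ρ' * (G.flowDist (G.logit (ρ⁻¹ • (w - α • v))) (G.logit (ρ⁻¹ • w)) ^ 2 /
          (4 * G.totalDemand)) := by
  have hstep := adaptive_step_le (G.totalDemand_pos hN) hρ hρ' ha (G.flowDist_nonneg _ _)
    (G.flowDist_le (G.isFlow_logit (ρ⁻¹ • (w - α • u))) (G.isFlow_logit (ρ⁻¹ • (w - α • v))))
    (G.flowDist_nonneg _ _)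
    (G.flowDist_le (G.isFlow_logit (ρ⁻¹ • (w - α • v))) (G.isFlow_logit (ρ⁻¹ • w)))
  have hdescent := mul_le_mul_of_nonneg_left
    (G.pairing_logit_sub_le hN (ρ⁻¹ • w) (ρ⁻¹ • α • u) (ρ⁻¹ • α • v)) hρ.le
  simp only [← smul_sub, pairing_smul, G.routeNorm_smul hα,
    G.routeNorm_smul (inv_nonneg.2 hρ.le)] at hdescent
  have hantitone := G.scaledPartition_antitone (w - α • u) hρ hρ'
  simp only [scaledPartition] at hantitone ⊢
  linear_combination hdescent + hstep + hantitone +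
    α * (G.routeNorm (u - v) *
      G.flowDist (G.logit (ρ⁻¹ • (w - α • u))) (G.logit (ρ⁻¹ • (w - α • v))) -
      G.pairing u (G.logit (ρ⁻¹ • (w - α • v)))) * mul_inv_cancel₀ hρ.ne'

namespace PathState

variable {G} {S : Type*} (c : E → ℝ → S → ℝ) (t : ℕ) (s : G.PathState)

/-- The inverse of the learning rate. -/
noncomputable def invRate : ℝ := √(1 + s.rateSum)

/-- The pivot flow of the test phase. -/
noncomputable def testPoint : ∀ i, G.Route i → ℝ := G.logit s.testScore

/-- The pivot flow of the recommendation phase. -/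
noncomputable def point (x : S) : ∀ i, G.Route i → ℝ := G.logit (s.score c t x)

/-- The Lyapunov function of the iteration. -/
noncomputable def energy : ℝ := G.scaledPartition s.invRate s.weight

theorem rate_eq_inv_invRate : s.rate = s.invRate⁻¹ := one_div _

variable {s}

theorem invRate_pos (hs : 0 ≤ s.rateSum) : 0 < s.invRate :=
  Real.sqrt_pos.2 (add_pos_of_pos_of_nonneg one_pos hs)

theorem rateSum_le_rateSum_next (x x' : S) : s.rateSum ≤ (s.next c t x x').rateSum :=
  le_add_of_nonneg_right (sq_nonneg _)

theorem invRate_next_sq (hs : 0 ≤ s.rateSum) (x x' : S) :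
    (s.next c t x x').invRate ^ 2 = s.invRate ^ 2 +
      ((t + 1) * G.routeNorm (s.cost c t x x' - s.testCost c t x)) ^ 2 := by
  have hnext := hs.trans (rateSum_le_rateSum_next c t x x')
  rw [invRate, invRate, Real.sq_sqrt (add_nonneg zero_le_one hs),
    Real.sq_sqrt (add_nonneg zero_le_one hnext), next, add_assoc]

theorem mul_pairing_cost_point_le (hN : 1 ≤ N) (hs : 0 ≤ s.rateSum) (x x' : S) :
    (t + 1) * G.pairing (s.cost c t x x') (s.point c t x) ≤
      s.energy - (s.next c t x x').energy +
        4 * G.totalDemand * ((s.next c t x x').invRate - s.invRate) -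
        (s.next c t x x').invRate *
          (G.flowDist (s.point c t x) s.testPoint ^ 2 / (4 * G.totalDemand)) := by
  rw [point, testPoint, score, testScore, rate_eq_inv_invRate]
  exact G.mul_pairing_logit_le hN (invRate_pos hs)
    (Real.sqrt_le_sqrt (add_le_add_right (rateSum_le_rateSum_next c t x x') 1)) (by positivity)
    s.weight _ _ (invRate_next_sq c t hs x x')

end PathState

section Run

variable {S : Type*} (c : E → ℝ → S → ℝ) (ζ : ℕ × Bool → S)

/-- The pivot flow of the recommendation phase of epoch `t + 1`. -/
noncomputable def runPoint (t : ℕ) : ∀ i, G.Route i → ℝ :=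
  (G.pathRun c ζ t).point c t (ζ (t + 1, false))

/-- The costs observed in the recommendation phase of epoch `t + 1`. -/
noncomputable def runCost (t : ℕ) : E → ℝ :=
  (G.pathRun c ζ t).cost c t (ζ (t + 1, false)) (ζ (t + 1, true))

/-- The costs observed in the test phase of epoch `t + 1`. -/
noncomputable def runTestCost (t : ℕ) : E → ℝ :=
  (G.pathRun c ζ t).testCost c t (ζ (t + 1, false))

/-- The distance of the pivot flows of the two phases of epoch `t + 1`. -/
noncomputable def runDist (t : ℕ) : ℝ :=
  G.flowDist (G.runPoint c ζ t) (G.pathRun c ζ t).testPoint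

theorem rateSum_pathRun_nonneg (t : ℕ) : 0 ≤ (G.pathRun c ζ t).rateSum := by
  induction t with
  | zero => exact le_rfl
  | succ t ih => exact ih.trans (PathState.rateSum_le_rateSum_next c t _ _)

theorem invRate_pathRun_zero : (G.pathRun c ζ 0).invRate = 1 := by
  simp [pathRun, PathState.invRate]

theorem energy_pathRun_zero : (G.pathRun c ζ 0).energy = 0 := by
  simp [PathState.energy, scaledPartition, pathRun]

theorem pairing_weight_pathRun (T : ℕ) (f : ∀ i, G.Route i → ℝ) :
    G.pairing (G.pathRun c ζ T).weight f =
      -∑ t ∈ Finset.range T, ((t : ℝ) + 1) * G.pairing (G.runCost c ζ t) f := by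
  induction T with
  | zero => simp [pairing_zero, pathRun]
  | succ T ih =>
    rw [Finset.sum_range_succ, neg_add, ← ih, ← pairing_smul, ← sub_eq_add_neg, ← pairing_sub]
    rfl

theorem neg_sum_pairing_le_energy (T : ℕ) {f : ∀ i, G.Route i → ℝ} (hf : G.IsFlow f) :
    -∑ t ∈ Finset.range T, ((t : ℝ) + 1) * G.pairing (G.runCost c ζ t) f ≤
      (G.pathRun c ζ T).energy + (G.pathRun c ζ T).invRate * G.logPartition 0 := by
  have hpos := PathState.invRate_pos (G.rateSum_pathRun_nonneg c ζ T)
  have hdual := mul_le_mul_of_nonneg_left (G.pairing_le_logPartition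
    ((G.pathRun c ζ T).invRate⁻¹ • (G.pathRun c ζ T).weight) hf) hpos.le
  rw [pairing_smul, mul_inv_cancel_left₀ hpos.ne', pairing_weight_pathRun] at hdual
  rw [PathState.energy, scaledPartition]
  linarith

theorem sum_pairing_runPoint_le (hN : 1 ≤ N) (T : ℕ) :
    ∑ t ∈ Finset.range T, ((t : ℝ) + 1) * G.pairing (G.runCost c ζ t) (G.runPoint c ζ t) ≤
      -(G.pathRun c ζ T).energy + 4 * G.totalDemand * ((G.pathRun c ζ T).invRate - 1) -
        ∑ t ∈ Finset.range T, (G.pathRun c ζ (t + 1)).invRate *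
          (G.runDist c ζ t ^ 2 / (4 * G.totalDemand)) := by
  induction T with
  | zero => simp [energy_pathRun_zero, invRate_pathRun_zero]
  | succ T ih =>
    rw [Finset.sum_range_succ, Finset.sum_range_succ]
    have hstep : ((T : ℝ) + 1) * G.pairing (G.runCost c ζ T) (G.runPoint c ζ T) ≤
        (G.pathRun c ζ T).energy - (G.pathRun c ζ (T + 1)).energy + 4 * G.totalDemand *
          ((G.pathRun c ζ (T + 1)).invRate - (G.pathRun c ζ T).invRate) -
          (G.pathRun c ζ (T + 1)).invRate * (G.runDist c ζ T ^ 2 / (4 * G.totalDemand)) :=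
      PathState.mul_pairing_cost_point_le c T hN (G.rateSum_pathRun_nonneg c ζ T) _ _
    linarith

theorem regret_le (hN : 1 ≤ N) (T : ℕ) {f : ∀ i, G.Route i → ℝ} (hf : G.IsFlow f) :
    ∑ t ∈ Finset.range T, ((t : ℝ) + 1) *
        (G.pairing (G.runCost c ζ t) (G.runPoint c ζ t) - G.pairing (G.runCost c ζ t) f) ≤
      (G.logPartition 0 + 4 * G.totalDemand) * (G.pathRun c ζ T).invRate -
        ∑ t ∈ Finset.range T, (G.pathRun c ζ (t + 1)).invRate *
          (G.runDist c ζ t ^ 2 / (4 * G.totalDemand)) := by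
  simp only [mul_sub, Finset.sum_sub_distrib]
  linarith [G.sum_pairing_runPoint_le c ζ hN T, G.neg_sum_pairing_le_energy c ζ T hf,
    G.totalDemand_nonneg]

end Run

end RoutingNetwork

/-! ## The potential -/

/-- Cost functions with the properties of a cost model at all loads, with an explicit bound `H`. -/
structure IsRegularCost {E S : Type*} [MeasurableSpace S] (c : E → ℝ → S → ℝ) (L H : ℝ) :
    Prop where
  measurable : ∀ e x, Measurable (c e x)
  monotone : ∀ e s, Monotone fun x => c e x s
  bounded : ∀ e x s, |c e x s| ≤ H
  lipschitz : ∀ e s x y, |c e x s - c e y s| ≤ L * |x - y|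

namespace IsRegularCost

open RoutingNetwork

variable {E : Type} {S : Type*} [MeasurableSpace S] {μ : Measure S} [IsProbabilityMeasure μ]
  {c : E → ℝ → S → ℝ} {L H : ℝ}

omit [IsProbabilityMeasure μ] in
theorem integrable [IsFiniteMeasure μ] (hc : IsRegularCost c L H) (e : E) (x : ℝ) :
    Integrable (c e x) μ :=
  Integrable.of_bound (hc.measurable e x).aestronglyMeasurable H
    (Filter.Eventually.of_forall (hc.bounded e x))

omit [IsProbabilityMeasure μ] in
theorem monotone_meanCost [IsFiniteMeasure μ] (hc : IsRegularCost c L H) (e : E) :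
    Monotone (meanCost μ c e) :=
  fun x y h => integral_mono (hc.integrable e x) (hc.integrable e y) fun s => hc.monotone e s h

theorem abs_meanCost_sub_le (hc : IsRegularCost c L H) (e : E) (x y : ℝ) :
    |meanCost μ c e x - meanCost μ c e y| ≤ L * |x - y| := by
  rw [meanCost, meanCost, ← integral_sub (hc.integrable e x) (hc.integrable e y)]
  simpa using norm_integral_le_of_norm_le_const (μ := μ) (f := fun s => c e x s - c e y s)
    (Filter.Eventually.of_forall fun s => hc.lipschitz e s x y)

theorem abs_meanCost_le (hc : IsRegularCost c L H) (e : E) (x : ℝ) :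
    |meanCost μ c e x| ≤ H := by
  simpa [meanCost] using norm_integral_le_of_norm_le_const (μ := μ)
    (f := c e x) (Filter.Eventually.of_forall (hc.bounded e x))

end IsRegularCost

theorem integral_sub_integral_le_mul_sub {φ : ℝ → ℝ} (hφ : Monotone φ) (a b : ℝ) :
    (∫ x in (0 : ℝ)..a, φ x) - ∫ x in (0 : ℝ)..b, φ x ≤ φ a * (a - b) := by
  have hint : ∀ a b : ℝ, IntervalIntegrable φ volume a b := fun a b => hφ.intervalIntegrable
  rw [intervalIntegral.integral_interval_sub_left (hint _ _) (hint _ _)]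
  rcases le_total b a with h | h
  · refine (intervalIntegral.integral_mono_on h (hint _ _) intervalIntegrable_const
      fun x hx => hφ hx.2).trans ?_
    rw [intervalIntegral.integral_const, smul_eq_mul, mul_comm]
  · rw [intervalIntegral.integral_symm]
    have hmono := intervalIntegral.integral_mono_on h (intervalIntegrable_const (c := φ a))
      (hint _ _) fun x hx => hφ hx.1
    rw [intervalIntegral.integral_const, smul_eq_mul] at hmono
    linarith

namespace RoutingNetwork

variable {V E : Type} [Fintype V] [DecidableEq V] [Fintype E] [DecidableEq E] {N : ℕ}
  (G : RoutingNetwork V E N)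

theorem potential_sub_le {S : Type*} [MeasurableSpace S] {μ : Measure S} [IsFiniteMeasure μ]
    {c : E → ℝ → S → ℝ} {L H : ℝ} (hc : IsRegularCost c L H) (f g : ∀ i, G.Route i → ℝ) :
    G.potential μ c f - G.potential μ c g ≤
      G.pairing (fun e => meanCost μ c e (G.load f e)) f -
        G.pairing (fun e => meanCost μ c e (G.load f e)) g := by
  simp only [potential, pairing_eq_sum_load, ← Finset.sum_sub_distrib, ← mul_sub]
  exact Finset.sum_le_sum fun e _ => integral_sub_integral_le_mul_sub (hc.monotone_meanCost e) _ _

theorem routeNorm_add_le (u v : E → ℝ) : G.routeNorm (u + v) ≤ G.routeNorm u + G.routeNorm v := by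
  refine G.routeNorm_le (add_nonneg (G.routeNorm_nonneg u) (G.routeNorm_nonneg v)) fun i p => ?_
  refine le_trans ?_ (add_le_add (G.le_routeNorm u i p) (G.le_routeNorm v i p))
  rw [← List.sum_map_add]
  exact List.sum_le_sum fun e _ => abs_add_le _ _

theorem routeNorm_sub_le (u v : E → ℝ) : G.routeNorm (u - v) ≤ G.routeNorm u + G.routeNorm v := by
  rw [sub_eq_add_neg, show G.routeNorm v = G.routeNorm (-v) by simp [routeNorm]]
  exact G.routeNorm_add_le u (-v)

theorem routeNorm_le_of_abs_le {K : ℕ} (hK : ∀ i (p : G.Route i), p.1.length ≤ K) {u : E → ℝ}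
    {b : ℝ} (hb : 0 ≤ b) (hu : ∀ e, |u e| ≤ b) : G.routeNorm u ≤ K * b := by
  refine G.routeNorm_le (by positivity) fun i p => ?_
  refine (List.sum_le_card_nsmul _ b ?_).trans ?_
  · simpa using fun e _ => hu e
  · rw [List.length_map, nsmul_eq_mul]
    exact mul_le_mul_of_nonneg_right (Nat.cast_le.2 (hK i p)) hb

section Run

variable {S : Type*} (c : E → ℝ → S → ℝ) (ζ : ℕ × Bool → S)

theorem anchor_pathRun_succ (t : ℕ) :
    (G.pathRun c ζ (t + 1)).anchor = stepTotal t • G.runFlow c ζ t := by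
  have hA := (stepTotal_pos t).ne'
  simp only [pathRun, PathState.next, runFlow, PathState.flow, PathState.averageFlow, smul_add,
    smul_smul, mul_div_cancel₀ _ hA, one_smul]
  exact add_comm _ _

theorem runFlow_zero : G.runFlow c ζ 0 = G.runPoint c ζ 0 := by
  simp [runFlow, PathState.flow, PathState.averageFlow, pathRun, runPoint, PathState.point,
    stepTotal]

theorem runFlow_succ (t : ℕ) :
    G.runFlow c ζ (t + 1) = (((t + 1 : ℕ) + 1) / stepTotal (t + 1)) • G.runPoint c ζ (t + 1) +
      (stepTotal t / stepTotal (t + 1)) • G.runFlow c ζ t := by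
  rw [runFlow, PathState.flow, PathState.averageFlow, anchor_pathRun_succ, smul_smul,
    one_div_mul_eq_div]
  rfl

theorem stepTotal_mul_pairing_runFlow_succ (t : ℕ) (u : E → ℝ) :
    stepTotal (t + 1) * G.pairing u (G.runFlow c ζ (t + 1)) =
      ((t + 1 : ℕ) + 1) * G.pairing u (G.runPoint c ζ (t + 1)) +
        stepTotal t * G.pairing u (G.runFlow c ζ t) := by
  have hA := (stepTotal_pos (t + 1)).ne'
  rw [runFlow_succ, pairing_linear_right]
  field_simp

end Run

section Run

variable {S : Type*} [MeasurableSpace S] (μ : Measure S) (c : E → ℝ → S → ℝ) (ζ : ℕ × Bool → S)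

/-- The flow of the test phase of epoch `t + 1`. -/
noncomputable def runTestFlow (t : ℕ) : ∀ i, G.Route i → ℝ :=
  (G.pathRun c ζ t).averageFlow t (G.pathRun c ζ t).testScore

/-- The mean costs at the flow recommended in epoch `t + 1`. -/
noncomputable def runMean (t : ℕ) : E → ℝ := fun e => meanCost μ c e (G.load (G.runFlow c ζ t) e)

/-- The mean costs at the flow of the test phase of epoch `t + 1`. -/
noncomputable def runTestMean (t : ℕ) : E → ℝ :=
  fun e => meanCost μ c e (G.load (G.runTestFlow c ζ t) e)

/-- The noise of the costs observed in the recommendation phase of epoch `t + 1`. -/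
noncomputable def runNoise (t : ℕ) : E → ℝ := G.runCost c ζ t - G.runMean μ c ζ t

/-- The noise of the costs observed in the test phase of epoch `t + 1`. -/
noncomputable def runTestNoise (t : ℕ) : E → ℝ := G.runTestCost c ζ t - G.runTestMean μ c ζ t

/-- The squared variation of the noise between the two phases, cumulated over the first `T` epochs
with the squares of the steps as weights. -/
noncomputable def noiseVariation (T : ℕ) : ℝ :=
  ∑ t ∈ Finset.range T,
    ((t + 1) * G.routeNorm (G.runNoise μ c ζ t - G.runTestNoise μ c ζ t)) ^ 2

variable {μ c} {L H : ℝ}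

theorem stepTotal_mul_potential_sub_le_sum [IsFiniteMeasure μ] (hc : IsRegularCost c L H) (T : ℕ)
    (f : ∀ i, G.Route i → ℝ) :
    stepTotal T * (G.potential μ c (G.runFlow c ζ T) - G.potential μ c f) ≤
      ∑ t ∈ Finset.range (T + 1), ((t : ℝ) + 1) *
        (G.pairing (G.runMean μ c ζ t) (G.runPoint c ζ t) - G.pairing (G.runMean μ c ζ t) f) := by
  have hgradient (t : ℕ) (g : ∀ i, G.Route i → ℝ) :
      G.potential μ c (G.runFlow c ζ t) - G.potential μ c g ≤
        G.pairing (G.runMean μ c ζ t) (G.runFlow c ζ t) - G.pairing (G.runMean μ c ζ t) g :=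
    G.potential_sub_le hc _ g
  induction T with
  | zero =>
    have hzero := hgradient 0 f
    rw [runFlow_zero] at hzero
    simpa [stepTotal, runFlow_zero] using hzero
  | succ T ih =>
    rw [Finset.sum_range_succ]
    have htarget := mul_le_mul_of_nonneg_left (hgradient (T + 1) f)
      (by positivity : (0 : ℝ) ≤ ((T + 1 : ℕ) + 1))
    have hprevious := mul_le_mul_of_nonneg_left (hgradient (T + 1) (G.runFlow c ζ T))
      (stepTotal_pos T).le
    have haverage := G.stepTotal_mul_pairing_runFlow_succ c ζ T (G.runMean μ c ζ (T + 1))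
    rw [stepTotal_eq_cast_succ T] at haverage hprevious ih
    rw [← stepTotal_eq_add (T + 1)] at haverage ⊢
    linarith

variable {G} in
theorem PathState.abs_load_averageFlow_sub_le (s : G.PathState) (t : ℕ) (θ θ' : E → ℝ) (e : E) :
    |G.load (s.averageFlow t θ) e - G.load (s.averageFlow t θ') e| ≤
      (t + 1) / stepTotal t * G.flowDist (G.logit θ) (G.logit θ') := by
  have hA := stepTotal_pos t
  simp only [averageFlow, load_linear, add_sub_add_right_eq_sub, Pi.add_apply,
    Pi.smul_apply, smul_eq_mul, ← mul_sub]
  rw [abs_mul, abs_of_nonneg (by positivity)]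
  exact mul_le_mul_of_nonneg_left (G.abs_load_sub_le _ _ e) (by positivity)

variable [IsProbabilityMeasure μ]

theorem mul_routeNorm_runMean_sub_le (hL : 0 ≤ L) {K : ℕ}
    (hK : ∀ i (p : G.Route i), p.1.length ≤ K) (hc : IsRegularCost c L H) (t : ℕ) :
    (t + 1) * G.routeNorm (G.runMean μ c ζ t - G.runTestMean μ c ζ t) ≤
      2 * K * L * G.runDist c ζ t := by
  have hA := stepTotal_pos t
  have hdist : 0 ≤ G.runDist c ζ t := G.flowDist_nonneg _ _
  have hmean : G.routeNorm (G.runMean μ c ζ t - G.runTestMean μ c ζ t) ≤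
      K * (L * ((t + 1) / stepTotal t * G.runDist c ζ t)) :=
    G.routeNorm_le_of_abs_le hK (by positivity) fun e =>
      (hc.abs_meanCost_sub_le e _ _).trans (mul_le_mul_of_nonneg_left
        ((G.pathRun c ζ t).abs_load_averageFlow_sub_le t _ _ e) hL)
  have hstep : ((t : ℝ) + 1) * ((t + 1) / stepTotal t) ≤ 2 := by
    rw [← mul_div_assoc, div_le_iff₀ hA, stepTotal]
    nlinarith
  calc (t + 1) * G.routeNorm (G.runMean μ c ζ t - G.runTestMean μ c ζ t)
      ≤ (t + 1) * (K * (L * ((t + 1) / stepTotal t * G.runDist c ζ t))) := by gcongr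
    _ = (t + 1) * ((t + 1) / stepTotal t) * (K * L * G.runDist c ζ t) := by ring
    _ ≤ 2 * (K * L * G.runDist c ζ t) := by gcongr
    _ = 2 * K * L * G.runDist c ζ t := by ring

theorem mul_routeNorm_runCost_sub_sq_le (hL : 0 ≤ L) {K : ℕ}
    (hK : ∀ i (p : G.Route i), p.1.length ≤ K) (hc : IsRegularCost c L H) (t : ℕ) :
    ((t + 1) * G.routeNorm (G.runCost c ζ t - G.runTestCost c ζ t)) ^ 2 ≤
      2 * (2 * K * L) ^ 2 * G.runDist c ζ t ^ 2 +
        2 * ((t + 1) * G.routeNorm (G.runNoise μ c ζ t - G.runTestNoise μ c ζ t)) ^ 2 := by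
  have htriangle := G.routeNorm_add_le (G.runMean μ c ζ t - G.runTestMean μ c ζ t)
    (G.runNoise μ c ζ t - G.runTestNoise μ c ζ t)
  rw [show G.runMean μ c ζ t - G.runTestMean μ c ζ t +
    (G.runNoise μ c ζ t - G.runTestNoise μ c ζ t) = G.runCost c ζ t - G.runTestCost c ζ t by
      rw [runNoise, runTestNoise]; abel] at htriangle
  have hvariation : (t + 1) * G.routeNorm (G.runCost c ζ t - G.runTestCost c ζ t) ≤
      2 * K * L * G.runDist c ζ t +
        (t + 1) * G.routeNorm (G.runNoise μ c ζ t - G.runTestNoise μ c ζ t) := by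
    refine (mul_le_mul_of_nonneg_left htriangle (by positivity)).trans ?_
    rw [mul_add]
    exact add_le_add_left (G.mul_routeNorm_runMean_sub_le ζ hL hK hc t) _
  refine (pow_le_pow_left₀ (mul_nonneg (by positivity) (G.routeNorm_nonneg _)) hvariation 2).trans
    ((add_sq_le).trans_eq ?_)
  ring

/-- The factor of the inverse learning rates in the regret bound. -/
noncomputable def rateConst : ℝ := G.logPartition 0 + 4 * G.totalDemand + 1

theorem one_le_rateConst : 1 ≤ G.rateConst :=
  le_add_of_nonneg_left
    (add_nonneg G.logPartition_zero_nonneg (mul_nonneg zero_le_four G.totalDemand_nonneg))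

theorem regret_le_of_regular (hN : 1 ≤ N) (hL : 0 ≤ L) {K : ℕ}
    (hK : ∀ i (p : G.Route i), p.1.length ≤ K) (hc : IsRegularCost c L H) (T : ℕ)
    {f : ∀ i, G.Route i → ℝ} (hf : G.IsFlow f) :
    ∑ t ∈ Finset.range T, ((t : ℝ) + 1) *
        (G.pairing (G.runCost c ζ t) (G.runPoint c ζ t) - G.pairing (G.runCost c ζ t) f) ≤
      G.rateConst * √G.rateConst * (1 + 8 * K ^ 2 * L ^ 2 * G.totalDemand) +
      G.rateConst * √(2 * G.noiseVariation μ c ζ T) := by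
  have hadaptive := adaptive_sum_le (ρ := fun t => (G.pathRun c ζ t).invRate)
    (mul_pos four_pos (G.totalDemand_pos hN)) G.one_le_rateConst (by positivity : 0 ≤ 2 * K * L)
    (G.invRate_pathRun_zero c ζ) (fun t => Real.sqrt_nonneg _)
    (fun t => PathState.invRate_next_sq c t (G.rateSum_pathRun_nonneg c ζ t) _ _)
    (G.mul_routeNorm_runCost_sub_sq_le (μ := μ) ζ hL hK hc) T
  have hrate : (G.logPartition 0 + 4 * G.totalDemand) * (G.pathRun c ζ T).invRate ≤
      G.rateConst * (G.pathRun c ζ T).invRate :=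
    mul_le_mul_of_nonneg_right (le_add_of_nonneg_right zero_le_one) (Real.sqrt_nonneg _)
  rw [show (2 * K * L) ^ 2 * (4 * G.totalDemand) / 2 = 8 * K ^ 2 * L ^ 2 * G.totalDemand by ring]
    at hadaptive
  rw [noiseVariation]
  linarith [G.regret_le c ζ hN T hf]

theorem stepTotal_mul_potential_sub_le (hN : 1 ≤ N) (hL : 0 ≤ L) {K : ℕ}
    (hK : ∀ i (p : G.Route i), p.1.length ≤ K) (hc : IsRegularCost c L H) (T : ℕ)
    {f : ∀ i, G.Route i → ℝ} (hf : G.IsFlow f) :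
    stepTotal T * (G.potential μ c (G.runFlow c ζ T) - G.potential μ c f) ≤
      G.rateConst * √G.rateConst * (1 + 8 * K ^ 2 * L ^ 2 * G.totalDemand) +
      G.rateConst * √(2 * G.noiseVariation μ c ζ (T + 1)) -
      ∑ t ∈ Finset.range (T + 1), ((t : ℝ) + 1) *
        (G.pairing (G.runNoise μ c ζ t) (G.runPoint c ζ t) - G.pairing (G.runNoise μ c ζ t) f) := by
  refine (G.stepTotal_mul_potential_sub_le_sum ζ hc T f).trans
    ((le_of_eq ?_).trans (sub_le_sub_right (G.regret_le_of_regular ζ hN hL hK hc (T + 1) hf) _))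
  rw [← Finset.sum_sub_distrib]
  exact Finset.sum_congr rfl fun t _ => by rw [runNoise, pairing_sub, pairing_sub]; ring

end Run

end RoutingNetwork

/-! ## Independence and measurability -/

theorem integral_eq_of_indepFun {α S Ω : Type*} [MeasurableSpace α] [MeasurableSpace S]
    [MeasurableSpace Ω] {P : Measure Ω} [IsProbabilityMeasure P] {X : Ω → α} {Y : Ω → S}
    (hX : Measurable X) (hY : Measurable Y) (hXY : IndepFun X Y P) {g : α → S → ℝ}
    (hg : Measurable (Function.uncurry g)) {b : ℝ} (hb : ∀ x s, |g x s| ≤ b) :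
    ∫ ω, g (X ω) (Y ω) ∂P = ∫ ω, ∫ s, g (X ω) s ∂P.map Y ∂P := by
  have := Measure.isProbabilityMeasure_map (μ := P) hX.aemeasurable
  have := Measure.isProbabilityMeasure_map (μ := P) hY.aemeasurable
  have hlaw := (indepFun_iff_map_prod_eq_prod_map_map hX.aemeasurable hY.aemeasurable).1 hXY
  calc ∫ ω, g (X ω) (Y ω) ∂P
      = ∫ z, Function.uncurry g z ∂(P.map X).prod (P.map Y) := by
        rw [← hlaw, integral_map (hX.prodMk hY).aemeasurable hg.aestronglyMeasurable]
        rfl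
    _ = ∫ x, ∫ s, g x s ∂P.map Y ∂P.map X :=
        integral_prod _ (.of_bound hg.aestronglyMeasurable b (.of_forall fun z => hb z.1 z.2))
    _ = ∫ ω, ∫ s, g (X ω) s ∂P.map Y ∂P :=
        integral_map hX.aemeasurable
          hg.stronglyMeasurable.integral_prod_right.aestronglyMeasurable

theorem integral_infinitePi_eq_of_dependsOn {ι : Type*} {S : ι → Type*}
    [∀ i, MeasurableSpace (S i)] (μ : ∀ i, Measure (S i)) [∀ i, IsProbabilityMeasure (μ i)]
    {J : Finset ι} {k : ι} (hk : k ∉ J) {g : (∀ i, S i) → S k → ℝ}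
    (hg : Measurable (Function.uncurry g)) (hgJ : DependsOn g J) {b : ℝ}
    (hb : ∀ x s, |g x s| ≤ b) :
    ∫ x, g x (x k) ∂Measure.infinitePi μ = ∫ x, ∫ s, g x s ∂μ k ∂Measure.infinitePi μ := by
  classical
  obtain ⟨x₀⟩ : Nonempty (∀ i, S i) := nonempty_of_isProbabilityMeasure (Measure.infinitePi μ)
  let extend : (∀ j : J, S j) → ∀ i, S i := Function.updateFinset x₀ J
  have hind : IndepFun (fun x (j : J) => x j) (fun x => x k) (Measure.infinitePi μ) :=
    ((iIndepFun_infinitePi (P := μ) fun _ => measurable_id).indepFun_finset J {k}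
      (Finset.disjoint_singleton_right.2 hk) fun i => measurable_pi_apply i).comp measurable_id
        (measurable_pi_apply (⟨k, Finset.mem_singleton_self k⟩ : ({k} : Finset ι)))
  have hextend (x : ∀ i, S i) : g x = g (extend fun j => x j) :=
    hgJ fun j hj => by simp [extend, Function.updateFinset, Finset.mem_coe.1 hj]
  have hfubini := integral_eq_of_indepFun (g := fun y => g (extend y))
    (measurable_pi_lambda _ fun j => measurable_pi_apply _) (measurable_pi_apply k) hind
    (hg.comp ((measurable_updateFinset.comp measurable_fst).prodMk measurable_snd)) fun y => hb _
  rw [Measure.infinitePi_map_eval] at hfubini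
  simpa only [← hextend] using hfubini

theorem measurable_sum_map {α : Type*} (p : List α) :
    Measurable fun u : α → ℝ => (p.map u).sum := by
  simpa [List.map_map, Function.comp_def] using
    (p.map fun e (u : α → ℝ) => u e).measurable_fun_sum fun f hf => by
      obtain ⟨e, -, rfl⟩ := List.mem_map.1 hf
      exact measurable_pi_apply e

namespace IsRegularCost

variable {E S : Type*} [MeasurableSpace S] {c : E → ℝ → S → ℝ} {L H : ℝ}

theorem measurable_uncurry (hc : IsRegularCost c L H) (e : E) :
    Measurable (Function.uncurry (c e)) :=
  measurable_uncurry_of_continuous_of_measurable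
    (fun s => (LipschitzWith.of_le_add_mul' L fun x y => by
      have := (abs_le.1 (hc.lipschitz e s x y)).2
      rw [Real.dist_eq]
      linarith).continuous) (hc.measurable e)

theorem continuous_meanCost {E : Type} {c : E → ℝ → S → ℝ} {μ : Measure S} [IsProbabilityMeasure μ]
    (hc : IsRegularCost c L H) (e : E) : Continuous (RoutingNetwork.meanCost μ c e) :=
  (LipschitzWith.of_le_add_mul' L fun x y => by
    have := (abs_le.1 (hc.abs_meanCost_sub_le (μ := μ) e x y)).2
    rw [Real.dist_eq]
    linarith).continuous

end IsRegularCost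

namespace RoutingNetwork

variable {V E : Type} [Fintype V] [DecidableEq V] [Fintype E] [DecidableEq E] {N : ℕ}
  (G : RoutingNetwork V E N)

theorem measurable_logit : Measurable G.logit := by
  refine measurable_pi_lambda _ fun i => measurable_pi_lambda _ fun p => ?_
  simp only [logit, softmax, routeScore]
  exact ((measurable_sum_map p.1).exp.div (Finset.measurable_fun_sum _ fun p _ =>
    (measurable_sum_map p.1).exp)).const_mul _

theorem measurable_load : Measurable G.load := by
  refine measurable_pi_lambda _ fun e => Finset.measurable_fun_sum _ fun i _ =>
    Finset.measurable_fun_sum _ fun p _ => ?_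
  split_ifs
  · exact (measurable_pi_apply p).comp (measurable_pi_apply i)
  · exact measurable_const

theorem measurable_routeNorm : Measurable G.routeNorm :=
  Measurable.iSup fun r => (measurable_sum_map r.2.1).comp
    (measurable_pi_lambda (fun (u : E → ℝ) e => |u e|) fun e => (measurable_pi_apply e).abs)

theorem measurable_pairing :
    Measurable fun z : (E → ℝ) × (∀ i, G.Route i → ℝ) => G.pairing z.1 z.2 :=
  Finset.measurable_fun_sum _ fun i _ => Finset.measurable_fun_sum _ fun p _ =>
    ((measurable_pi_apply p).comp ((measurable_pi_apply i).comp measurable_snd)).fun_mul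
      ((measurable_sum_map p.1).comp measurable_fst)

section Measurability

variable {X S : Type*} [MeasurableSpace X] [MeasurableSpace S]

/-- A random state of the algorithm, measurable in every component. -/
structure MeasurableState (s : X → G.PathState) : Prop where
  weight : Measurable fun x => (s x).weight
  anchor : Measurable fun x => (s x).anchor
  rateSum : Measurable fun x => (s x).rateSum

namespace MeasurableState

variable {G} {s : X → G.PathState} (hs : G.MeasurableState s) {c : E → ℝ → S → ℝ} {L H : ℝ}
  (hc : IsRegularCost c L H) (t : ℕ) {ξ ξ' : X → S} (hξ : Measurable ξ) (hξ' : Measurable ξ')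

include hs

theorem rate : Measurable fun x => (s x).rate :=
  (hs.rateSum.const_add 1).sqrt.const_div 1

theorem averageFlow {θ : X → E → ℝ} (hθ : Measurable θ) :
    Measurable fun x => (s x).averageFlow t (θ x) :=
  ((G.measurable_logit.comp hθ).fun_const_smul _).add (hs.anchor.fun_const_smul _)

theorem testScore : Measurable fun x => (s x).testScore := hs.rate.smul hs.weight

theorem testFlow : Measurable fun x => (s x).averageFlow t (s x).testScore :=
  hs.averageFlow t hs.testScore

include hc hξ

theorem testCost : Measurable fun x => (s x).testCost c t (ξ x) :=
  measurable_pi_lambda _ fun e => (hc.measurable_uncurry e).comp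
    (((measurable_pi_apply e).comp (G.measurable_load.comp (hs.testFlow t))).prodMk hξ)

theorem score : Measurable fun x => (s x).score c t (ξ x) :=
  hs.rate.smul (hs.weight.sub ((hs.testCost hc t hξ).fun_const_smul _))

theorem point : Measurable fun x => (s x).point c t (ξ x) :=
  G.measurable_logit.comp (hs.score hc t hξ)

theorem flow : Measurable fun x => (s x).flow c t (ξ x) :=
  hs.averageFlow t (hs.score hc t hξ)

include hξ'

theorem cost : Measurable fun x => (s x).cost c t (ξ x) (ξ' x) :=
  measurable_pi_lambda _ fun e => (hc.measurable_uncurry e).comp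
    (((measurable_pi_apply e).comp (G.measurable_load.comp (hs.flow hc t hξ))).prodMk hξ')

theorem next : G.MeasurableState fun x => (s x).next c t (ξ x) (ξ' x) where
  weight := hs.weight.sub ((hs.cost hc t hξ hξ').fun_const_smul _)
  anchor := hs.anchor.add ((hs.point hc t hξ).fun_const_smul _)
  rateSum := hs.rateSum.add (((G.measurable_routeNorm.comp
    ((hs.cost hc t hξ hξ').sub (hs.testCost hc t hξ))).const_mul _).pow_const 2)

end MeasurableState

variable {μ : Measure S} {c : E → ℝ → S → ℝ} {L H : ℝ} (hc : IsRegularCost c L H) (t : ℕ)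

include hc

theorem measurableState_pathRun : G.MeasurableState fun ζ : ℕ × Bool → S => G.pathRun c ζ t := by
  induction t with
  | zero => exact ⟨measurable_const, measurable_const, measurable_const⟩
  | succ t ih => exact ih.next hc t (measurable_pi_apply _) (measurable_pi_apply _)

theorem measurable_runFlow : Measurable fun ζ => G.runFlow c ζ t :=
  (G.measurableState_pathRun hc t).flow hc t (measurable_pi_apply _)

theorem measurable_runTestFlow : Measurable fun ζ : ℕ × Bool → S => G.runTestFlow c ζ t :=
  (G.measurableState_pathRun hc t).testFlow t

theorem measurable_runPoint : Measurable fun ζ => G.runPoint c ζ t :=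
  (G.measurableState_pathRun hc t).point hc t (measurable_pi_apply _)

variable [IsProbabilityMeasure μ]

theorem measurable_potential : Measurable (G.potential μ c) :=
  Finset.measurable_fun_sum _ fun e _ => (intervalIntegral.continuous_primitive
    (fun a b => (hc.continuous_meanCost e).intervalIntegrable a b) 0).measurable.comp
      ((measurable_pi_apply e).comp G.measurable_load)

end Measurability

section Feasible

variable {S : Type*} (c : E → ℝ → S → ℝ) (ζ : ℕ × Bool → S)

theorem anchor_pathRun_nonneg (t : ℕ) (i : Fin N) (p : G.Route i) :
    0 ≤ (G.pathRun c ζ t).anchor i p := by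
  induction t with
  | zero => exact le_rfl
  | succ t ih =>
    exact add_nonneg ih (mul_nonneg (by positivity) ((G.isFlow_logit _ i).1 p))

theorem sum_anchor_pathRun (t : ℕ) (i : Fin N) :
    ∑ p, (G.pathRun c ζ t).anchor i p = t * (t + 1) / 2 * G.demand i := by
  induction t with
  | zero => simp [pathRun]
  | succ t ih =>
    simp only [pathRun, PathState.next, Pi.add_apply, Pi.smul_apply, smul_eq_mul,
      Finset.sum_add_distrib, ih, ← Finset.mul_sum, (G.isFlow_logit _ i).2]
    push_cast
    ring

theorem isFlow_averageFlow (t : ℕ) (θ : E → ℝ) :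
    G.IsFlow ((G.pathRun c ζ t).averageFlow t θ) := by
  have hA := stepTotal_pos t
  refine fun i => ⟨fun p => ?_, ?_⟩
  · have hlogit := (G.isFlow_logit θ i).1 p
    have hanchor := G.anchor_pathRun_nonneg c ζ t i p
    simp only [PathState.averageFlow, Pi.add_apply, Pi.smul_apply, smul_eq_mul]
    positivity
  · simp only [PathState.averageFlow, Pi.add_apply, Pi.smul_apply, smul_eq_mul,
      Finset.sum_add_distrib, ← Finset.mul_sum, (G.isFlow_logit _ i).2, sum_anchor_pathRun]
    field_simp
    linear_combination 2 * G.demand i * stepTotal_eq_add t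

theorem isFlow_runFlow (t : ℕ) : G.IsFlow (G.runFlow c ζ t) := G.isFlow_averageFlow c ζ t _

theorem isFlow_runTestFlow (t : ℕ) : G.IsFlow (G.runTestFlow c ζ t) :=
  G.isFlow_averageFlow c ζ t _

variable {G} in
theorem IsFlow.load_mem {f : ∀ i, G.Route i → ℝ} (hf : G.IsFlow f) (e : E) :
    G.load f e ∈ Set.Icc 0 G.totalDemand := by
  refine ⟨Finset.sum_nonneg fun i _ => Finset.sum_nonneg fun p _ => ?_, ?_⟩
  · split_ifs
    exacts [(hf i).1 p, le_rfl]
  · rw [← hf.sum_eq]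
    refine Finset.sum_le_sum fun i _ => Finset.sum_le_sum fun p _ => ?_
    split_ifs
    exacts [le_rfl, (hf i).1 p]

end Feasible

end RoutingNetwork

/-! ## Expectation of the gap -/

theorem memLp_two_sqrt {Ω : Type*} [MeasurableSpace Ω] {P : Measure Ω} {g : Ω → ℝ}
    (hg : Integrable g P) : MemLp (fun ω => √(g ω)) 2 P := by
  refine (memLp_two_iff_integrable_sq
    (Real.continuous_sqrt.comp_aestronglyMeasurable hg.1)).2 ?_
  simpa only [Real.sq_sqrt'] using hg.pos_part

theorem integral_sqrt_le {Ω : Type*} [MeasurableSpace Ω] {P : Measure Ω} [IsProbabilityMeasure P]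
    {g : Ω → ℝ} (hg : Integrable g P) (hg₀ : ∀ ω, 0 ≤ g ω) :
    ∫ ω, √(g ω) ∂P ≤ √(∫ ω, g ω ∂P) := by
  have hvariance := variance_nonneg (fun ω => √(g ω)) P
  rw [variance_eq_sub (memLp_two_sqrt hg)] at hvariance
  simp only [Pi.pow_apply, Real.sq_sqrt (hg₀ _)] at hvariance
  exact Real.le_sqrt_of_sq_le (sub_nonneg.1 hvariance)

namespace RoutingNetwork

variable {V E : Type} [Fintype V] [DecidableEq V] [Fintype E] [DecidableEq E] {N : ℕ}
  (G : RoutingNetwork V E N)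

variable {G} in
theorem IsFlow.abs_pairing_le {f : ∀ i, G.Route i → ℝ} (hf : G.IsFlow f) (u : E → ℝ) :
    |G.pairing u f| ≤ G.routeNorm u * G.totalDemand := by
  rw [← hf.sum_eq, pairing, Finset.mul_sum]
  refine (Finset.abs_sum_le_sum_abs _ _).trans (Finset.sum_le_sum fun i _ => ?_)
  rw [Finset.mul_sum]
  refine (Finset.abs_sum_le_sum_abs _ _).trans (Finset.sum_le_sum fun p _ => ?_)
  rw [abs_mul, abs_of_nonneg ((hf i).1 p), mul_comm]
  exact mul_le_mul_of_nonneg_right ((abs_sum_map_le u p.1).trans (G.le_routeNorm u i p))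
    ((hf i).1 p)

theorem routeNorm_sub_sq_le (u v : E → ℝ) :
    G.routeNorm (u - v) ^ 2 ≤ 2 * (G.routeNorm u ^ 2 + G.routeNorm v ^ 2) := by
  exact (pow_le_pow_left₀ (G.routeNorm_nonneg _) (G.routeNorm_sub_le u v) 2).trans add_sq_le

section Deviation

variable {S : Type*} [MeasurableSpace S] {μ : Measure S} {c : E → ℝ → S → ℝ} {L H : ℝ}

/-- Deviation of the costs from their means under the path flow `f`. -/
noncomputable def deviation (μ : Measure S) (c : E → ℝ → S → ℝ) (f : ∀ i, G.Route i → ℝ) (s : S) :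
    E → ℝ := fun e => c e (G.load f e) s - meanCost μ c e (G.load f e)

theorem noiseLevel_nonneg : 0 ≤ G.noiseLevel μ c := Real.sqrt_nonneg _

variable [IsProbabilityMeasure μ] (hc : IsRegularCost c L H)

include hc

theorem measurable_deviation :
    Measurable fun z : (∀ i, G.Route i → ℝ) × S => G.deviation μ c z.1 z.2 :=
  measurable_pi_lambda _ fun e =>
    have hload := ((measurable_pi_apply e).comp G.measurable_load).comp measurable_fst
    ((hc.measurable_uncurry e).comp (hload.prodMk measurable_snd)).sub
      ((hc.continuous_meanCost e).measurable.comp hload)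

theorem exists_routeNorm_deviation_le :
    ∃ b, ∀ f s, G.routeNorm (G.deviation μ c f s) ≤ b := by
  refine ⟨Fintype.card V * (2 * |H|), fun f s => G.routeNorm_le_of_abs_le
    (fun i p => G.walk_length_le i p.2) (by positivity) fun e => ?_⟩
  rw [two_mul]
  exact (abs_sub _ _).trans (add_le_add ((hc.bounded e _ s).trans (le_abs_self H))
    ((hc.abs_meanCost_le e _).trans (le_abs_self H)))

theorem integral_routeNorm_deviation_sq_le {f : ∀ i, G.Route i → ℝ} (hf : G.IsFlow f) :
    ∫ s, G.routeNorm (G.deviation μ c f s) ^ 2 ∂μ ≤ G.noiseLevel μ c ^ 2 := by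
  obtain ⟨b, hb⟩ := G.exists_routeNorm_deviation_le (μ := μ) hc
  have hbdd : BddAbove (Set.range fun f : {f : ∀ i, G.Route i → ℝ // G.IsFlow f} =>
      ∫ s, G.routeNorm (G.deviation μ c f.1 s) ^ 2 ∂μ) := by
    refine ⟨b ^ 2, Set.forall_mem_range.2 fun f => (integral_mono_of_nonneg
      (.of_forall fun s => sq_nonneg _) (integrable_const (b ^ 2))
      (.of_forall fun s => pow_le_pow_left₀ (G.routeNorm_nonneg _) (hb f.1 s) 2)).trans_eq ?_⟩
    simp
  rw [noiseLevel, Real.sq_sqrt (Real.iSup_nonneg fun f => integral_nonneg fun s => sq_nonneg _)]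
  exact le_ciSup hbdd ⟨f, hf⟩

theorem integral_pairing_deviation (f g : ∀ i, G.Route i → ℝ) :
    ∫ s, G.pairing (G.deviation μ c f s) g ∂μ = 0 := by
  have hint (e : E) : Integrable (fun s => G.deviation μ c f s e) μ :=
    (hc.integrable e _).sub (integrable_const _)
  have hmean (e : E) : ∫ s, G.deviation μ c f s e ∂μ = 0 := by
    simp only [deviation, integral_sub (hc.integrable e _) (integrable_const _)]
    simp [meanCost]
  simp only [pairing_eq_sum_load, integral_finsetSum _ fun e _ => (hint e).mul_const _,
    integral_mul_const, hmean, zero_mul, Finset.sum_const_zero]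

theorem abs_potential_le {f : ∀ i, G.Route i → ℝ} (hf : G.IsFlow f) :
    |G.potential μ c f| ≤ Fintype.card E * (H * G.totalDemand) := by
  refine (Finset.abs_sum_le_sum_abs _ _).trans ?_
  refine (Finset.sum_le_card_nsmul _ _ (H * G.totalDemand) fun e _ => ?_).trans_eq
    (by rw [Finset.card_univ, nsmul_eq_mul])
  obtain ⟨hload_nonneg, hload_le⟩ := hf.load_mem e
  have hint := intervalIntegral.norm_integral_le_of_norm_le_const (a := 0) (b := G.load f e)
    (f := meanCost μ c e) (C := H) fun x _ => hc.abs_meanCost_le e x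
  rw [Real.norm_eq_abs, sub_zero, abs_of_nonneg hload_nonneg] at hint
  exact hint.trans (mul_le_mul_of_nonneg_left hload_le
    ((abs_nonneg _).trans (hc.abs_meanCost_le (μ := μ) e 0)))

section Adapted

variable {ι : Type*} {F Q : (ι → S) → ∀ i, G.Route i → ℝ} {J : Finset ι} {k : ι}

theorem integrable_routeNorm_deviation_sq (hF : Measurable F) (k : ι) :
    Integrable (fun ζ => G.routeNorm (G.deviation μ c (F ζ) (ζ k)) ^ 2)
      (Measure.infinitePi fun _ => μ) := by
  obtain ⟨b, hb⟩ := G.exists_routeNorm_deviation_le (μ := μ) hc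
  refine .of_bound ((G.measurable_routeNorm.comp ((G.measurable_deviation hc).comp
    (hF.prodMk (measurable_pi_apply k)))).pow_const 2).aestronglyMeasurable (b ^ 2)
    (.of_forall fun ζ => ?_)
  rw [Real.norm_of_nonneg (sq_nonneg _)]
  exact pow_le_pow_left₀ (G.routeNorm_nonneg _) (hb _ _) 2

theorem integral_infinitePi_routeNorm_deviation_sq_le (hF : Measurable F)
    (hflow : ∀ ζ, G.IsFlow (F ζ)) (hFJ : DependsOn F J) (hk : k ∉ J) :
    ∫ ζ, G.routeNorm (G.deviation μ c (F ζ) (ζ k)) ^ 2 ∂Measure.infinitePi (fun _ => μ) ≤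
      G.noiseLevel μ c ^ 2 := by
  obtain ⟨b, hb⟩ := G.exists_routeNorm_deviation_le (μ := μ) hc
  have hmeas : Measurable (Function.uncurry fun (ζ : ι → S) s =>
      G.routeNorm (G.deviation μ c (F ζ) s) ^ 2) :=
    (G.measurable_routeNorm.comp ((G.measurable_deviation hc).comp
      ((hF.comp measurable_fst).prodMk measurable_snd))).pow_const 2
  rw [integral_infinitePi_eq_of_dependsOn (fun _ => μ) hk hmeas
    (fun ζ ζ' h => by simp only [hFJ h]) (b := b ^ 2) fun ζ s => ?_]
  · refine (integral_mono_of_nonneg (.of_forall fun ζ => integral_nonneg fun s => sq_nonneg _)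
      (integrable_const (G.noiseLevel μ c ^ 2))
      (.of_forall fun ζ => G.integral_routeNorm_deviation_sq_le hc (hflow ζ))).trans_eq ?_
    simp
  · rw [abs_of_nonneg (sq_nonneg _)]
    exact pow_le_pow_left₀ (G.routeNorm_nonneg _) (hb _ _) 2

theorem integrable_pairing_deviation (hF : Measurable F) (hQ : Measurable Q)
    (hflow : ∀ ζ, G.IsFlow (Q ζ)) (k : ι) :
    Integrable (fun ζ => G.pairing (G.deviation μ c (F ζ) (ζ k)) (Q ζ))
      (Measure.infinitePi fun _ => μ) := by
  obtain ⟨b, hb⟩ := G.exists_routeNorm_deviation_le (μ := μ) hc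
  exact .of_bound (G.measurable_pairing.comp (((G.measurable_deviation hc).comp
    (hF.prodMk (measurable_pi_apply k))).prodMk hQ)).aestronglyMeasurable (b * G.totalDemand)
    (.of_forall fun ζ => ((hflow ζ).abs_pairing_le _).trans
      (mul_le_mul_of_nonneg_right (hb _ _) G.totalDemand_nonneg))

theorem integral_infinitePi_pairing_deviation (hF : Measurable F) (hQ : Measurable Q)
    (hflow : ∀ ζ, G.IsFlow (Q ζ)) (hFJ : DependsOn F J) (hQJ : DependsOn Q J) (hk : k ∉ J) :
    ∫ ζ, G.pairing (G.deviation μ c (F ζ) (ζ k)) (Q ζ) ∂Measure.infinitePi (fun _ => μ) = 0 := by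
  obtain ⟨b, hb⟩ := G.exists_routeNorm_deviation_le (μ := μ) hc
  have hmeas : Measurable (Function.uncurry fun (ζ : ι → S) s =>
      G.pairing (G.deviation μ c (F ζ) s) (Q ζ)) :=
    G.measurable_pairing.comp (((G.measurable_deviation hc).comp
      ((hF.comp measurable_fst).prodMk measurable_snd)).prodMk (hQ.comp measurable_fst))
  rw [integral_infinitePi_eq_of_dependsOn (fun _ => μ) hk hmeas
    (fun ζ ζ' h => by simp only [hFJ h, hQJ h]) fun ζ s => ((hflow ζ).abs_pairing_le _).trans
      (mul_le_mul_of_nonneg_right (hb _ _) G.totalDemand_nonneg)]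
  simp only [G.integral_pairing_deviation hc, integral_zero]

end Adapted

end Deviation

section Run

/-- The states of nature observed before epoch `t + 1`. -/
def past (t : ℕ) : Finset (ℕ × Bool) := Finset.range (t + 1) ×ˢ Finset.univ

theorem mem_past {t : ℕ} {k : ℕ × Bool} : k ∈ past t ↔ k.1 ≤ t := by simp [past]

theorem dependsOn_pathRun {S : Type*} (c : E → ℝ → S → ℝ) (t : ℕ) :
    DependsOn (fun ζ => G.pathRun c ζ t) (past t) := by
  induction t with
  | zero => exact fun ζ ζ' _ => rfl
  | succ t ih =>
    intro ζ ζ' h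
    have hpast : G.pathRun c ζ t = G.pathRun c ζ' t :=
      ih fun k hk => h k (mem_past.2 ((mem_past.1 hk).trans t.le_succ))
    simp only [pathRun, hpast, h (t + 1, false) (mem_past.2 le_rfl),
      h (t + 1, true) (mem_past.2 le_rfl)]

theorem dependsOn_runTestFlow {S : Type*} (c : E → ℝ → S → ℝ) (t : ℕ) :
    DependsOn (fun ζ => G.runTestFlow c ζ t) (past t) := fun ζ ζ' h => by
  simp only [runTestFlow, G.dependsOn_pathRun c t h]

theorem dependsOn_runFlow {S : Type*} (c : E → ℝ → S → ℝ) (t : ℕ) :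
    DependsOn (fun ζ => G.runFlow c ζ t) (insert (t + 1, false) (past t) : Finset _) :=
  fun ζ ζ' h => by
    have hpast : G.pathRun c ζ t = G.pathRun c ζ' t :=
      G.dependsOn_pathRun c t fun k hk => h k (Finset.mem_insert_of_mem hk)
    simp only [runFlow, hpast, h _ (Finset.mem_insert_self _ _)]

theorem dependsOn_runPoint {S : Type*} (c : E → ℝ → S → ℝ) (t : ℕ) :
    DependsOn (fun ζ => G.runPoint c ζ t) (insert (t + 1, false) (past t) : Finset _) :=
  fun ζ ζ' h => by
    have hpast : G.pathRun c ζ t = G.pathRun c ζ' t :=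
      G.dependsOn_pathRun c t fun k hk => h k (Finset.mem_insert_of_mem hk)
    simp only [runPoint, hpast, h _ (Finset.mem_insert_self _ _)]

variable {S : Type*} [MeasurableSpace S] {μ : Measure S} [IsProbabilityMeasure μ]
  {c : E → ℝ → S → ℝ} {L H : ℝ} (hc : IsRegularCost c L H)

include hc

theorem integrable_potential_runFlow (T : ℕ) :
    Integrable (fun ζ => G.potential μ c (G.runFlow c ζ T)) (Measure.infinitePi fun _ => μ) :=
  .of_bound ((G.measurable_potential hc).comp (G.measurable_runFlow hc T)).aestronglyMeasurable _
    (.of_forall fun ζ => G.abs_potential_le hc (G.isFlow_runFlow c ζ T))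

theorem integrable_routeNorm_runNoise_sq (t : ℕ) :
    Integrable (fun ζ => G.routeNorm (G.runNoise μ c ζ t) ^ 2) (Measure.infinitePi fun _ => μ) :=
  G.integrable_routeNorm_deviation_sq hc (G.measurable_runFlow hc t) (t + 1, true)

theorem integrable_routeNorm_runTestNoise_sq (t : ℕ) :
    Integrable (fun ζ => G.routeNorm (G.runTestNoise μ c ζ t) ^ 2)
      (Measure.infinitePi fun _ => μ) :=
  G.integrable_routeNorm_deviation_sq hc (G.measurable_runTestFlow hc t) (t + 1, false)

theorem integral_routeNorm_runNoise_sq_le (t : ℕ) :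
    ∫ ζ, G.routeNorm (G.runNoise μ c ζ t) ^ 2 ∂Measure.infinitePi (fun _ => μ) ≤
      G.noiseLevel μ c ^ 2 :=
  G.integral_infinitePi_routeNorm_deviation_sq_le hc (k := (t + 1, true))
    (G.measurable_runFlow hc t) (G.isFlow_runFlow c · t) (G.dependsOn_runFlow c t)
    (by simp [mem_past])

theorem integral_routeNorm_runTestNoise_sq_le (t : ℕ) :
    ∫ ζ, G.routeNorm (G.runTestNoise μ c ζ t) ^ 2 ∂Measure.infinitePi (fun _ => μ) ≤
      G.noiseLevel μ c ^ 2 :=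
  G.integral_infinitePi_routeNorm_deviation_sq_le hc (k := (t + 1, false))
    (G.measurable_runTestFlow hc t) (G.isFlow_runTestFlow c · t) (G.dependsOn_runTestFlow c t)
    (by simp [mem_past])

theorem integrable_pairing_runNoise_sub (t : ℕ) {f : ∀ i, G.Route i → ℝ} (hf : G.IsFlow f) :
    Integrable (fun ζ => G.pairing (G.runNoise μ c ζ t) (G.runPoint c ζ t) -
      G.pairing (G.runNoise μ c ζ t) f) (Measure.infinitePi fun _ => μ) :=
  (G.integrable_pairing_deviation hc (G.measurable_runFlow hc t) (G.measurable_runPoint hc t)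
    (fun _ => G.isFlow_logit _) (t + 1, true)).sub
  (G.integrable_pairing_deviation hc (G.measurable_runFlow hc t) measurable_const
    (fun _ => hf) (t + 1, true))

theorem integral_pairing_runNoise_sub (t : ℕ) {f : ∀ i, G.Route i → ℝ} (hf : G.IsFlow f) :
    ∫ ζ, (G.pairing (G.runNoise μ c ζ t) (G.runPoint c ζ t) - G.pairing (G.runNoise μ c ζ t) f)
      ∂Measure.infinitePi (fun _ => μ) = 0 := by
  have hfresh : (t + 1, true) ∉ insert (t + 1, false) (past t) := by simp [mem_past]
  have hpoint := G.integral_infinitePi_pairing_deviation (μ := μ) hc (G.measurable_runFlow hc t)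
    (G.measurable_runPoint hc t) (fun _ => G.isFlow_logit _) (G.dependsOn_runFlow c t)
    (G.dependsOn_runPoint c t) hfresh
  have htarget := G.integral_infinitePi_pairing_deviation (μ := μ) hc (G.measurable_runFlow hc t)
    measurable_const (fun _ => hf) (G.dependsOn_runFlow c t) (fun _ _ _ => rfl) hfresh
  have hint_point := G.integrable_pairing_deviation (μ := μ) hc (G.measurable_runFlow hc t)
    (G.measurable_runPoint hc t) (fun _ => G.isFlow_logit _) (t + 1, true)
  have hint_target := G.integrable_pairing_deviation (μ := μ) hc (G.measurable_runFlow hc t)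
    measurable_const (fun _ => hf) (t + 1, true)
  exact (integral_sub hint_point hint_target).trans (by rw [hpoint, htarget, sub_zero])

theorem integrable_noiseVariation (T : ℕ) :
    Integrable (fun ζ => G.noiseVariation μ c ζ T) (Measure.infinitePi fun _ => μ) := by
  refine integrable_finsetSum _ fun t _ => ?_
  simp only [mul_pow]
  refine Integrable.const_mul (Integrable.mono'
    (((G.integrable_routeNorm_runNoise_sq hc t).add
      (G.integrable_routeNorm_runTestNoise_sq hc t)).const_mul 2) ?_
    (.of_forall fun ζ => ?_)) _
  · exact ((G.measurable_routeNorm.comp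
      (((G.measurable_deviation hc).comp ((G.measurable_runFlow hc t).prodMk
        (measurable_pi_apply (t + 1, true)))).sub
      ((G.measurable_deviation hc).comp ((G.measurable_runTestFlow hc t).prodMk
        (measurable_pi_apply (t + 1, false)))))).pow_const 2).aestronglyMeasurable
  · rw [Real.norm_of_nonneg (sq_nonneg _)]
    exact G.routeNorm_sub_sq_le _ _

theorem integral_noiseVariation_le (T : ℕ) :
    ∫ ζ, G.noiseVariation μ c ζ T ∂Measure.infinitePi (fun _ => μ) ≤
      4 * G.noiseLevel μ c ^ 2 * T ^ 3 := by
  have hint (t : ℕ) := (G.integrable_routeNorm_runNoise_sq (μ := μ) hc t).fun_add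
    (G.integrable_routeNorm_runTestNoise_sq hc t)
  have hsum (t : ℕ) : ∫ ζ, (G.routeNorm (G.runNoise μ c ζ t) ^ 2 +
      G.routeNorm (G.runTestNoise μ c ζ t) ^ 2) ∂Measure.infinitePi (fun _ => μ) ≤
        2 * G.noiseLevel μ c ^ 2 := by
    rw [integral_add (G.integrable_routeNorm_runNoise_sq hc t)
      (G.integrable_routeNorm_runTestNoise_sq hc t), two_mul]
    exact add_le_add (G.integral_routeNorm_runNoise_sq_le hc t)
      (G.integral_routeNorm_runTestNoise_sq_le hc t)
  calc ∫ ζ, G.noiseVariation μ c ζ T ∂Measure.infinitePi (fun _ => μ)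
      ≤ ∫ ζ, ∑ t ∈ Finset.range T, 2 * ((t : ℝ) + 1) ^ 2 * (G.routeNorm (G.runNoise μ c ζ t) ^ 2 +
          G.routeNorm (G.runTestNoise μ c ζ t) ^ 2) ∂Measure.infinitePi (fun _ => μ) := by
        refine integral_mono (G.integrable_noiseVariation hc T)
          (integrable_finsetSum _ fun t _ => (hint t).const_mul _) fun ζ =>
            Finset.sum_le_sum fun t _ => ?_
        rw [mul_pow, mul_assoc, mul_left_comm]
        exact mul_le_mul_of_nonneg_left (G.routeNorm_sub_sq_le _ _) (sq_nonneg _)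
    _ = ∑ t ∈ Finset.range T, 2 * ((t : ℝ) + 1) ^ 2 * ∫ ζ, (G.routeNorm (G.runNoise μ c ζ t) ^ 2 +
          G.routeNorm (G.runTestNoise μ c ζ t) ^ 2) ∂Measure.infinitePi (fun _ => μ) := by
        rw [integral_finsetSum _ fun t _ => (hint t).const_mul _]
        simp only [integral_const_mul]
    _ ≤ ∑ t ∈ Finset.range T, 2 * (T : ℝ) ^ 2 * (2 * G.noiseLevel μ c ^ 2) :=
        Finset.sum_le_sum fun t ht => by
          have hstep : (t : ℝ) + 1 ≤ T := by exact_mod_cast Finset.mem_range.1 ht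
          gcongr
          exact hsum t
    _ = 4 * G.noiseLevel μ c ^ 2 * T ^ 3 := by
        rw [Finset.sum_const, Finset.card_range, nsmul_eq_mul]
        ring

theorem integral_sqrt_noiseVariation_le (T : ℕ) :
    ∫ ζ, √(2 * G.noiseVariation μ c ζ T) ∂Measure.infinitePi (fun _ => μ) ≤
      3 * G.noiseLevel μ c * (T * √T) := by
  have hσ := G.noiseLevel_nonneg (μ := μ) (c := c)
  refine (integral_sqrt_le ((G.integrable_noiseVariation hc T).const_mul 2) fun ζ =>
    mul_nonneg zero_le_two (Finset.sum_nonneg fun t _ => sq_nonneg _)).trans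
      (Real.sqrt_le_iff.2 ⟨by positivity, ?_⟩)
  rw [integral_const_mul, mul_pow, mul_pow, mul_pow, Real.sq_sqrt (Nat.cast_nonneg T)]
  have hscale : 0 ≤ G.noiseLevel μ c ^ 2 * (T : ℝ) ^ 3 := by positivity
  linarith [G.integral_noiseVariation_le (μ := μ) hc T]

theorem stepTotal_mul_integral_potential_sub_le (hN : 1 ≤ N) (hL : 0 ≤ L) {K : ℕ}
    (hK : ∀ i (p : G.Route i), p.1.length ≤ K) (T : ℕ) {f : ∀ i, G.Route i → ℝ}
    (hf : G.IsFlow f) :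
    stepTotal T * (∫ ζ, G.potential μ c (G.runFlow c ζ T) ∂Measure.infinitePi (fun _ => μ) -
        G.potential μ c f) ≤
      G.rateConst * √G.rateConst * (1 + 8 * K ^ 2 * L ^ 2 * G.totalDemand) +
        G.rateConst * (3 * G.noiseLevel μ c * ((T + 1) * √(T + 1))) := by
  have hpotential := G.integrable_potential_runFlow (μ := μ) hc T
  have hsqrt := ((memLp_two_sqrt ((G.integrable_noiseVariation (μ := μ) hc (T + 1)).const_mul
    2)).integrable one_le_two).const_mul G.rateConst
  have hnoise (t : ℕ) := (G.integrable_pairing_runNoise_sub (μ := μ) hc t hf).const_mul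
    ((t : ℝ) + 1)
  have hmain := integral_mono ((hpotential.sub (integrable_const _)).const_mul (stepTotal T))
    (((integrable_const _).fun_add hsqrt).sub (integrable_finsetSum _ fun t _ => hnoise t))
    fun ζ => G.stepTotal_mul_potential_sub_le ζ hN hL hK hc T hf
  simp only [Pi.sub_apply] at hmain
  rw [integral_const_mul, integral_sub hpotential (integrable_const _),
    integral_sub ((integrable_const _).fun_add hsqrt) (integrable_finsetSum _ fun t _ => hnoise t),
    integral_add (integrable_const _) hsqrt, integral_finsetSum _ fun t _ => hnoise t] at hmain
  simp only [integral_const_mul, integral_const, probReal_univ, one_smul,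
    G.integral_pairing_runNoise_sub hc _ hf, mul_zero, Finset.sum_const_zero, sub_zero] at hmain
  have hvariation := mul_le_mul_of_nonneg_left (G.integral_sqrt_noiseVariation_le (μ := μ) hc
    (T + 1)) (zero_le_one.trans G.one_le_rateConst)
  push_cast at hvariation
  linarith

end Run

end RoutingNetwork

namespace RoutingNetwork

variable {V E : Type} [Fintype V] [DecidableEq V] [Fintype E] [DecidableEq E] {N : ℕ}
  (G : RoutingNetwork V E N)

section Clamp

variable {S : Type*} (c : E → ℝ → S → ℝ)

/-- The cost functions continued by constants outside the range of possible loads.  A cost model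
constrains the costs only on this range, the analysis uses them at all loads. -/
noncomputable def clampCost (e : E) (x : ℝ) (s : S) : ℝ :=
  c e (Set.projIcc 0 G.totalDemand G.totalDemand_nonneg x) s

theorem clampCost_of_mem {x : ℝ} (hx : x ∈ Set.Icc 0 G.totalDemand) (e : E) :
    G.clampCost c e x = c e x := by
  ext s
  rw [clampCost, Set.projIcc_of_mem _ hx]

variable {G} in
theorem IsFlow.clampCost_load {f : ∀ i, G.Route i → ℝ} (hf : G.IsFlow f) (e : E) :
    G.clampCost c e (G.load f e) = c e (G.load f e) :=
  G.clampCost_of_mem c (hf.load_mem e) e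

namespace PathState

variable {G} {s : G.PathState} {t : ℕ} (hs : ∀ θ, G.IsFlow (s.averageFlow t θ))

include hs

theorem testCost_clampCost (x : S) : s.testCost (G.clampCost c) t x = s.testCost c t x :=
  funext fun e => congrFun ((hs _).clampCost_load c e) x

theorem score_clampCost (x : S) : s.score (G.clampCost c) t x = s.score c t x := by
  rw [score, score, testCost_clampCost c hs]

theorem flow_clampCost (x : S) : s.flow (G.clampCost c) t x = s.flow c t x := by
  rw [flow, flow, score_clampCost c hs]

theorem cost_clampCost (x x' : S) : s.cost (G.clampCost c) t x x' = s.cost c t x x' := by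
  ext e
  rw [cost, cost, flow_clampCost c hs]
  exact congrFun ((hs _).clampCost_load c e) x'

theorem next_clampCost (x x' : S) : s.next (G.clampCost c) t x x' = s.next c t x x' := by
  simp only [next, testCost_clampCost c hs, score_clampCost c hs, cost_clampCost c hs]

end PathState

theorem pathRun_clampCost (ζ : ℕ × Bool → S) (t : ℕ) :
    G.pathRun (G.clampCost c) ζ t = G.pathRun c ζ t := by
  induction t with
  | zero => rfl
  | succ t ih => rw [pathRun, pathRun, ih, PathState.next_clampCost c (G.isFlow_averageFlow c ζ t)]

theorem runFlow_clampCost (ζ : ℕ × Bool → S) (t : ℕ) :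
    G.runFlow (G.clampCost c) ζ t = G.runFlow c ζ t := by
  rw [runFlow, runFlow, pathRun_clampCost,
    PathState.flow_clampCost c (G.isFlow_averageFlow c ζ t)]

variable [MeasurableSpace S]

variable {G c} in
theorem IsCostModel.exists_isRegularCost_clampCost {L : ℝ} (hc : G.IsCostModel c L) :
    ∃ H, IsRegularCost (G.clampCost c) |L| H := by
  obtain ⟨H, hH⟩ := hc.bounded
  exact ⟨H, {
    measurable := fun e x => hc.measurable e _ (Subtype.coe_prop _)
    monotone := fun e s x y h =>
      hc.monotone e s (Subtype.coe_prop _) (Subtype.coe_prop _) (Set.monotone_projIcc _ h)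
    bounded := fun e x s => hH e s _ (Subtype.coe_prop _)
    lipschitz := fun e s x y =>
      (hc.lipschitz e s _ (Subtype.coe_prop _) _ (Subtype.coe_prop _)).trans
        (mul_le_mul (le_abs_self L) (Set.abs_projIcc_sub_projIcc G.totalDemand_nonneg)
          (abs_nonneg _) (abs_nonneg _)) }⟩

variable (μ : Measure S)

theorem meanCost_clampCost {x : ℝ} (hx : x ∈ Set.Icc 0 G.totalDemand) (e : E) :
    meanCost μ (G.clampCost c) e x = meanCost μ c e x := by
  rw [meanCost, meanCost, G.clampCost_of_mem c hx]

theorem potential_clampCost {f : ∀ i, G.Route i → ℝ} (hf : G.IsFlow f) :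
    G.potential μ (G.clampCost c) f = G.potential μ c f := by
  refine Finset.sum_congr rfl fun e _ => intervalIntegral.integral_congr fun x hx => ?_
  obtain ⟨hload_nonneg, hload_le⟩ := hf.load_mem e
  rw [Set.uIcc_of_le hload_nonneg] at hx
  exact G.meanCost_clampCost c μ ⟨hx.1, hx.2.trans hload_le⟩ e

theorem gap_clampCost {f : ∀ i, G.Route i → ℝ} (hf : G.IsFlow f) :
    G.gap μ (G.clampCost c) f = G.gap μ c f := by
  rw [gap, gap, G.potential_clampCost c μ hf,
    Set.image_congr (s := {g | G.IsFlow g}) fun g hg => G.potential_clampCost c μ hg]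

theorem noiseLevel_clampCost : G.noiseLevel μ (G.clampCost c) = G.noiseLevel μ c := by
  rw [noiseLevel, noiseLevel]
  congr 2 with f
  simp only [f.2.clampCost_load c, G.meanCost_clampCost c μ (f.2.load_mem _)]

theorem gap_adaLightFlow (ζ : ℕ × Bool → S) (t : ℕ) :
    G.gap μ c (G.adaLightFlow c ζ (t + 1)) =
      G.gap μ (G.clampCost c) (G.runFlow (G.clampCost c) ζ t) := by
  rw [G.gap_clampCost c μ (G.isFlow_runFlow _ ζ t), runFlow_clampCost]
  simp only [gap, potential, load_adaLightFlow]

end Clamp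

/-! ## Convergence rates -/

theorem nonempty_flows : {f | G.IsFlow f}.Nonempty := ⟨G.logit 0, G.isFlow_logit 0⟩

variable {G} in
theorem IsFlow.eq_of_numRoutes_le_one (h : G.numRoutes ≤ 1) {f g : ∀ i, G.Route i → ℝ}
    (hf : G.IsFlow f) (hg : G.IsFlow g) : f = g := by
  ext i p
  have hcard : Fintype.card (G.Route i) ≤ 1 :=
    (Finset.single_le_sum (f := fun i => Fintype.card (G.Route i)) (fun _ _ => Nat.zero_le _)
      (Finset.mem_univ i)).trans h
  have := Fintype.card_le_one_iff_subsingleton.1 hcard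
  rw [← Fintype.sum_subsingleton (f i) p, ← Fintype.sum_subsingleton (g i) p, (hf i).2, (hg i).2]

variable {G} in
theorem IsFlow.gap_eq_zero_of_numRoutes_le_one (h : G.numRoutes ≤ 1) {S : Type*}
    [MeasurableSpace S] (μ : Measure S) (c : E → ℝ → S → ℝ) {f : ∀ i, G.Route i → ℝ}
    (hf : G.IsFlow f) : G.gap μ c f = 0 := by
  have hflows : {g | G.IsFlow g} = {f} :=
    Set.eq_singleton_iff_unique_mem.2 ⟨hf, fun g hg => hg.eq_of_numRoutes_le_one h hf⟩
  rw [gap, hflows, Set.image_singleton, csInf_singleton, sub_self]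

variable {G} in
theorem pos_of_two_le_numRoutes (h : 2 ≤ G.numRoutes) : 1 ≤ N := by
  rcases Nat.eq_zero_or_pos N with rfl | hN
  · simp [numRoutes] at h
  · exact hN

variable {G} in
theorem totalDemand_le {M : ℝ} (hM : ∀ i, G.demand i ≤ M) : G.totalDemand ≤ N * |M| := by
  refine (Finset.sum_le_card_nsmul _ _ |M| fun i _ => (hM i).trans (le_abs_self M)).trans_eq ?_
  simp

end RoutingNetwork

theorem mul_sqrt_eq_rpow {x : ℝ} (hx : 0 < x) : x * √x = x ^ (3 / 2 : ℝ) := by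
  rw [Real.sqrt_eq_rpow, show (3 / 2 : ℝ) = 1 + 1 / 2 by norm_num, Real.rpow_add hx, Real.rpow_one]

theorem le_rate_of_stepTotal_mul_le {g Q b σ : ℝ} {T : ℕ} (hQ : 0 ≤ Q) (hb : 0 ≤ b) (hσ : 0 ≤ σ)
    (h : stepTotal T * g ≤ Q * (b + 3 * σ * ((T + 1) * √(T + 1)))) :
    g ≤ Q * (2 * b + 6) * (σ / √(T + 1) + 1 / (T + 1 : ℝ) ^ 2) := by
  have hstep : (T + 1 : ℝ) ^ 2 / 2 ≤ stepTotal T := by rw [stepTotal]; nlinarith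
  have hscale : (T + 1 : ℝ) ^ 2 * (σ / √(T + 1) + 1 / (T + 1 : ℝ) ^ 2) =
      σ * ((T + 1) * √(T + 1)) + 1 := by
    rw [mul_add, mul_one_div_cancel (by positivity), mul_div_left_comm, sq, mul_div_assoc,
      Real.div_sqrt]
  refine le_of_mul_le_mul_left (h.trans ?_) (stepTotal_pos T)
  calc Q * (b + 3 * σ * ((T + 1) * √(T + 1)))
      ≤ Q * ((b + 3) * (σ * ((T + 1) * √(T + 1)) + 1)) := by
        have : 0 ≤ b * (σ * ((T + 1) * √(T + 1))) := by positivity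
        gcongr
        linarith
    _ = (T + 1 : ℝ) ^ 2 / 2 * (Q * (2 * b + 6) * (σ / √(T + 1) + 1 / (T + 1 : ℝ) ^ 2)) := by
        rw [← hscale]; ring
    _ ≤ stepTotal T * (Q * (2 * b + 6) * (σ / √(T + 1) + 1 / (T + 1 : ℝ) ^ 2)) := by gcongr

theorem mul_sub_sInf_le_of_forall {A : Set ℝ} (hA : A.Nonempty) {x b s : ℝ} (hs : 0 < s)
    (h : ∀ y ∈ A, s * (x - y) ≤ b) : s * (x - sInf A) ≤ b := by
  have : x - b / s ≤ sInf A := le_csInf hA fun y hy => by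
    linarith [(le_div_iff₀' hs).2 (h y hy)]
  rw [← le_div_iff₀' hs]
  linarith

/-- The factor by which the constant of the rates depends on the number of pairs and the demands.
The division by `log 2` absorbs additive constants into the logarithm of the number of routes. -/
noncomputable def demandFactor (N : ℕ) (M : ℝ) : ℝ := N * |M| + (4 * (N * |M|) + 1) / Real.log 2

theorem demandFactor_nonneg (N : ℕ) (M : ℝ) : 0 ≤ demandFactor N M := by
  have := Real.log_pos one_lt_two
  unfold demandFactor
  positivity

/-- The constant of the convergence rates. -/
noncomputable def convergenceConst (N K : ℕ) (L M : ℝ) : ℝ :=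
  demandFactor N M ^ (3 / 2 : ℝ) * (2 * (1 + 8 * K ^ 2 * |L| ^ 2 * (N * |M|)) + 6)

namespace RoutingNetwork

variable {V E : Type} [Fintype V] [DecidableEq V] [Fintype E] [DecidableEq E] {N : ℕ}
  {G : RoutingNetwork V E N} {M : ℝ} (hM : ∀ i, G.demand i ≤ M) (h : 2 ≤ G.numRoutes)

include hM h

theorem rateConst_le : G.rateConst ≤ demandFactor N M * Real.log G.numRoutes := by
  have hlog : Real.log 2 ≤ Real.log G.numRoutes :=
    Real.log_le_log zero_lt_two (by exact_mod_cast h)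
  have hlog₂ := Real.log_pos one_lt_two
  have hdemand := totalDemand_le hM
  have hlogPartition : G.logPartition 0 ≤ N * |M| * Real.log G.numRoutes :=
    G.logPartition_zero_le.trans (mul_le_mul_of_nonneg_right hdemand (hlog₂.le.trans hlog))
  have habsorb : 4 * (N * |M|) + 1 ≤ (4 * (N * |M|) + 1) / Real.log 2 * Real.log G.numRoutes := by
    rw [div_mul_eq_mul_div, le_div_iff₀ hlog₂]
    gcongr
  rw [demandFactor, add_mul, rateConst]
  linarith

theorem rateConst_mul_sqrt_le : G.rateConst * √G.rateConst ≤
    demandFactor N M ^ (3 / 2 : ℝ) * Real.log G.numRoutes ^ (3 / 2 : ℝ) := by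
  have hone := G.one_le_rateConst
  rw [mul_sqrt_eq_rpow (by linarith),
    ← Real.mul_rpow (demandFactor_nonneg N M) (Real.log_natCast_nonneg _)]
  exact Real.rpow_le_rpow (by linarith) (rateConst_le hM h) (by norm_num)

theorem le_convergenceConst_mul {K : ℕ} {L g σ : ℝ} {T : ℕ} (hσ : 0 ≤ σ)
    (hg : stepTotal T * g ≤
      G.rateConst * √G.rateConst * (1 + 8 * K ^ 2 * |L| ^ 2 * G.totalDemand) +
        G.rateConst * (3 * σ * ((T + 1) * √(T + 1)))) :
    g ≤ convergenceConst N K L M * Real.log G.numRoutes ^ (3 / 2 : ℝ) *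
      (σ / √(T + 1) + 1 / (T + 1 : ℝ) ^ 2) := by
  have hconst := rateConst_mul_sqrt_le hM h
  have hone := G.one_le_rateConst
  have hdemand := totalDemand_le hM
  refine (le_rate_of_stepTotal_mul_le (Q := demandFactor N M ^ (3 / 2 : ℝ) *
    Real.log G.numRoutes ^ (3 / 2 : ℝ)) (b := 1 + 8 * K ^ 2 * |L| ^ 2 * (N * |M|))
    ((by positivity : 0 ≤ G.rateConst * √G.rateConst).trans hconst) (by positivity) hσ
    (hg.trans ?_)).trans_eq (by rw [convergenceConst]; ring)
  calc G.rateConst * √G.rateConst * (1 + 8 * K ^ 2 * |L| ^ 2 * G.totalDemand) +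
        G.rateConst * (3 * σ * ((T + 1) * √(T + 1)))
      ≤ G.rateConst * √G.rateConst * (1 + 8 * K ^ 2 * |L| ^ 2 * (N * |M|)) +
        G.rateConst * √G.rateConst * (3 * σ * ((T + 1) * √(T + 1))) := by
        gcongr
        exact le_mul_of_one_le_right (by linarith) (Real.one_le_sqrt.2 hone)
    _ = G.rateConst * √G.rateConst * (1 + 8 * K ^ 2 * |L| ^ 2 * (N * |M|) +
        3 * σ * ((T + 1) * √(T + 1))) := by ring
    _ ≤ _ := by gcongr

end RoutingNetwork

namespace RoutingNetwork

theorem meanCost_of_static {E : Type} {S : Type*} [MeasurableSpace S] {μ : Measure S}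
    [IsProbabilityMeasure μ] {c : E → ℝ → S → ℝ} (hstatic : ∀ e x s s', c e x s = c e x s')
    (e : E) (x : ℝ) (s : S) : meanCost μ c e x = c e x s := by
  simp [meanCost, fun s' => hstatic e x s' s]

variable {V E : Type} [Fintype V] [DecidableEq V] [Fintype E] [DecidableEq E] {N : ℕ}
  {G : RoutingNetwork V E N} {K : ℕ} {L M : ℝ} {S : Type*} [MeasurableSpace S] {μ : Measure S}
  [IsProbabilityMeasure μ] {c : E → ℝ → S → ℝ}

theorem stepTotal_mul_potential_sub_le_of_static {H : ℝ} (hN : 1 ≤ N) (hL : 0 ≤ L)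
    (hK : ∀ i (p : G.Route i), p.1.length ≤ K) (hc : IsRegularCost c L H)
    (hstatic : ∀ e x s s', c e x s = c e x s') (ζ : ℕ × Bool → S) (T : ℕ)
    {f : ∀ i, G.Route i → ℝ} (hf : G.IsFlow f) :
    stepTotal T * (G.potential μ c (G.runFlow c ζ T) - G.potential μ c f) ≤
      G.rateConst * √G.rateConst * (1 + 8 * K ^ 2 * L ^ 2 * G.totalDemand) := by
  have hnoise (t : ℕ) : G.runNoise μ c ζ t = 0 :=
    funext fun e => sub_eq_zero.2 (meanCost_of_static hstatic e _ _).symm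
  have htestNoise (t : ℕ) : G.runTestNoise μ c ζ t = 0 :=
    funext fun e => sub_eq_zero.2 (meanCost_of_static hstatic e _ _).symm
  have hnorm : G.routeNorm 0 = 0 :=
    le_antisymm (G.routeNorm_le le_rfl fun i p => by simp) (G.routeNorm_nonneg _)
  simpa [noiseVariation, hnoise, htestNoise, hnorm, pairing_zero] using
    G.stepTotal_mul_potential_sub_le (μ := μ) ζ hN hL hK hc T hf

variable (hK : ∀ i (p : G.Route i), p.1.length ≤ K) (hM : ∀ i, G.demand i ≤ M)
  (h : 2 ≤ G.numRoutes) (hc : G.IsCostModel c L)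

include hK hM h hc

theorem gap_adaLightFlow_le_of_static
    (hstatic : ∀ e, ∀ x ∈ Set.Icc 0 G.totalDemand, ∀ s s', c e x s = c e x s')
    (ζ : ℕ × Bool → S) (T : ℕ) :
    G.gap μ c (G.adaLightFlow c ζ (T + 1)) ≤
      convergenceConst N K L M * Real.log G.numRoutes ^ (3 / 2 : ℝ) / (T + 1 : ℝ) ^ 2 := by
  obtain ⟨H, hregular⟩ := hc.exists_isRegularCost_clampCost
  rw [gap_adaLightFlow]
  refine (le_convergenceConst_mul (K := K) (L := L) (T := T) hM h le_rfl ?_).trans_eq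
    (by rw [zero_div, zero_add, mul_one_div])
  refine mul_sub_sInf_le_of_forall (G.nonempty_flows.image _) (stepTotal_pos T)
    (Set.forall_mem_image.2 fun f hf => ?_)
  simpa using stepTotal_mul_potential_sub_le_of_static (pos_of_two_le_numRoutes h) (abs_nonneg L)
    hK hregular (fun e x => hstatic e _ (Subtype.coe_prop _)) ζ T hf

theorem integral_gap_adaLightFlow_le (T : ℕ) :
    ∫ ζ, G.gap μ c (G.adaLightFlow c ζ (T + 1)) ∂Measure.infinitePi (fun _ => μ) ≤
      convergenceConst N K L M * Real.log G.numRoutes ^ (3 / 2 : ℝ) *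
        (G.noiseLevel μ c / √(T + 1) + 1 / (T + 1 : ℝ) ^ 2) := by
  obtain ⟨H, hregular⟩ := hc.exists_isRegularCost_clampCost
  simp only [gap_adaLightFlow]
  simp only [gap]
  rw [integral_sub (G.integrable_potential_runFlow hregular T) (integrable_const _),
    integral_const, probReal_univ, one_smul, ← noiseLevel_clampCost]
  exact le_convergenceConst_mul hM h G.noiseLevel_nonneg (mul_sub_sInf_le_of_forall
    (G.nonempty_flows.image _) (stepTotal_pos T) (Set.forall_mem_image.2 fun f hf =>
      G.stepTotal_mul_integral_potential_sub_le hregular (pos_of_two_le_numRoutes h)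
        (abs_nonneg L) hK T hf))

omit hK hM h in
theorem integrable_gap_adaLightFlow (T : ℕ) :
    Integrable (fun ζ => G.gap μ c (G.adaLightFlow c ζ (T + 1)))
      (Measure.infinitePi fun _ => μ) := by
  obtain ⟨H, hregular⟩ := hc.exists_isRegularCost_clampCost
  simp only [gap_adaLightFlow]
  exact (G.integrable_potential_runFlow hregular T).sub (integrable_const _)

end RoutingNetwork

theorem measurePreserving_infinitePi_of_iIndepFun {ι Ω S : Type*} [MeasurableSpace Ω]
    [MeasurableSpace S] {P : Measure Ω} {μ : Measure S} {X : ι → Ω → S}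
    (hX : ∀ k, Measurable (X k)) (hlaw : ∀ k, P.map (X k) = μ) (hindep : iIndepFun X P) :
    MeasurePreserving (fun ω k => X k ω) P (Measure.infinitePi fun _ => μ) :=
  ⟨measurable_pi_iff.2 hX, by rw [hindep.map_fun_eq_infinitePi_map hX]; simp only [hlaw]⟩

theorem integral_comp_of_measurePreserving {Ω Ω' : Type*} [MeasurableSpace Ω] [MeasurableSpace Ω']
    {P : Measure Ω} {Q : Measure Ω'} {X : Ω → Ω'} (hX : MeasurePreserving X P Q) {g : Ω' → ℝ}
    (hg : Integrable g Q) : ∫ ω, g (X ω) ∂P = ∫ x, g x ∂Q := by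
  rw [← hX.map_eq, integral_map hX.aemeasurable (hX.map_eq ▸ hg.1)]

theorem mainTheorem2 :
    (∀ (N K : ℕ) (L M : ℝ), ∃ C : ℝ,
      ∀ (V E : Type) [Fintype V] [DecidableEq V] [Fintype E] [DecidableEq E]
        (G : RoutingNetwork V E N),
        (∀ i (p : G.Route i), p.1.length ≤ K) → (∀ i, G.demand i ≤ M) →
      ∀ (S : Type*) [MeasurableSpace S] (μ : Measure S) [IsProbabilityMeasure μ]
        (c : E → ℝ → S → ℝ), G.IsCostModel c L →
      ∀ (Ω : Type*) [MeasurableSpace Ω] (P : Measure Ω) [IsProbabilityMeasure P]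
        (ζ : ℕ × Bool → Ω → S),
        (∀ k, Measurable (ζ k)) → (∀ k, P.map (ζ k) = μ) → iIndepFun ζ P →
      ∀ T : ℕ, 1 ≤ T →
        (∀ ω, G.IsFlow (G.adaLightFlow c (fun k => ζ k ω) T)) ∧
        Integrable (fun ω => G.gap μ c (G.adaLightFlow c (fun k => ζ k ω) T)) P ∧
        ∫ ω, G.gap μ c (G.adaLightFlow c (fun k => ζ k ω) T) ∂P ≤
          C * Real.log G.numRoutes ^ (3 / 2 : ℝ) *
            (G.noiseLevel μ c / Real.sqrt T + 1 / (T : ℝ) ^ 2) ∧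
        ((∀ e, ∀ x ∈ Set.Icc 0 G.totalDemand, ∀ s s', c e x s = c e x s') →
          ∀ ω, G.gap μ c (G.adaLightFlow c (fun k => ζ k ω) T) ≤
            C * Real.log G.numRoutes ^ (3 / 2 : ℝ) / (T : ℝ) ^ 2)) ∧
    (∃ C : ℕ,
      ∀ (V E : Type) [Fintype V] [DecidableEq V] [Fintype E] [DecidableEq E] (N : ℕ)
        (G : RoutingNetwork V E N), 1 ≤ N →
        (∀ u : E → ℝ, (G.routeNormProgram u).val = G.routeNorm u) ∧
        ∀ (testCost cost : (Fin N → E → ℝ) → E → ℝ) (α : ℝ) (s : AdaState E N),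
          (G.iteration testCost cost α s).ops ≤
            C * (N * Fintype.card V * Fintype.card E)) := by
  refine ⟨fun N K L M => ⟨convergenceConst N K L M, ?_⟩, 108,
    fun V E _ _ _ _ N G hN => ⟨G.val_routeNormProgram_eq_routeNorm, G.ops_iteration_le hN⟩⟩
  intro V E _ _ _ _ G hK hM S _ μ _ c hc Ω _ P _ ζ hζ hlaw hindep T hT
  obtain ⟨T, rfl⟩ := Nat.exists_eq_add_of_le' hT
  have hflow : ∀ ω, G.IsFlow (G.adaLightFlow c (fun k => ζ k ω) (T + 1)) :=
    fun ω => G.isFlow_adaLightFlow c _ T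
  have hpreserving := measurePreserving_infinitePi_of_iIndepFun hζ hlaw hindep
  have hgap := RoutingNetwork.integrable_gap_adaLightFlow (μ := μ) hc T
  refine ⟨hflow, hpreserving.integrable_comp_of_integrable hgap, ?_⟩
  rcases Nat.lt_or_ge G.numRoutes 2 with h | h
  · have hgap_zero := fun ω => (hflow ω).gap_eq_zero_of_numRoutes_le_one (Nat.lt_succ_iff.1 h) μ c
    have hlog : Real.log G.numRoutes = 0 := by interval_cases G.numRoutes <;> simp
    simp [hgap_zero, hlog]
  · push_cast
    refine ⟨?_, fun hstatic ω =>
      RoutingNetwork.gap_adaLightFlow_le_of_static hK hM h hc hstatic _ T⟩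
    exact (integral_comp_of_measurePreserving hpreserving hgap).trans_le
      (RoutingNetwork.integral_gap_adaLightFlow_le hK hM h hc T)
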